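/- Fix a finite relational schema $\sigma$. A database $D$ over $\sigma$ consists of a finite domain and, for each $R\in\sigma$ of arity $r$, a finite set $R^D$ of $r$-tuples of domain elements; $\|D\|$ denotes its number of tuples. A full conjunctive query $q$ is a finite conjunction (set) of atoms $R(\bar x)$, $R\in\sigma$, all of whose variables are free; every variable of $q$ occurs in an atom. Its set of solutions $q(D)$ consists of the assignments of domain elements to the variables that make every atom of $q$ a fact of $D$. A set of atoms is acyclic if it has a join tree, that is, a tree whose nodes are the atoms such that for each variable the atoms containing it are connected in the tree. An endomorphism of $q$ is a map $\nu$ from the variables of $q$ to the variables of $q$ such that $R(\nu(\bar x))$ is an atom of $q$ for every atom $R(\bar x)$ of $q$; the query $I$ with atoms $R(\nu(\bar x))$, for $R(\bar x)$ an atom of $q$, is then called an image of $q$. The query $q$ is a mirror if it has an acyclic image $I$ such that the atoms of $q$ that are not in $I$ form a query isomorphic to $I$, by an isomorphism (a bijection of the variables carrying the atoms of one query exactly onto those of the other) that fixes every variable occurring in both. Proposition. Every mirror full conjunctive query $q$ can be enumerated with constant delay after linear preprocessing. Precisely, there are a program of a random access machine (integer registers and an integer-addressed memory, initially zero except for the input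 and its length; constants, addition, multiplication, comparisons and jumps, indirect loads and stores, output of a tuple of registers, each in one time unit) and a constant $c$, both depending only on $q$ (and $\sigma$), such that for every database $D$ with natural numbers as elements, and every listing of the relations of $D$ in the memory (for each relation the number of its tuples followed by its tuples, in any order), the program halts; it outputs every solution in $q(D)$ exactly once and nothing else; after an initial phase of at most $c\cdot(\|D\|+1)$ steps without output, from any moment on at most $c$ steps pass until the next output starts or the machine has halted; and all numbers and addresses used are at most $N^c$, where $N$ is $2$ plus the length of the input plus its largest entry. The memory used during the enumeration may be superlinear in the size of the input. -/

import Mathlib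

namespace MirrorCQ

/-! ### Schemas, databases, full conjunctive queries -/

/-- A finite relational schema: finitely many relation symbols, each with an arity. -/
structure Schema where
  numSymbols : ℕ
  arity : Fin numSymbols → ℕ

/-- A database over `S`: a finite domain (of elements named by natural numbers) and, for each
relation symbol `R` of arity `r`, a finite set of `r`-tuples of domain elements. -/
structure Database (S : Schema) where
  dom : Finset ℕ
  rel : (R : Fin S.numSymbols) → Finset (Fin (S.arity R) → ℕ)
  rel_mem_dom : ∀ R, ∀ t ∈ rel R, ∀ j, t j ∈ dom

/-- The size of a database: the number of its facts. -/
def Database.size {S : Schema} (D : Database S) : ℕ := ∑ R, (D.rel R).card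

/-- An atom `R(x̄)` over the variables `Fin n`. Variables may be repeated. -/
abbrev Atom (S : Schema) (n : ℕ) : Type := (R : Fin S.numSymbols) × (Fin (S.arity R) → Fin n)

/-- The set of variables occurring in an atom. -/
def Atom.vars {S : Schema} {n : ℕ} (a : Atom S n) : Set (Fin n) := Set.range a.2

/-- The atom `R(f(x̄))` obtained from `R(x̄)`. -/
def Atom.map {S : Schema} {n : ℕ} (f : Fin n → Fin n) (a : Atom S n) : Atom S n := ⟨a.1, f ∘ a.2⟩

/-- The set of variables occurring in a set of atoms. -/
def varsOf {S : Schema} {n : ℕ} (A : Finset (Atom S n)) : Set (Fin n) :=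
  {x | ∃ a ∈ A, x ∈ Atom.vars a}

/-- A full conjunctive query: a conjunction of atoms, all of whose variables are free. The
variables are named `0, …, numVars - 1`, and each of them occurs in some atom. -/
structure FullCQ (S : Schema) where
  numVars : ℕ
  atoms : Finset (Atom S numVars)
  covered : ∀ x, x ∈ varsOf atoms

/-- The solutions of `q` over `D`, as tuples indexed by the variables of `q`. -/
def FullCQ.solutions {S : Schema} (q : FullCQ S) (D : Database S) : Set (Fin q.numVars → ℕ) :=
  {v | (∀ x, v x ∈ D.dom) ∧ ∀ a ∈ q.atoms, v ∘ a.2 ∈ D.rel a.1}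

/-! ### Acyclicity, images, mirror queries -/

/-- `T` is a join tree for the set `A` of atoms: a tree with node set `A` such that, for each
variable `x`, the nodes whose atoms contain `x` are connected in `T`. (A tree is a connected
acyclic graph; the tree without nodes is allowed, for the empty set of atoms.) -/
def IsJoinTree {S : Schema} {n : ℕ} (A : Finset (Atom S n))
    (T : SimpleGraph {a : Atom S n // a ∈ A}) : Prop :=
  T.Preconnected ∧ T.IsAcyclic ∧
    ∀ x : Fin n, (T.induce {a | x ∈ Atom.vars a.1}).Preconnected

/-- A set of atoms is acyclic if it has a join tree. -/
def IsAcyclic {S : Schema} {n : ℕ} (A : Finset (Atom S n)) : Prop :=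
  ∃ T : SimpleGraph {a : Atom S n // a ∈ A}, IsJoinTree A T

/-- A mapping from the variables of `q` to the variables of `q` that preserves the atoms of `q`. -/
def FullCQ.IsEndomorphism {S : Schema} (q : FullCQ S) (ν : Fin q.numVars → Fin q.numVars) : Prop :=
  ∀ a ∈ q.atoms, Atom.map ν a ∈ q.atoms

/-- `I` is (the set of atoms of) an image of `q`: the subquery that is the image of `q` by some
endomorphism of `q`. -/
def FullCQ.IsImage {S : Schema} (q : FullCQ S) (I : Finset (Atom S q.numVars)) : Prop :=
  ∃ ν, q.IsEndomorphism ν ∧ I = q.atoms.image (Atom.map ν)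

/-- `f` is an isomorphism from the query with atoms `A` to the query with atoms `B`: a bijection
from the variables of `A` onto the variables of `B` that carries the atoms of `A` exactly onto
the atoms of `B`. -/
def IsIsomorphism {S : Schema} {n : ℕ} (f : Fin n → Fin n) (A B : Finset (Atom S n)) : Prop :=
  Set.BijOn f (varsOf A) (varsOf B) ∧ A.image (Atom.map f) = B

/-- `q` is a mirror: it has an acyclic image `I` such that the remaining atoms form a query
isomorphic to `I` by an isomorphism that is the identity on the shared variables. -/
def FullCQ.IsMirror {S : Schema} (q : FullCQ S) : Prop :=
  ∃ I, q.IsImage I ∧ IsAcyclic I ∧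
    ∃ f, IsIsomorphism f I (q.atoms \ I) ∧ ∀ x ∈ varsOf I ∩ varsOf (q.atoms \ I), f x = x

/-! ### Random access machines with uniform-cost addition and multiplication -/

/-- Instructions. Operands are names of registers, jump targets `l` are positions in the program.
* `const r k` : `reg r := k`
* `add r a b`, `mul r a b` : `reg r := reg a + reg b`, `reg r := reg a * reg b`
* `load r a` : `reg r := mem (reg a)`
* `store a r` : `mem (reg a) := reg r`
* `jmp l`, `jlt a b l`, `jeq a b l` : jump to `l`, always, if `reg a < reg b`, if `reg a = reg b`
* `emit rs` : output the tuple of the contents of the registers in the list `rs`. -/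
inductive Instr where
  | const (r k : ℕ)
  | add (r a b : ℕ)
  | mul (r a b : ℕ)
  | load (r a : ℕ)
  | store (a r : ℕ)
  | jmp (l : ℕ)
  | jlt (a b l : ℕ)
  | jeq (a b l : ℕ)
  | emit (rs : List ℕ)

abbrev Program : Type := List Instr

/-- A configuration: program counter, registers, memory. -/
structure Config where
  pc : ℕ
  reg : ℕ → ℕ
  mem : ℕ → ℕ

/-- The effect of one instruction. -/
def Instr.exec : Instr → Config → Config
  | .const r k, c => ⟨c.pc + 1, Function.update c.reg r k, c.mem⟩
  | .add r a b, c => ⟨c.pc + 1, Function.update c.reg r (c.reg a + c.reg b), c.mem⟩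
  | .mul r a b, c => ⟨c.pc + 1, Function.update c.reg r (c.reg a * c.reg b), c.mem⟩
  | .load r a, c => ⟨c.pc + 1, Function.update c.reg r (c.mem (c.reg a)), c.mem⟩
  | .store a r, c => ⟨c.pc + 1, c.reg, Function.update c.mem (c.reg a) (c.reg r)⟩
  | .jmp l, c => ⟨l, c.reg, c.mem⟩
  | .jlt a b l, c => ⟨if c.reg a < c.reg b then l else c.pc + 1, c.reg, c.mem⟩
  | .jeq a b l, c => ⟨if c.reg a = c.reg b then l else c.pc + 1, c.reg, c.mem⟩
  | .emit _, c => ⟨c.pc + 1, c.reg, c.mem⟩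

/-- The machine has halted when the program counter points outside the program. -/
def Halted (p : Program) (c : Config) : Prop := p[c.pc]? = none

/-- One computation step; it takes one unit of time. -/
def step (p : Program) (c : Config) : Config :=
  match p[c.pc]? with
  | some i => i.exec c
  | none => c

/-- The tuple that is output by the next step from `c`, if that step outputs one. -/
def emission (p : Program) (c : Config) : Option (List ℕ) :=
  match p[c.pc]? with
  | some (.emit rs) => some (rs.map c.reg)
  | _ => none

/-- The initial configuration on input word `w`: the word stands at the beginning of the memory,
register `0` holds its length, and everything else is `0`. -/
def initConfig (w : List ℕ) : Config :=
  ⟨0, Function.update (fun _ => 0) 0 w.length, fun i => w.getD i 0⟩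

/-- The configuration after `t` steps on input `w`. -/
def run (p : Program) (w : List ℕ) (t : ℕ) : Config := (step p)^[t] (initConfig w)

/-! ### Enumeration with constant delay after linear preprocessing -/

/-- `w` is an encoding of `D`: for each relation symbol in turn, the number of its tuples, followed
by its tuples, listed in any order without repetition. -/
def Database.IsEncoding {S : Schema} (D : Database S) (w : List ℕ) : Prop :=
  ∃ rows : (R : Fin S.numSymbols) → List (Fin (S.arity R) → ℕ),
    (∀ R, (rows R).Nodup ∧ ∀ t, t ∈ rows R ↔ t ∈ D.rel R) ∧
    w = (List.finRange S.numSymbols).flatMap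
      fun R => (rows R).length :: (rows R).flatMap List.ofFn

/-- On input `w`, the program `p` enumerates the set `A` of tuples with preprocessing time `pre`
and delay `delay`: it halts; up to its halting it outputs exactly the elements of `A`, each of them
once; and there is a time `t₀ ≤ pre`, the end of the preprocessing phase, such that nothing is
output before `t₀` and from any moment `t ≥ t₀` on it takes at most `delay` steps until the next
output starts or the machine has halted. Moreover, no register ever holds a number
above `bound`; as memory is accessed only through registers, this bounds the addresses and the
numbers written to memory as well. -/
def Enumerates (p : Program) (w : List ℕ) (A : Set (List ℕ)) (pre delay bound : ℕ) : Prop :=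
  (∃ T, Halted p (run p w T)) ∧
  (∀ s, s ∈ A ↔ ∃ t, emission p (run p w t) = some s) ∧
  (∀ t t' s, emission p (run p w t) = some s → emission p (run p w t') = some s → t = t') ∧
  (∃ t₀ ≤ pre, (∀ t < t₀, emission p (run p w t) = none) ∧
    ∀ t ≥ t₀, ∃ u, t ≤ u ∧ u ≤ t + delay ∧
      (emission p (run p w u) ≠ none ∨ Halted p (run p w u))) ∧
  (∀ t r, (run p w t).reg r ≤ bound)

/-- The length of `w` plus its largest entry (plus 2, so that powers of it are never trivial). -/
def magnitude (w : List ℕ) : ℕ := w.length + w.foldr max 0 + 2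

/-- `q` can be enumerated with constant delay after linear preprocessing: some program and some
constant `c`, both depending only on `q`, work for all databases `D`. The preprocessing time is
linear in the size of `D`, the delay is constant, and the machine works with numbers and addresses
that are polynomial in the length and the entries of the input. -/
def FullCQ.ConstantDelayEnumerable {S : Schema} (q : FullCQ S) : Prop :=
  ∃ (p : Program) (c : ℕ), ∀ (D : Database S) (w : List ℕ), D.IsEncoding w →
    Enumerates p w (List.ofFn '' q.solutions D) (c * (D.size + 1)) c (magnitude w ^ c)

end MirrorCQ

/-!
A mirror query `q` consists of an acyclic image `I` and a copy of `I` that agrees with it on the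
shared variables `Z`. So the solutions of `q` are the pairs `(s, s')` of solutions of `I` that agree
on `Z`. As `I` is acyclic and full, nested loops over the nodes of its join tree visit its solutions
one after the other: once the tuples that do not extend to the subtree below them have been removed
in linear time, no loop runs into a dead end. When a solution `s` of `I` is visited, it is stored in
a list for its values on `Z`; then `(s, s)` is output, and `(s, s')` and `(s', s)` for each `s'`
stored before in the same list. Thus every visit leads to an output, which bounds the delay, and
each pair is output exactly once, at the visit of the later of its two members.

Since the domain elements are only polynomially bounded, the lists are accessed by hashing without
collisions: a tuple of numbers is encoded injectively as a polynomially bounded memory address.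
-/

namespace MirrorCQ

/-! ### A structured language over a memory addressed by lists -/

/-- The registers of the structured language: a constant zero, registers for the current
computation, the number `cnt R` of tuples of a relation, two assignments `asg` and `old` of values
to variables, and for each nested loop a row number `ptr`. -/
inductive Reg where
  | zero | aux | pos | row | ctr | cur
  | cnt (R : ℕ)
  | asg (x : ℕ)
  | old (x : ℕ)
  | ptr (i : ℕ)
  deriving DecidableEq

/-- The machine register that holds a register of the structured language. Machine register `0`
holds the length of the input, and machine registers `1` to `4` are reserved for the computation of
addresses. -/
def Reg.code : Reg → ℕ
  | .zero => 5
  | .aux => 6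
  | .pos => 7
  | .row => 8
  | .ctr => 9
  | .cur => 10
  | .cnt R => 11 + 4 * R
  | .asg x => 12 + 4 * x
  | .old x => 13 + 4 * x
  | .ptr i => 14 + 4 * i

theorem Reg.code_injective : Function.Injective Reg.code := by
  intro a b h
  cases a <;> cases b <;> simp only [Reg.code] at h <;> first | rfl | omega | (congr 1; omega)

theorem Reg.five_le_code (r : Reg) : 5 ≤ r.code := by
  cases r <;> simp only [Reg.code] <;> omega

/-- A state of the structured language: registers, and a heap addressed by lists of numbers. -/
structure State where
  reg : Reg → ℕ
  heap : List ℕ → ℕ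

namespace State

variable (σ : State) (r r' : Reg) (l l' : List ℕ) (v v' : ℕ)

/-- The state in which every register and every heap cell is zero. -/
def blank : State := ⟨fun _ => 0, fun _ => 0⟩

/-- Assignment to a register. -/
def set : State := ⟨Function.update σ.reg r v, σ.heap⟩

/-- Assignment to a heap cell. -/
def write : State := ⟨σ.reg, Function.update σ.heap l v⟩

@[simp] theorem set_heap : (σ.set r v).heap = σ.heap := rfl

@[simp] theorem write_reg : (σ.write l v).reg = σ.reg := rfl

theorem set_reg : (σ.set r v).reg r' = if r' = r then v else σ.reg r' :=
  Function.update_apply ..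

theorem write_heap : (σ.write l v).heap l' = if l' = l then v else σ.heap l' :=
  Function.update_apply ..

@[simp] theorem set_reg_self : (σ.set r v).reg r = v := Function.update_self ..

variable {r r'} in
theorem set_reg_of_ne (h : r' ≠ r) : (σ.set r v).reg r' = σ.reg r' := Function.update_of_ne h ..

theorem set_eq_self : σ.set r (σ.reg r) = σ := by simp [set]

theorem set_set : (σ.set r v).set r v' = σ.set r v' := by simp [set]

end State

/-- A component of a heap address. -/
inductive Operand where
  | lit (k : ℕ)
  | reg (r : Reg)

/-- The value of an operand in a state. -/
def Operand.val (σ : State) : Operand → ℕ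
  | .lit k => k
  | .reg r => σ.reg r

@[simp] theorem Operand.val_lit (σ : State) (k : ℕ) : (Operand.lit k).val σ = k := rfl

@[simp] theorem Operand.val_reg (σ : State) (r : Reg) : (Operand.reg r).val σ = σ.reg r := rfl

/-- The heap address denoted by a list of operands. -/
abbrev address (σ : State) (l : List Operand) : List ℕ := l.map (Operand.val σ)

/-- An injective numbering of the lists of numbers. Unlike `Nat.pair`, the polynomial
`(a + e) ^ 2 + e` is injective in `(a, e)` without a case distinction, so that it can be computed
by straight-line code. -/
def listCode : List ℕ → ℕ
  | [] => 0
  | a :: l => (a + listCode l) * (a + listCode l) + listCode l + 1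

theorem listCode_injective : Function.Injective listCode := by
  intro l
  induction l with
  | nil => rintro (_ | ⟨b, l'⟩) h <;> simp_all [listCode]
  | cons a l ih =>
    rintro (_ | ⟨b, l'⟩) h
    · simp [listCode] at h
    · simp only [listCode] at h
      have hsum : a + listCode l = b + listCode l' := by
        by_contra hne
        rcases Nat.lt_or_gt_of_ne hne with hlt | hlt <;> nlinarith
      rw [hsum] at h
      have htail : l = l' := ih (by omega)
      subst htail
      rw [show a = b by omega]

theorem listCode_le_listCode_cons (a : ℕ) (l : List ℕ) : listCode l ≤ listCode (a :: l) := by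
  simp only [listCode]
  omega

theorem listCode_add_le {V : ℕ} {l : List ℕ} (h : ∀ x ∈ l, x ≤ V) :
    listCode l + V + 2 ≤ (V + 2) ^ 3 ^ l.length := by
  induction l with
  | nil => simp [listCode]
  | cons a l ih =>
    have ih := ih fun x hx => h x (List.mem_cons_of_mem _ hx)
    have ha := h a List.mem_cons_self
    rw [List.length_cons, pow_succ, pow_mul]
    refine le_trans ?_ (Nat.pow_le_pow_left ih 3)
    simp only [listCode]
    generalize listCode l = e
    have hsq : (a + e) * (a + e) ≤ (V + e) * (V + e) := Nat.mul_le_mul (by omega) (by omega)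
    nlinarith [Nat.zero_le ((e + V) ^ 3)]

section LinearMemory

variable (w : List ℕ) (heap : List ℕ → ℕ)

open Classical in
/-- The machine memory that holds the input word `w`, followed by the cells of `heap`. -/
noncomputable def linearMem (i : ℕ) : ℕ :=
  if i < w.length then w.getD i 0
  else if h : ∃ l, w.length + listCode l = i then heap h.choose else 0

theorem linearMem_listCode (l : List ℕ) : linearMem w heap (w.length + listCode l) = heap l := by
  have h : ∃ l', w.length + listCode l' = w.length + listCode l := ⟨l, rfl⟩
  have hl : h.choose = l := listCode_injective (Nat.add_left_cancel h.choose_spec)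
  simp only [linearMem, dif_pos h, hl]
  simp

variable {w} in
theorem linearMem_of_drop {i x : ℕ} {tl : List ℕ} (h : w.drop i = x :: tl) :
    linearMem w heap i = x := by
  have hx : w[i]? = some x := by rw [← List.head?_drop, h, List.head?_cons]
  obtain ⟨hi, hget⟩ := List.getElem?_eq_some_iff.mp hx
  simp [linearMem, hi, hget]

theorem linearMem_zero : linearMem w (fun _ => 0) = fun i => w.getD i 0 := by
  funext i
  by_cases h : i < w.length <;> simp [linearMem, h]

theorem linearMem_update (l : List ℕ) (v : ℕ) :
    linearMem w (Function.update heap l v)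
      = Function.update (linearMem w heap) (w.length + listCode l) v := by
  funext i
  by_cases hi : i = w.length + listCode l
  · rw [hi, linearMem_listCode, Function.update_self, Function.update_self]
  rw [Function.update_of_ne hi]
  by_cases hinput : i < w.length
  · simp [linearMem, hinput]
  by_cases hcell : ∃ l', w.length + listCode l' = i
  · obtain ⟨l', rfl⟩ := hcell
    rw [linearMem_listCode, linearMem_listCode, Function.update_of_ne]
    rintro rfl
    exact hi rfl
  · simp [linearMem, hinput, hcell]

variable {w heap} in
theorem linearMem_le {m : ℕ} (hw : ∀ x ∈ w, x ≤ m) (hh : ∀ l, heap l ≤ m) (i : ℕ) :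
    linearMem w heap i ≤ m := by
  unfold linearMem
  split_ifs with hi
  · rw [List.getD_eq_getElem _ _ hi]
    exact hw _ (List.getElem_mem hi)
  · exact hh _
  · exact Nat.zero_le _

end LinearMemory

/-- The basic operations: `const` and `inc` set a register to a constant and to the successor of a
register, `input` reads the machine memory at a position of the input word, `get` and `put` read and
write a heap cell. -/
inductive Op where
  | const (r : Reg) (k : ℕ)
  | inc (r a : Reg)
  | input (r a : Reg)
  | get (r : Reg) (l : List Operand)
  | put (l : List Operand) (r : Reg)

/-- The effect of an operation, with the input word `w`. -/
noncomputable def Op.eval (w : List ℕ) : Op → State → State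
  | .const r k, σ => σ.set r k
  | .inc r a, σ => σ.set r (σ.reg a + 1)
  | .input r a, σ => σ.set r (linearMem w σ.heap (σ.reg a))
  | .get r l, σ => σ.set r (σ.heap (address σ l))
  | .put l r, σ => σ.write (address σ l) (σ.reg r)

/-- The number of machine instructions for an operation. -/
def Op.cost : Op → ℕ
  | .const _ _ => 1
  | .inc _ _ => 2
  | .input _ _ => 1
  | .get _ l | .put l _ => 1 + 7 * l.length + 2

theorem Op.one_le_cost (o : Op) : 1 ≤ o.cost := by
  cases o <;> simp only [Op.cost] <;> omega

/-- Commands of the structured language. -/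
inductive Cmd where
  | skip
  | op (o : Op)
  | emit (rs : List Reg)
  | seq (c₁ c₂ : Cmd)
  | ifeq (a b : Reg) (c₁ c₂ : Cmd)
  | whileNe (a b : Reg) (c : Cmd)

/-- One entry for each machine step: the tuple output by that step, if any. -/
abbrev Trace : Type := List (Option (List ℕ))

/-- The trace of `k` steps without output. -/
abbrev silent (k : ℕ) : Trace := List.replicate k none

/-- `Exec w C σ t σ'`: with the input word `w`, the command `C` leads from `σ` to `σ'`, and its
machine code takes the steps recorded in `t`. -/
inductive Exec (w : List ℕ) : Cmd → State → Trace → State → Prop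
  | skip (σ : State) : Exec w .skip σ [] σ
  | op (o : Op) (σ : State) : Exec w (.op o) σ (silent o.cost) (o.eval w σ)
  | emit (rs : List Reg) (σ : State) : Exec w (.emit rs) σ [some (rs.map σ.reg)] σ
  | seq {c₁ c₂ : Cmd} {σ σ₁ σ₂ : State} {t₁ t₂ : Trace} (h₁ : Exec w c₁ σ t₁ σ₁)
      (h₂ : Exec w c₂ σ₁ t₂ σ₂) : Exec w (.seq c₁ c₂) σ (t₁ ++ t₂) σ₂
  | ifTrue {a b : Reg} {c₁ c₂ : Cmd} {σ σ' : State} {t : Trace} (h : σ.reg a = σ.reg b)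
      (h₁ : Exec w c₁ σ t σ') : Exec w (.ifeq a b c₁ c₂) σ (none :: t) σ'
  | ifFalse {a b : Reg} {c₁ c₂ : Cmd} {σ σ' : State} {t : Trace} (h : σ.reg a ≠ σ.reg b)
      (h₂ : Exec w c₂ σ t σ') : Exec w (.ifeq a b c₁ c₂) σ (none :: (t ++ [none])) σ'
  | whileDone {a b : Reg} {c : Cmd} {σ : State} (h : σ.reg a = σ.reg b) :
      Exec w (.whileNe a b c) σ [none] σ
  | whileStep {a b : Reg} {c : Cmd} {σ σ₁ σ₂ : State} {t t' : Trace} (h : σ.reg a ≠ σ.reg b)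
      (h₁ : Exec w c σ t σ₁) (h₂ : Exec w (.whileNe a b c) σ₁ t' σ₂) :
      Exec w (.whileNe a b c) σ (none :: (t ++ none :: t')) σ₂

/-! ### Commands without output -/

/-- `C` leads from `σ` to `σ'` without output in at most `k` steps. -/
def Runs (w : List ℕ) (C : Cmd) (k : ℕ) (σ σ' : State) : Prop :=
  ∃ i ≤ k, Exec w C σ (silent i) σ'

/-- A command without loops and output. -/
def Cmd.Plain : Cmd → Prop
  | .skip | .op _ => True
  | .seq c₁ c₂ | .ifeq _ _ c₁ c₂ => c₁.Plain ∧ c₂.Plain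
  | .emit _ | .whileNe _ _ _ => False

/-- An upper bound for the number of steps of a plain command; it has no meaning for loops. -/
def Cmd.cost : Cmd → ℕ
  | .skip => 0
  | .op o => o.cost
  | .emit _ => 1
  | .seq c₁ c₂ => c₁.cost + c₂.cost
  | .ifeq _ _ c₁ c₂ => c₁.cost + c₂.cost + 2
  | .whileNe _ _ _ => 0

/-- The effect of a plain command; it has no meaning for loops. -/
noncomputable def Cmd.eval (w : List ℕ) : Cmd → State → State
  | .skip, σ | .emit _, σ | .whileNe _ _ _, σ => σ
  | .op o, σ => o.eval w σ
  | .seq c₁ c₂, σ => c₂.eval w (c₁.eval w σ)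
  | .ifeq a b c₁ c₂, σ => if σ.reg a = σ.reg b then c₁.eval w σ else c₂.eval w σ

/-- A sequence of operations. -/
def Cmd.block (l : List Op) : Cmd := l.foldr (fun o c => .seq (.op o) c) .skip

theorem Cmd.plain_block (l : List Op) : (Cmd.block l).Plain := by
  induction l with
  | nil => trivial
  | cons o l ih => exact ⟨trivial, ih⟩

section

variable {w : List ℕ}

@[simp] theorem Cmd.eval_block_nil (σ : State) : (Cmd.block []).eval w σ = σ := rfl

@[simp] theorem Cmd.eval_block_cons (o : Op) (l : List Op) (σ : State) :
    (Cmd.block (o :: l)).eval w σ = (Cmd.block l).eval w (o.eval w σ) := rfl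

theorem Runs.mono {C : Cmd} {k k' : ℕ} {σ σ' : State} (h : Runs w C k σ σ') (hk : k ≤ k') :
    Runs w C k' σ σ' :=
  let ⟨i, hi, h⟩ := h
  ⟨i, hi.trans hk, h⟩

theorem Runs.seq {C₁ C₂ : Cmd} {k₁ k₂ : ℕ} {σ σ₁ σ₂ : State} (h₁ : Runs w C₁ k₁ σ σ₁)
    (h₂ : Runs w C₂ k₂ σ₁ σ₂) : Runs w (.seq C₁ C₂) (k₁ + k₂) σ σ₂ := by
  obtain ⟨i, hi, h₁⟩ := h₁
  obtain ⟨j, hj, h₂⟩ := h₂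
  refine ⟨i + j, by omega, ?_⟩
  rw [silent, List.replicate_add]
  exact h₁.seq h₂

theorem Cmd.Plain.runs {C : Cmd} (hC : C.Plain) (σ : State) :
    Runs w C C.cost σ (C.eval w σ) := by
  induction C generalizing σ with
  | skip => exact ⟨0, le_rfl, .skip σ⟩
  | op o => exact ⟨o.cost, le_rfl, .op o σ⟩
  | emit rs => exact hC.elim
  | seq c₁ c₂ ih₁ ih₂ => exact (ih₁ hC.1 σ).seq (ih₂ hC.2 _)
  | ifeq a b c₁ c₂ ih₁ ih₂ =>
    by_cases h : σ.reg a = σ.reg b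
    · obtain ⟨i, hi, h₁⟩ := ih₁ hC.1 σ
      refine ⟨i + 1, by simp only [Cmd.cost]; omega, ?_⟩
      simp only [Cmd.eval, if_pos h]
      exact .ifTrue h h₁
    · obtain ⟨i, hi, h₂⟩ := ih₂ hC.2 σ
      refine ⟨i + 1 + 1, by simp only [Cmd.cost]; omega, ?_⟩
      rw [Cmd.eval, if_neg h, silent, List.replicate_succ, List.replicate_succ']
      exact .ifFalse h h₂
  | whileNe a b c => exact hC.elim

theorem Runs.whileNe_of_invariant {C : Cmd} {a b : Reg} {k N : ℕ} {J : ℕ → State → Prop}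
    (hJ : ∀ j σ, J j σ → σ.reg a = j ∧ σ.reg b = N)
    (hC : ∀ j σ, j < N → J j σ → ∃ σ', Runs w C k σ σ' ∧ J (j + 1) σ')
    {σ : State} (h : J 0 σ) : ∃ σ', Runs w (.whileNe a b C) (N * (k + 2) + 1) σ σ' ∧ J N σ' := by
  suffices key : ∀ i j σ, i + j = N → J j σ →
      ∃ σ', Runs w (.whileNe a b C) (i * (k + 2) + 1) σ σ' ∧ J N σ' from key N 0 σ (by omega) h
  intro i
  induction i with
  | zero =>
    intro j σ hj h
    obtain ⟨ha, hb⟩ := hJ j σ h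
    obtain rfl : j = N := by omega
    exact ⟨σ, ⟨1, by omega, .whileDone (by rw [ha, hb])⟩, h⟩
  | succ i ih =>
    intro j σ hj h
    obtain ⟨ha, hb⟩ := hJ j σ h
    obtain ⟨σ₁, ⟨x, hx, e₁⟩, hσ₁⟩ := hC j σ (by omega) h
    obtain ⟨σ₂, ⟨y, hy, e₂⟩, hσ₂⟩ := ih (j + 1) σ₁ (by omega) hσ₁
    refine ⟨σ₂, ⟨(x + (y + 1)) + 1, by rw [Nat.succ_mul]; omega, ?_⟩, hσ₂⟩
    rw [silent, List.replicate_succ, List.replicate_add, List.replicate_succ]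
    exact .whileStep (by omega) e₁ e₂

end

/-! ### Gaps between outputs -/

/-- The number of silent steps at the beginning of a trace. -/
def lead : Trace → ℕ
  | [] => 0
  | none :: t => lead t + 1
  | some _ :: _ => 0

/-- At most `d` successive steps of the trace are silent. -/
def Gap (d : ℕ) : Trace → Prop
  | [] => True
  | e :: t => lead (e :: t) ≤ d ∧ Gap d t

/-- The outputs of a trace. -/
def outputs (t : Trace) : List (List ℕ) := t.filterMap id

@[simp] theorem outputs_append (s t : Trace) : outputs (s ++ t) = outputs s ++ outputs t := by
  simp [outputs]

@[simp] theorem outputs_nil : outputs [] = [] := rfl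

@[simp] theorem outputs_none (t : Trace) : outputs (none :: t) = outputs t := rfl

@[simp] theorem outputs_some (o : List ℕ) (t : Trace) :
    outputs (some o :: t) = o :: outputs t := rfl

@[simp] theorem outputs_silent (k : ℕ) : outputs (silent k) = [] := by
  simp [outputs]

theorem mem_outputs {t : Trace} {o : List ℕ} : o ∈ outputs t ↔ ∃ i : ℕ, t[i]? = some (some o) := by
  simp [← List.mem_iff_getElem?, outputs]

theorem index_unique_of_nodup_outputs {t : Trace} (h : (outputs t).Nodup) {o : List ℕ} {i j : ℕ}
    (hi : t[i]? = some (some o)) (hj : t[j]? = some (some o)) : i = j := by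
  rw [outputs, List.Nodup, List.pairwise_filterMap, List.pairwise_iff_getElem] at h
  obtain ⟨hit, hi⟩ := List.getElem?_eq_some_iff.mp hi
  obtain ⟨hjt, hj⟩ := List.getElem?_eq_some_iff.mp hj
  rcases lt_trichotomy i j with hlt | heq | hlt
  · exact (h i j hit hjt hlt o hi o hj rfl).elim
  · exact heq
  · exact (h j i hjt hit hlt o hj o hi rfl).elim

@[simp] theorem lead_silent (k : ℕ) : lead (silent k) = k := by
  induction k with
  | zero => rfl
  | succ k ih => exact congrArg (· + 1) ih

theorem lead_append_le (s t : Trace) : lead (s ++ t) ≤ lead s + lead t := by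
  induction s with
  | nil => simp [lead]
  | cons e s ih => cases e <;> simp only [List.cons_append, lead] <;> omega

theorem lead_append_of_outputs_ne_nil {s : Trace} (h : outputs s ≠ []) (t : Trace) :
    lead (s ++ t) = lead s := by
  induction s with
  | nil => simp at h
  | cons e s ih => cases e <;> simp_all [lead]

theorem getElem?_lead (t : Trace) : (∃ o, t[lead t]? = some (some o)) ∨ t.length ≤ lead t := by
  induction t with
  | nil => simp
  | cons e t ih => cases e <;> simp_all [lead]

namespace Gap

variable {d d' : ℕ} {s t : Trace}

theorem lead_le (h : Gap d t) : lead t ≤ d := by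
  cases t with
  | nil => exact Nat.zero_le d
  | cons e t => exact h.1

theorem mono (h : Gap d t) (hd : d ≤ d') : Gap d' t := by
  induction t with
  | nil => trivial
  | cons e t ih => exact ⟨h.1.trans hd, ih h.2⟩

theorem append (hs : Gap d s) (ht : Gap d' t) (h : d + lead t ≤ d') : Gap d' (s ++ t) := by
  induction s with
  | nil => exact ht
  | cons e s ih =>
    have := hs.1
    exact ⟨(lead_append_le (e :: s) t).trans (by omega), ih hs.2⟩

theorem append_add (hs : Gap d s) (ht : Gap d' t) : Gap (d + d') (s ++ t) :=
  hs.append (ht.mono (Nat.le_add_left d' d)) (Nat.add_le_add_left ht.lead_le d)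

theorem singleton (o : List ℕ) : Gap 1 [some o] := ⟨by simp [lead], trivial⟩

theorem silent {k : ℕ} (h : k ≤ d) : Gap d (silent k) := by
  induction k with
  | zero => trivial
  | succ k ih => exact ⟨(lead_silent (k + 1)).trans_le h, ih (by omega)⟩

theorem length_le (h : Gap d t) : t.length ≤ (d + 1) * ((outputs t).length + 1) := by
  suffices key : t.length ≤ lead t + (d + 1) * (outputs t).length by
    have := h.lead_le
    rw [Nat.mul_succ]
    omega
  induction t with
  | nil => simp
  | cons e t ih =>
    have := ih h.2
    have := h.2.lead_le
    cases e <;> simp only [List.length_cons, lead, outputs_none, outputs_some, Nat.mul_succ] <;>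
      omega

theorem exists_output (h : Gap d t) {i : ℕ} (hi : i ≤ t.length) :
    ∃ u, i ≤ u ∧ u ≤ i + d ∧ ((∃ o, t[u]? = some (some o)) ∨ t.length ≤ u) := by
  induction t generalizing i with
  | nil => exact ⟨i, le_rfl, by omega, .inr (Nat.zero_le i)⟩
  | cons e t ih =>
    cases i with
    | zero => exact ⟨lead (e :: t), by omega, by simpa using h.1, getElem?_lead _⟩
    | succ i =>
      obtain ⟨u, hiu, hui, hu⟩ := ih h.2 (i := i) (by simpa using hi)
      exact ⟨u + 1, by omega, by omega, by simpa using hu⟩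

end Gap

/-! ### Compilation -/

/-- The instruction that puts the value of an operand into register `4`, which holds `0`. -/
def Operand.load : Operand → Instr
  | .lit k => .const 4 k
  | .reg r => .add 4 4 r.code

/-- Code that replaces the number `e` in register `2` by `(a + e) ^ 2 + e + 1`, for the value `a` of
the operand. -/
def Operand.code (o : Operand) : List Instr :=
  [.const 4 0, o.load, .add 3 4 2, .mul 3 3 3, .add 3 3 2, .const 1 1, .add 2 3 1]

/-- Code that computes the number `listCode` of an address in register `2`. -/
def addressCode : List Operand → List Instr
  | [] => [.const 2 0]
  | o :: l => addressCode l ++ o.code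

/-- The machine code of an operation. Cell `l` of the heap is stored behind the input word, whose
length register `0` holds. -/
def Op.code : Op → List Instr
  | .const r k => [.const r.code k]
  | .inc r a => [.const 1 1, .add r.code a.code 1]
  | .input r a => [.load r.code a.code]
  | .get r l => addressCode l ++ [.add 2 2 0, .load r.code 2]
  | .put l r => addressCode l ++ [.add 2 2 0, .store 2 r.code]

/-- The length of the machine code of a command. -/
def Cmd.size : Cmd → ℕ
  | .skip => 0
  | .op o => o.cost
  | .emit _ => 1
  | .seq c₁ c₂ => c₁.size + c₂.size
  | .ifeq _ _ c₁ c₂ => c₂.size + 2 + c₁.size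
  | .whileNe _ _ c => c.size + 2

/-- The machine code of a command, to be placed at position `s` of the program. -/
def Cmd.code (s : ℕ) : Cmd → List Instr
  | .skip => []
  | .op o => o.code
  | .emit rs => [.emit (rs.map Reg.code)]
  | .seq c₁ c₂ => c₁.code s ++ c₂.code (s + c₁.size)
  | .ifeq a b c₁ c₂ =>
      .jeq a.code b.code (s + (c₂.size + 2)) ::
        (c₂.code (s + 1) ++ .jmp (s + (c₂.size + 2 + c₁.size)) :: c₁.code (s + (c₂.size + 2)))
  | .whileNe a b c => .jeq a.code b.code (s + (c.size + 2)) :: (c.code (s + 1) ++ [.jmp s])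

theorem length_addressCode (l : List Operand) : (addressCode l).length = 1 + 7 * l.length := by
  induction l with
  | nil => rfl
  | cons o l ih =>
    rw [addressCode, List.length_append, ih, List.length_cons]
    exact Nat.add_assoc 1 (7 * l.length) 7

theorem Op.length_code (o : Op) : o.code.length = o.cost := by
  cases o <;> simp [Op.code, Op.cost, length_addressCode]

theorem Cmd.length_code (C : Cmd) (s : ℕ) : (C.code s).length = C.size := by
  induction C generalizing s with
  | skip => rfl
  | op o => exact o.length_code
  | emit rs => rfl
  | seq c₁ c₂ ih₁ ih₂ => simp [Cmd.code, Cmd.size, ih₁, ih₂]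
  | ifeq a b c₁ c₂ ih₁ ih₂ =>
    simp only [Cmd.code, Cmd.size, List.length_cons, List.length_append, ih₁, ih₂]
    ring
  | whileNe a b c ih => simp [Cmd.code, Cmd.size, ih]

/-- The piece of code `l` stands at position `s` of the program `p`. -/
def CodeAt (p : Program) (s : ℕ) (l : List Instr) : Prop := l <+: p.drop s

namespace CodeAt

variable {p : Program} {s : ℕ} {i : Instr} {l l' : List Instr}

theorem head (h : CodeAt p s (i :: l)) : p[s]? = some i := by
  obtain ⟨t, ht⟩ := h
  rw [← List.head?_drop, ← ht]
  rfl

theorem tail (h : CodeAt p s (i :: l)) : CodeAt p (s + 1) l := by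
  obtain ⟨t, ht⟩ := h
  refine ⟨t, ?_⟩
  rw [← List.drop_drop, ← ht]
  rfl

theorem left (h : CodeAt p s (l ++ l')) : CodeAt p s l := (List.prefix_append l l').trans h

theorem right {k : ℕ} (h : CodeAt p s (l ++ l')) (hk : l.length = k) : CodeAt p (s + k) l' := by
  obtain ⟨t, ht⟩ := h
  refine ⟨t, ?_⟩
  rw [← List.drop_drop, ← ht, ← hk]
  simp

end CodeAt

/-- `p` leads from `c` to `c'` through the steps recorded in a trace, and no register ever exceeds
`B`. -/
inductive Steps (p : Program) (B : ℕ) : Config → Trace → Config → Prop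
  | nil {c : Config} (hB : ∀ r, c.reg r ≤ B) : Steps p B c [] c
  | cons {c c' : Config} {t : Trace} (hB : ∀ r, c.reg r ≤ B)
      (h : Steps p B (step p c) t c') : Steps p B c (emission p c :: t) c'

/-- `p` leads from `c` to a configuration that satisfies `Q` through the steps recorded in `t`, and
no register ever exceeds `B`. -/
def Reaches (p : Program) (B : ℕ) (c : Config) (t : Trace) (Q : Config → Prop) : Prop :=
  ∃ c', Steps p B c t c' ∧ Q c'

section

variable {p : Program} {B : ℕ}

theorem Steps.append {c c₁ c₂ : Config} {t₁ t₂ : Trace} (h₁ : Steps p B c t₁ c₁)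
    (h₂ : Steps p B c₁ t₂ c₂) : Steps p B c (t₁ ++ t₂) c₂ := by
  induction h₁ with
  | nil _ => exact h₂
  | cons hB _ ih => exact .cons hB (ih h₂)

theorem Reaches.trans {c : Config} {t t' : Trace} {Q Q' : Config → Prop} (h : Reaches p B c t Q)
    (h' : ∀ c', Q c' → Reaches p B c' t' Q') : Reaches p B c (t ++ t') Q' := by
  obtain ⟨c₁, s₁, q₁⟩ := h
  obtain ⟨c₂, s₂, q₂⟩ := h' c₁ q₁
  exact ⟨c₂, s₁.append s₂, q₂⟩

theorem Reaches.trans_silent {c : Config} {a b : ℕ} {Q Q' : Config → Prop}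
    (h : Reaches p B c (silent a) Q) (h' : ∀ c', Q c' → Reaches p B c' (silent b) Q') :
    Reaches p B c (silent (a + b)) Q' := by
  rw [silent, List.replicate_add]
  exact h.trans h'

theorem Steps.of_instr {c : Config} {i : Instr} (hi : p[c.pc]? = some i)
    (hc : ∀ r, c.reg r ≤ B) (hB : ∀ r, (i.exec c).reg r ≤ B) :
    Steps p B c [emission p c] (i.exec c) := by
  have h : step p c = i.exec c := by simp [step, hi]
  rw [← h] at hB ⊢
  exact .cons hc (.nil hB)

end

/-- The configuration `c` at program position `s` represents the state `σ`, and no register exceeds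
`B`. -/
structure Represents (w : List ℕ) (B s : ℕ) (σ : State) (c : Config) : Prop where
  pc : c.pc = s
  len : c.reg 0 = w.length
  reg : ∀ r : Reg, c.reg r.code = σ.reg r
  mem : c.mem = linearMem w σ.heap
  le : ∀ r, c.reg r ≤ B

namespace Represents

variable {w : List ℕ} {p : Program} {B s : ℕ} {σ : State} {c : Config}

theorem scratch (h : Represents w B s σ c) {r v : ℕ} (h0 : r ≠ 0) (h5 : r < 5) (hv : v ≤ B) :
    Represents w B (s + 1) σ ⟨c.pc + 1, Function.update c.reg r v, c.mem⟩ where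
  pc := congrArg (· + 1) h.pc
  len := (Function.update_of_ne h0.symm ..).trans h.len
  reg r' := (Function.update_of_ne (by have := r'.five_le_code; omega) ..).trans (h.reg r')
  mem := h.mem
  le r' := by
    simp only [Function.update_apply]
    split_ifs
    · exact hv
    · exact h.le r'

theorem set (h : Represents w B s σ c) (r : Reg) {v : ℕ} (hv : v ≤ B) :
    Represents w B (s + 1) (σ.set r v) ⟨c.pc + 1, Function.update c.reg r.code v, c.mem⟩ where
  pc := congrArg (· + 1) h.pc
  len := (Function.update_of_ne (by have := r.five_le_code; omega) ..).trans h.len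
  reg r' := by simp only [Function.update_apply, State.set_reg, Reg.code_injective.eq_iff, h.reg]
  mem := h.mem
  le r' := by
    simp only [Function.update_apply]
    split_ifs
    · exact hv
    · exact h.le r'

theorem steps (h : Represents w B s σ c) {i : Instr} (hp : p[s]? = some i)
    (hi : ∀ rs, i ≠ .emit rs) {s' : ℕ} {σ' : State} (h' : Represents w B s' σ' (i.exec c)) :
    Steps p B c (silent 1) (i.exec c) := by
  have hpc : p[c.pc]? = some i := by rw [h.pc, hp]
  have he : emission p c = none := by
    unfold emission
    rw [hpc]
    cases i with
    | emit rs => exact (hi rs rfl).elim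
    | _ => rfl
  have := Steps.of_instr hpc h.le h'.le
  rwa [he] at this

theorem reaches_scratch (h : Represents w B s σ c) {i : Instr} (hp : p[s]? = some i) {r v : ℕ}
    (he : i.exec c = ⟨c.pc + 1, Function.update c.reg r v, c.mem⟩) (hi : ∀ rs, i ≠ .emit rs)
    (h0 : r ≠ 0) (h5 : r < 5) (hv : v ≤ B) :
    Reaches p B c (silent 1) fun c' =>
      Represents w B (s + 1) σ c' ∧ c'.reg = Function.update c.reg r v := by
  have hr := h.scratch h0 h5 hv
  rw [← he] at hr
  exact ⟨_, h.steps hp hi hr, hr, by rw [he]⟩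

theorem reaches_load (h : Represents w B s σ c) (o : Operand)
    (hp : CodeAt p s [.const 4 0, o.load]) (hB : o.val σ ≤ B) :
    Reaches p B c (silent 2) fun c' =>
      Represents w B (s + 2) σ c' ∧ c'.reg 4 = o.val σ ∧ c'.reg 2 = c.reg 2 := by
  obtain ⟨c₁, s₁, r₁, e₁⟩ := h.reaches_scratch (r := 4) (v := 0) hp.head rfl nofun
    (by omega) (by omega) (by omega)
  have hload : o.load.exec c₁ = ⟨c₁.pc + 1, Function.update c₁.reg 4 (o.val σ), c₁.mem⟩ := by
    cases o with
    | lit k => rfl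
    | reg r => simp only [Operand.load, Instr.exec, r₁.reg, Operand.val_reg]; simp [e₁]
  obtain ⟨c₂, s₂, r₂, e₂⟩ := r₁.reaches_scratch hp.tail.head hload
    (by cases o <;> nofun) (by omega) (by omega) hB
  exact ⟨c₂, s₁.append s₂, r₂, by simp [e₂], by simp [e₂, e₁]⟩

theorem reaches_pair (h : Represents w B s σ c) {v e : ℕ} (hv : c.reg 4 = v) (he : c.reg 2 = e)
    (hp : CodeAt p s [.add 3 4 2, .mul 3 3 3, .add 3 3 2, .const 1 1, .add 2 3 1])
    (hB : (v + e) * (v + e) + e + 1 ≤ B) :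
    Reaches p B c (silent 5) fun c' =>
      Represents w B (s + 5) σ c' ∧ c'.reg 2 = (v + e) * (v + e) + e + 1 := by
  have hle : v + e ≤ (v + e) * (v + e) := Nat.le_mul_self _
  obtain ⟨c₁, s₁, r₁, e₁⟩ := h.reaches_scratch (r := 3) (v := v + e) hp.head
    (by simp [Instr.exec, hv, he]) nofun (by omega) (by omega) (by omega)
  obtain ⟨c₂, s₂, r₂, e₂⟩ := r₁.reaches_scratch (r := 3) (v := (v + e) * (v + e)) hp.tail.head
    (by simp [Instr.exec, e₁]) nofun (by omega) (by omega) (by omega)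
  obtain ⟨c₃, s₃, r₃, e₃⟩ := r₂.reaches_scratch (r := 3) (v := (v + e) * (v + e) + e)
    hp.tail.tail.head (by simp [Instr.exec, e₂, e₁, he]) nofun (by omega) (by omega) (by omega)
  obtain ⟨c₄, s₄, r₄, e₄⟩ := r₃.reaches_scratch (r := 1) (v := 1) hp.tail.tail.tail.head
    rfl nofun (by omega) (by omega) (by omega)
  obtain ⟨c₅, s₅, r₅, e₅⟩ := r₄.reaches_scratch (r := 2) hp.tail.tail.tail.tail.head
    (by simp [Instr.exec, e₄, e₃]) nofun (by omega) (by omega) hB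
  exact ⟨c₅, s₁.append (s₂.append (s₃.append (s₄.append s₅))), r₅, by simp [e₅]⟩

theorem reaches_listCode (h : Represents w B s σ c) (l : List Operand)
    (hp : CodeAt p s (addressCode l)) (hB : listCode (address σ l) ≤ B) :
    Reaches p B c (silent (1 + 7 * l.length)) fun c' =>
      Represents w B (s + (1 + 7 * l.length)) σ c' ∧ c'.reg 2 = listCode (address σ l) := by
  induction l with
  | nil =>
    obtain ⟨c', s', r', e'⟩ := h.reaches_scratch (r := 2) (v := 0) hp.head rfl nofun
      (by omega) (by omega) (by omega)
    exact ⟨c', s', r', by simp [e', listCode]⟩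
  | cons o l ih =>
    have hcode := hp.right (length_addressCode l)
    have hval : o.val σ ≤ listCode (address σ (o :: l)) := by
      have := Nat.le_mul_self (o.val σ + listCode (address σ l))
      change _ ≤ (_ + listCode (address σ l)) * (_ + listCode (address σ l)) + _ + 1
      omega
    rw [List.length_cons, Nat.mul_succ, ← Nat.add_assoc, ← Nat.add_assoc]
    refine (ih hp.left ((listCode_le_listCode_cons _ _).trans hB)).trans_silent
      fun c₁ ⟨r₁, e₁⟩ => ?_
    refine (r₁.reaches_load o (hcode.left (l := [_, _])) (hval.trans hB)).trans_silent
      (a := 2) (b := 5) fun c₂ ⟨r₂, v₂, e₂⟩ => ?_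
    exact r₂.reaches_pair v₂ (e₂.trans e₁) hcode.tail.tail hB

theorem reaches_address (h : Represents w B s σ c) {l : List Operand} {i : Instr}
    (hp : CodeAt p s (addressCode l ++ [.add 2 2 0, i]))
    (hB : w.length + listCode (address σ l) ≤ B) :
    Reaches p B c (silent (1 + 7 * l.length + 1)) fun c' =>
      Represents w B (s + (1 + 7 * l.length + 1)) σ c' ∧
        c'.reg 2 = w.length + listCode (address σ l) ∧ p[s + (1 + 7 * l.length + 1)]? = some i := by
  have hadd := hp.right (length_addressCode l)
  refine (h.reaches_listCode l hp.left (by omega)).trans_silent fun c₁ ⟨r₁, e₁⟩ => ?_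
  obtain ⟨c₂, s₂, r₂, e₂⟩ := r₁.reaches_scratch (r := 2) hadd.head
    (by simp only [Instr.exec]; rw [r₁.len, e₁, Nat.add_comm w.length]) nofun
    (by omega) (by omega) hB
  exact ⟨c₂, s₂, r₂, by simp [e₂], hadd.tail.head⟩

end Represents

/-! ### Bounds on numbers -/

/-- The size of the constant in an operand. -/
def Operand.extent : Operand → ℕ
  | .lit k => k
  | .reg _ => 0

/-- An upper bound for the constants and for the lengths of the addresses in an operation. -/
def Op.extent : Op → ℕ
  | .const _ k => k
  | .inc _ _ | .input _ _ => 0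
  | .get _ l | .put l _ => l.length + (l.map Operand.extent).sum

/-- An upper bound for the constants and for the lengths of the addresses in a command. -/
def Cmd.extent : Cmd → ℕ
  | .skip | .emit _ => 0
  | .op o => o.extent
  | .seq c₁ c₂ | .ifeq _ _ c₁ c₂ => c₁.extent + c₂.extent
  | .whileNe _ _ c => c.extent

/-- All numbers in the state and in the input, and the length of the input, are at most `m`. -/
structure State.Bounded (w : List ℕ) (m : ℕ) (σ : State) : Prop where
  reg : ∀ r, σ.reg r ≤ m
  heap : ∀ l, σ.heap l ≤ m
  input : ∀ x ∈ w, x ≤ m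
  length : w.length ≤ m

namespace State.Bounded

variable {w : List ℕ} {m m' v : ℕ} {σ : State}

theorem mono (h : σ.Bounded w m) (hm : m ≤ m') : σ.Bounded w m' :=
  ⟨fun r => (h.reg r).trans hm, fun l => (h.heap l).trans hm, fun x hx => (h.input x hx).trans hm,
    h.length.trans hm⟩

theorem set (h : σ.Bounded w m) (r : Reg) (hv : v ≤ m) : (σ.set r v).Bounded w m where
  reg r' := by
    rw [State.set_reg]
    split_ifs
    · exact hv
    · exact h.reg r'
  heap := h.heap
  input := h.input
  length := h.length

theorem write (h : σ.Bounded w m) (l : List ℕ) (hv : v ≤ m) : (σ.write l v).Bounded w m where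
  reg := h.reg
  heap l' := by
    rw [State.write_heap]
    split_ifs
    · exact hv
    · exact h.heap l'
  input := h.input
  length := h.length

theorem listCode_address_le (h : σ.Bounded w m) {l : List Operand} {k : ℕ}
    (hl : l.length + (l.map Operand.extent).sum ≤ k) (hk : k ≤ m) :
    w.length + listCode (address σ l) ≤ (m + 2) ^ 3 ^ k := by
  have hval : ∀ x ∈ address σ l, x ≤ m := by
    intro x hx
    obtain ⟨o, ho, rfl⟩ := List.mem_map.mp hx
    have := List.le_sum_of_mem (List.mem_map_of_mem (f := Operand.extent) ho)
    cases o with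
    | lit a => exact (this.trans (by omega) : a ≤ m)
    | reg r => exact h.reg r
  calc w.length + listCode (address σ l) ≤ listCode (address σ l) + m + 2 := by
        have := h.length
        omega
    _ ≤ (m + 2) ^ 3 ^ (address σ l).length := listCode_add_le hval
    _ ≤ (m + 2) ^ 3 ^ k :=
        Nat.pow_le_pow_right (by omega) (Nat.pow_le_pow_right (by omega) (by
          rw [List.length_map]
          omega))

theorem eval (h : σ.Bounded w m) {o : Op} (ho : o.extent ≤ m) :
    (o.eval w σ).Bounded w (m + 1) := by
  cases o with
  | const r k => exact (h.set r ho).mono (by omega)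
  | inc r a => exact (h.mono (by omega)).set r (Nat.succ_le_succ (h.reg a))
  | input r a => exact (h.set r (linearMem_le h.input h.heap _)).mono (by omega)
  | get r l => exact (h.set r (h.heap _)).mono (by omega)
  | put l r => exact (h.write _ (h.reg _)).mono (by omega)

theorem exec {C : Cmd} {σ' : State} {t : Trace} (hσ : σ.Bounded w m) (h : Exec w C σ t σ')
    (hC : C.extent ≤ m) : σ'.Bounded w (m + t.length) := by
  induction h generalizing m with
  | skip | emit => exact hσ.mono (by omega)
  | op o =>
    refine (hσ.eval hC).mono ?_
    rw [List.length_replicate]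
    exact Nat.add_le_add_left o.one_le_cost m
  | seq _ _ ih₁ ih₂ =>
    simp only [Cmd.extent] at hC
    refine (ih₂ (ih₁ hσ (by omega)) (by omega)).mono ?_
    rw [List.length_append, Nat.add_assoc]
  | ifTrue _ _ ih =>
    simp only [Cmd.extent] at hC
    exact (ih hσ (by omega)).mono (by rw [List.length_cons]; omega)
  | ifFalse _ _ ih =>
    simp only [Cmd.extent] at hC
    exact (ih hσ (by omega)).mono (by simp only [List.length_cons, List.length_append]; omega)
  | whileDone _ => exact hσ.mono (by omega)
  | whileStep _ _ _ ih₁ ih₂ =>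
    refine (ih₂ (ih₁ hσ hC) (hC.trans (by omega))).mono ?_
    simp only [List.length_cons, List.length_append]
    omega

end State.Bounded

/-! ### Correctness of the compilation -/

namespace Represents

variable {w : List ℕ} {p : Program} {B k s V : ℕ} {σ : State} {c : Config}

theorem reaches_inc (h : Represents w B s σ c) (r a : Reg) (hp : CodeAt p s (Op.inc r a).code)
    (hB : σ.reg a + 1 ≤ B) :
    Reaches p B c (silent 2) (Represents w B (s + 2) ((Op.inc r a).eval w σ)) := by
  obtain ⟨c₁, s₁, r₁, e₁⟩ := h.reaches_scratch (r := 1) (v := 1) hp.head rfl nofun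
    (by omega) (by omega) (by omega)
  have r₂ := r₁.set r hB
  have hadd : (Instr.add r.code a.code 1).exec c₁
      = ⟨c₁.pc + 1, Function.update c₁.reg r.code (σ.reg a + 1), c₁.mem⟩ := by
    simp only [Instr.exec, r₁.reg]
    simp [e₁]
  rw [← hadd] at r₂
  exact ⟨_, s₁.append (r₁.steps hp.tail.head nofun r₂), r₂⟩

theorem reaches_get (h : Represents w B s σ c) (r : Reg) (l : List Operand)
    (hp : CodeAt p s (Op.get r l).code) (hl : w.length + listCode (address σ l) ≤ B)
    (hB : σ.heap (address σ l) ≤ B) :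
    Reaches p B c (silent (Op.get r l).cost)
      (Represents w B (s + (Op.get r l).cost) ((Op.get r l).eval w σ)) := by
  refine (h.reaches_address hp hl).trans_silent (b := 1) fun c₁ ⟨r₁, e₁, hload⟩ => ?_
  have r₂ := r₁.set r hB
  have hexec : (Instr.load r.code 2).exec c₁
      = ⟨c₁.pc + 1, Function.update c₁.reg r.code (σ.heap (address σ l)), c₁.mem⟩ := by
    simp only [Instr.exec]
    rw [e₁, r₁.mem, linearMem_listCode]
  rw [← hexec] at r₂
  exact ⟨_, r₁.steps hload nofun r₂, r₂⟩

theorem reaches_put (h : Represents w B s σ c) (l : List Operand) (r : Reg)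
    (hp : CodeAt p s (Op.put l r).code) (hl : w.length + listCode (address σ l) ≤ B) :
    Reaches p B c (silent (Op.put l r).cost)
      (Represents w B (s + (Op.put l r).cost) ((Op.put l r).eval w σ)) := by
  refine (h.reaches_address hp hl).trans_silent (b := 1) fun c₁ ⟨r₁, e₁, hstore⟩ => ?_
  have r₂ : Represents w B (s + (1 + 7 * l.length + 1) + 1) ((Op.put l r).eval w σ)
      ((Instr.store 2 r.code).exec c₁) := by
    refine ⟨congrArg (· + 1) r₁.pc, r₁.len, r₁.reg, ?_, r₁.le⟩
    simp only [Instr.exec, Op.eval, State.write]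
    rw [linearMem_update, e₁, r₁.mem, r₁.reg]
  exact ⟨_, r₁.steps hstore nofun r₂, r₂⟩

theorem reaches_op (h : Represents w B s σ c) (o : Op) (hp : CodeAt p s o.code)
    (hσ : σ.Bounded w V) (ho : o.extent ≤ k) (hk : k ≤ V) (hB : (V + 2) ^ 3 ^ k ≤ B) :
    Reaches p B c (silent o.cost) (Represents w B (s + o.cost) (o.eval w σ)) := by
  have hV : V + 2 ≤ B := (Nat.le_self_pow (by positivity) _).trans hB
  cases o with
  | const r x =>
    have r₁ := h.set r (v := x) ((ho.trans hk : x ≤ V).trans (by omega))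
    exact ⟨_, h.steps (i := .const r.code x) hp.head nofun r₁, r₁⟩
  | inc r a =>
    have := hσ.reg a
    exact h.reaches_inc r a hp (by omega)
  | input r a =>
    have r₁ := h.set r ((linearMem_le hσ.input hσ.heap (σ.reg a)).trans (by omega : V ≤ B))
    have hload : (Instr.load r.code a.code).exec c
        = ⟨c.pc + 1, Function.update c.reg r.code (linearMem w σ.heap (σ.reg a)), c.mem⟩ := by
      simp only [Instr.exec, h.reg, h.mem]
    rw [← hload] at r₁
    exact ⟨_, h.steps hp.head nofun r₁, r₁⟩
  | get r l =>
    have := hσ.heap (address σ l)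
    exact h.reaches_get r l hp ((hσ.listCode_address_le ho hk).trans hB) (by omega)
  | put l r => exact h.reaches_put l r hp ((hσ.listCode_address_le ho hk).trans hB)

theorem reaches_jmp (h : Represents w B s σ c) {l : ℕ} (hp : p[s]? = some (.jmp l)) :
    Reaches p B c (silent 1) (Represents w B l σ) := by
  have r₁ : Represents w B l σ ((Instr.jmp l).exec c) := ⟨rfl, h.len, h.reg, h.mem, h.le⟩
  exact ⟨_, h.steps hp nofun r₁, r₁⟩

theorem reaches_jeq (h : Represents w B s σ c) {a b : Reg} {l : ℕ}
    (hp : p[s]? = some (.jeq a.code b.code l)) :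
    Reaches p B c (silent 1) (Represents w B (if σ.reg a = σ.reg b then l else s + 1) σ) := by
  have r₁ : Represents w B (if σ.reg a = σ.reg b then l else s + 1) σ
      ((Instr.jeq a.code b.code l).exec c) :=
    ⟨by simp only [Instr.exec]; rw [h.reg, h.reg, h.pc], h.len, h.reg, h.mem, h.le⟩
  exact ⟨_, h.steps hp nofun r₁, r₁⟩

theorem reaches_emit (h : Represents w B s σ c) {rs : List Reg}
    (hp : p[s]? = some (.emit (rs.map Reg.code))) :
    Reaches p B c [some (rs.map σ.reg)] (Represents w B (s + 1) σ) := by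
  have hpc : p[c.pc]? = some (.emit (rs.map Reg.code)) := by rw [h.pc, hp]
  have he : emission p c = some (rs.map σ.reg) := by
    unfold emission
    rw [hpc]
    simp [h.reg]
  rw [← he]
  exact ⟨_, .of_instr hpc h.le h.le, congrArg (· + 1) h.pc, h.len, h.reg, h.mem, h.le⟩

theorem reaches_exec (hc : Represents w B s σ c) {C : Cmd} {σ' : State} {t : Trace}
    (h : Exec w C σ t σ') (hp : CodeAt p s (C.code s)) {m : ℕ} (hσ : σ.Bounded w m)
    (hC : C.extent ≤ k) (hk : k ≤ m) (hm : m + t.length ≤ V) (hB : (V + 2) ^ 3 ^ k ≤ B) :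
    Reaches p B c t (Represents w B (s + C.size) σ') := by
  induction h generalizing m s c with
  | skip σ => exact ⟨c, .nil hc.le, hc⟩
  | op o σ => exact hc.reaches_op o hp (hσ.mono (by omega)) hC (by omega) hB
  | emit rs σ => exact hc.reaches_emit hp.head
  | @seq c₁ c₂ σ σ₁ σ₂ t₁ t₂ h₁ _ ih₁ ih₂ =>
    simp only [Cmd.extent, List.length_append] at hC hm
    refine (ih₁ hc hp.left hσ (by omega) hk (by omega)).trans fun d₁ r₁ => ?_
    rw [Cmd.size, ← Nat.add_assoc]
    exact ih₂ r₁ (hp.right (c₁.length_code s)) (hσ.exec h₁ (by omega)) (by omega) (by omega)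
      (by omega)
  | @ifTrue a b c₁ c₂ σ _ t h _ ih =>
    simp only [Cmd.extent, List.length_cons] at hC hm
    refine (hc.reaches_jeq hp.head).trans fun d₁ r₁ => ?_
    rw [if_pos h] at r₁
    have hcode := (hp.tail.right (c₂.length_code (s + 1))).tail
    rw [show s + 1 + c₂.size + 1 = s + (c₂.size + 2) by omega] at hcode
    rw [Cmd.size, ← Nat.add_assoc]
    exact ih r₁ hcode hσ (by omega) hk (by omega)
  | @ifFalse a b c₁ c₂ σ _ t h _ ih =>
    simp only [Cmd.extent, List.length_cons, List.length_append] at hC hm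
    refine (hc.reaches_jeq hp.head).trans fun d₁ r₁ => ?_
    rw [if_neg h] at r₁
    refine (ih r₁ hp.tail.left hσ (by omega) hk (by omega)).trans fun d₂ r₂ => ?_
    exact r₂.reaches_jmp (hp.tail.right (c₂.length_code (s + 1))).head
  | whileDone h =>
    have := hc.reaches_jeq hp.head
    rwa [if_pos h] at this
  | @whileStep a b C σ σ₁ σ₂ t t' h h₁ _ ih₁ ih₂ =>
    simp only [Cmd.extent, List.length_cons, List.length_append] at hC hm
    refine (hc.reaches_jeq hp.head).trans fun d₁ r₁ => ?_
    rw [if_neg h] at r₁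
    refine (ih₁ r₁ hp.tail.left hσ hC hk (by omega)).trans fun d₂ r₂ => ?_
    refine (r₂.reaches_jmp (hp.tail.right (C.length_code (s + 1))).head).trans fun d₃ r₃ => ?_
    exact ih₂ r₃ hp (hσ.exec h₁ (by omega)) hC (by omega) (by omega)

end Represents

/-! ### Enumeration by structured programs -/

section Halting

variable {p : Program} {B : ℕ} {c c' : Config} {t : Trace}

theorem Halted.iterate_step (h : Halted p c) (i : ℕ) : (step p)^[i] c = c := by
  unfold Halted at h
  exact Function.iterate_fixed (by simp [step, h]) i

theorem Halted.emission_eq_none (h : Halted p c) : emission p c = none := by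
  unfold Halted at h
  simp [emission, h]

theorem Steps.halted_iterate (h : Steps p B c t c') (hc' : Halted p c') {i : ℕ}
    (hi : t.length ≤ i) : Halted p ((step p)^[i] c) := by
  induction h generalizing i with
  | nil _ => rwa [hc'.iterate_step]
  | cons _ _ ih =>
    cases i with
    | zero => simp at hi
    | succ i => exact ih hc' (Nat.le_of_succ_le_succ hi)

theorem Steps.emission_iterate_eq_some_iff (h : Steps p B c t c') (hc' : Halted p c') (i : ℕ)
    (o : List ℕ) : emission p ((step p)^[i] c) = some o ↔ t[i]? = some (some o) := by
  induction h generalizing i with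
  | nil _ => simp [hc'.iterate_step, hc'.emission_eq_none]
  | cons _ _ ih =>
    cases i with
    | zero => simp
    | succ i => exact ih hc' i

theorem Steps.reg_iterate_le (h : Steps p B c t c') (hc' : Halted p c') (i r : ℕ) :
    ((step p)^[i] c).reg r ≤ B := by
  induction h generalizing i with
  | nil hB => simpa only [hc'.iterate_step] using hB r
  | cons hB _ ih =>
    cases i with
    | zero => exact hB r
    | succ i => exact ih hc' i

theorem Steps.enumerates {w : List ℕ} {i d : ℕ} (h : Steps p B (initConfig w) (silent i ++ t) c')
    (hc' : Halted p c') (hgap : Gap d t) (hnodup : (outputs t).Nodup) :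
    Enumerates p w {o | o ∈ outputs t} i d B := by
  have hemit := h.emission_iterate_eq_some_iff hc'
  have hout : outputs (silent i ++ t) = outputs t := by simp
  refine ⟨⟨_, h.halted_iterate hc' le_rfl⟩, fun o => ?_, fun j j' o hj hj' => ?_,
    ⟨i, le_rfl, fun j hj => ?_, fun j hj => ?_⟩, h.reg_iterate_le hc'⟩
  · rw [Set.mem_ofPred, ← hout, mem_outputs]
    exact exists_congr fun j => (hemit j o).symm
  · exact index_unique_of_nodup_outputs (hout ▸ hnodup) ((hemit j o).mp hj) ((hemit j' o).mp hj')
  · refine Option.eq_none_iff_forall_ne_some.mpr fun o ho => ?_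
    have := (hemit j o).mp ho
    rw [List.getElem?_append_left (by simpa using hj)] at this
    simp [hj] at this
  · obtain hle | hlt := le_or_gt (j - i) t.length
    · obtain ⟨u, hju, huj, hu⟩ := hgap.exists_output hle
      refine ⟨i + u, by omega, by omega, hu.imp ?_ fun hu => ?_⟩
      · rintro ⟨o, ho⟩
        refine Option.ne_none_iff_exists'.mpr ⟨o, (hemit (i + u) o).mpr ?_⟩
        rw [List.getElem?_append_right (by simp)]
        simpa using ho
      · exact h.halted_iterate hc' (by simpa using hu)
    · refine ⟨j, le_rfl, by omega, .inr (h.halted_iterate hc' ?_)⟩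
      rw [List.length_append, List.length_replicate]
      omega

end Halting

theorem lt_magnitude {w : List ℕ} {x : ℕ} (hx : x ∈ w) : x < magnitude w := by
  suffices x ≤ w.foldr max 0 by
    unfold magnitude
    omega
  induction w with
  | nil => simp at hx
  | cons y w ih =>
    rcases List.mem_cons.mp hx with rfl | hx
    · exact le_max_left _ _
    · exact (ih hx).trans (le_max_right _ _)

theorem length_lt_magnitude (w : List ℕ) : w.length < magnitude w := by
  unfold magnitude
  omega

theorem represents_init {w : List ℕ} {B : ℕ} (hB : w.length ≤ B) :
    Represents w B 0 State.blank (initConfig w) where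
  pc := rfl
  len := by simp [initConfig]
  reg r := by
    have := r.five_le_code
    simp only [initConfig]
    rw [Function.update_of_ne (by omega)]
    rfl
  mem := (linearMem_zero w).symm
  le r := by
    simp only [initConfig, Function.update_apply]
    split_ifs <;> omega

theorem bounded_blank (w : List ℕ) : State.blank.Bounded w (magnitude w) where
  reg _ := Nat.zero_le _
  heap _ := Nat.zero_le _
  input _ hx := (lt_magnitude hx).le
  length := (length_lt_magnitude w).le

theorem Exec.enumerates {w : List ℕ} {C : Cmd} {σ' : State} {i d : ℕ} {t : Trace}
    (h : Exec w C State.blank (silent i ++ t) σ') (hgap : Gap d t) (hnodup : (outputs t).Nodup) :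
    Enumerates (C.code 0) w {o | o ∈ outputs t} i d
      ((magnitude w + C.extent + (i + t.length) + 2) ^ 3 ^ C.extent) := by
  set V := magnitude w + C.extent + (i + t.length) with hV
  have hVB : V + 2 ≤ (V + 2) ^ 3 ^ C.extent := Nat.le_self_pow (by positivity) _
  have hw := length_lt_magnitude w
  have hinit : Represents w ((V + 2) ^ 3 ^ C.extent) 0 State.blank (initConfig w) :=
    represents_init (by omega)
  obtain ⟨c', hsteps, hc'⟩ := hinit.reaches_exec h (List.prefix_refl _)
    ((bounded_blank w).mono (Nat.le_add_right _ C.extent)) le_rfl (by omega) (V := V)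
    (by simp [hV]) le_rfl
  refine hsteps.enumerates ?_ hgap hnodup
  rw [Halted, hc'.pc, List.getElem?_eq_none_iff, C.length_code, Nat.zero_add]

theorem Enumerates.mono {p : Program} {w : List ℕ} {A : Set (List ℕ)} {a d B a' d' B' : ℕ}
    (h : Enumerates p w A a d B) (ha : a ≤ a') (hd : d ≤ d') (hB : B ≤ B') :
    Enumerates p w A a' d' B' := by
  obtain ⟨hhalts, hsound, huniq, ⟨t₀, ht₀, hpre, hdelay⟩, hreg⟩ := h
  refine ⟨hhalts, hsound, huniq, ⟨t₀, ht₀.trans ha, hpre, fun t ht => ?_⟩,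
    fun t r => (hreg t r).trans hB⟩
  obtain ⟨u, htu, hut, hu⟩ := hdelay t ht
  exact ⟨u, htu, by omega, hu⟩

open Polynomial in
theorem exists_eval_le_pow (P : ℕ[X]) : ∃ r, ∀ N ≥ 2, P.eval N ≤ N ^ r := by
  induction P using Polynomial.induction_on' with
  | add P Q hP hQ =>
    obtain ⟨r, hr⟩ := hP
    obtain ⟨s, hs⟩ := hQ
    refine ⟨max r s + 1, fun N hN => ?_⟩
    calc (P + Q).eval N ≤ N ^ r + N ^ s := by
          rw [eval_add]
          exact Nat.add_le_add (hr N hN) (hs N hN)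
      _ ≤ N ^ max r s + N ^ max r s := by
          gcongr <;> omega
      _ = N ^ max r s * 2 := (Nat.mul_two _).symm
      _ ≤ N ^ (max r s + 1) := Nat.mul_le_mul_left _ hN
  | monomial n a =>
    refine ⟨a + n, fun N hN => ?_⟩
    rw [eval_monomial, pow_add]
    exact Nat.mul_le_mul_right _
      (Nat.lt_two_pow_self.le.trans (Nat.pow_le_pow_left hN a))

/-! ### Ear decompositions -/

section EarDecomposition

variable {S : Schema} {n : ℕ}

/-- An atom `atom` to be removed from an acyclic set of atoms, with a number `id` that names it in
the memory of the machine and a list `key` of the variables that it shares with the atoms that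
remain. -/
structure Ear (S : Schema) (n : ℕ) where
  id : ℕ
  atom : Atom S n
  key : List (Fin n)

/-- `e` is an ear of the atoms `es` that remain after it: all the variables that it shares with them
occur in a single one of them, its parent. -/
structure Ear.IsEarOf (e : Ear S n) (es : List (Ear S n)) : Prop where
  id_eq : e.id = es.length
  mem_key : ∀ x, x ∈ e.key ↔ x ∈ Atom.vars e.atom ∧ ∃ b ∈ es, x ∈ Atom.vars b.atom
  exists_parent : es ≠ [] → ∃ p ∈ es, ∀ x ∈ e.key, x ∈ Atom.vars p.atom

/-- The list is an ear decomposition: each of its entries is an ear of those that follow it. -/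
def EarList : List (Ear S n) → Prop
  | [] => True
  | e :: es => e.IsEarOf es ∧ EarList es

theorem EarList.id_lt {es : List (Ear S n)} (h : EarList es) : ∀ e ∈ es, e.id < es.length := by
  induction es with
  | nil => simp
  | cons e es ih =>
    intro b hb
    rcases List.mem_cons.mp hb with rfl | hb
    · simp [h.1.id_eq]
    · exact (ih h.2 b hb).trans (by simp)

variable {W : Type*} {T : SimpleGraph W}

theorem preconnected_induce_diff_singleton {U : Set W} {l : W}
    (hl : (U ∩ T.neighborSet l).Subsingleton) (hU : (T.induce U).Preconnected) :
    (T.induce (U \ {l})).Preconnected := by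
  have hconn : ((T.induce U).induce {a | a.1 ≠ l}).Preconnected := by
    refine hU.induce_of_degree_eq_one ?_
    rintro ⟨v, hv⟩ hvl ⟨y, hy⟩ hvy ⟨z, hz⟩ hvz
    obtain rfl : v = l := by simpa using hvl
    exact Subtype.ext (hl ⟨hy, hvy⟩ ⟨hz, hvz⟩)
  let φ : (T.induce U).induce {a | a.1 ≠ l} →g T.induce (U \ {l}) :=
    ⟨fun a => ⟨a.1.1, a.1.2, a.2⟩, fun h => h⟩
  intro a b
  exact (hconn ⟨⟨a.1, a.2.1⟩, a.2.2⟩ ⟨⟨b.1, b.2.1⟩, b.2.2⟩).map φ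

theorem exists_adj_of_preconnected_induce {U : Set W} (hU : (T.induce U).Preconnected) {l u : W}
    (hl : l ∈ U) (hu : u ∈ U) (hne : l ≠ u) : ∃ z ∈ U, T.Adj l z := by
  have h := hU ⟨l, hl⟩ ⟨u, hu⟩
  rw [SimpleGraph.reachable_iff_reflTransGen] at h
  rcases h.cases_head with h | ⟨⟨z, hz⟩, hlz, -⟩
  · exact (hne (congrArg Subtype.val h)).elim
  · exact ⟨z, hz, hlz⟩

theorem exists_subsingleton_inter_neighborSet (hT : T.IsAcyclic) {U : Finset W}
    (hne : U.Nonempty) (hU : (T.induce (U : Set W)).Preconnected) :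
    ∃ l ∈ U, ((U : Set W) ∩ T.neighborSet l).Subsingleton := by
  classical
  rcases hne.exists_eq_singleton_or_nontrivial with ⟨l, rfl⟩ | hU'
  · exact ⟨l, by simp, by simp⟩
  · have : Nontrivial (U : Set W) := hU'.coe_sort
    have : Nonempty (U : Set W) := inferInstance
    have : Fintype (U : Set W) := inferInstanceAs (Fintype U)
    obtain ⟨⟨l, hl⟩, hdeg⟩ := SimpleGraph.IsTree.exists_vert_degree_one_of_nontrivial
      (G := T.induce (U : Set W)) ⟨⟨hU⟩, hT.induce _⟩
    refine ⟨l, hl, fun y hy z hz => congrArg Subtype.val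
      ((SimpleGraph.degree_eq_one_iff_existsUnique_adj.mp hdeg).unique
        (y₁ := ⟨y, hy.1⟩) (y₂ := ⟨z, hz.1⟩) hy.2 hz.2)⟩

theorem exists_isEarOf_of_leaf {atom : W → Atom S n} {U : Set W} {l : W} (hl : l ∈ U)
    (hleaf : (U ∩ T.neighborSet l).Subsingleton) (hU : (T.induce U).Preconnected)
    (hvar : ∀ x, (T.induce (U ∩ {a | x ∈ Atom.vars (atom a)})).Preconnected)
    {es : List (Ear S n)} (hes : ∀ a, (∃ e ∈ es, e.atom = a) ↔ ∃ u ∈ U \ {l}, atom u = a) :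
    ∃ e : Ear S n, e.atom = atom l ∧ e.IsEarOf es := by
  classical
  refine ⟨⟨es.length, atom l, (List.finRange n).filter
    fun x => x ∈ Atom.vars (atom l) ∧ ∃ b ∈ es, x ∈ Atom.vars b.atom⟩, rfl, rfl,
    fun x => by simp, fun hne => ?_⟩
  obtain ⟨b, hb⟩ := List.exists_mem_of_ne_nil es hne
  obtain ⟨u, ⟨hu, hul⟩, -⟩ := (hes b.atom).mp ⟨b, hb, rfl⟩
  obtain ⟨p, hp, hlp⟩ := exists_adj_of_preconnected_induce hU hl hu (Ne.symm hul)
  obtain ⟨e, he, hep⟩ := (hes (atom p)).mpr ⟨p, ⟨hp, hlp.ne'⟩, rfl⟩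
  refine ⟨e, he, fun x hx => ?_⟩
  obtain ⟨hxl, b, hb, hxb⟩ : x ∈ Atom.vars (atom l) ∧ ∃ b ∈ es, x ∈ Atom.vars b.atom := by
    simpa using hx
  obtain ⟨u, ⟨hu, hul⟩, hub⟩ := (hes b.atom).mp ⟨b, hb, rfl⟩
  obtain ⟨z, ⟨hz, hxz⟩, hlz⟩ := exists_adj_of_preconnected_induce (hvar x) (u := u) ⟨hl, hxl⟩
    ⟨hu, by rwa [Set.mem_ofPred_eq, hub]⟩ (Ne.symm hul)
  obtain rfl : z = p := hleaf ⟨hz, hlz⟩ ⟨hp, hlp⟩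
  rwa [hep]

theorem exists_earList (atom : W → Atom S n) (hT : T.IsAcyclic) (U : Finset W)
    (hU : (T.induce (U : Set W)).Preconnected)
    (hvar : ∀ x, (T.induce ((U : Set W) ∩ {a | x ∈ Atom.vars (atom a)})).Preconnected) :
    ∃ es : List (Ear S n), EarList es ∧
      ∀ a, (∃ e ∈ es, e.atom = a) ↔ ∃ u ∈ (U : Set W), atom u = a := by
  classical
  induction hk : U.card generalizing U with
  | zero =>
    obtain rfl := Finset.card_eq_zero.mp hk
    exact ⟨[], trivial, by simp⟩
  | succ k ih =>
    obtain ⟨l, hl, hleaf⟩ :=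
      exists_subsingleton_inter_neighborSet hT (Finset.card_pos.mp (by omega)) hU
    obtain ⟨es, hes, hmem⟩ := ih (U.erase l)
      (by
        rw [Finset.coe_erase]
        exact preconnected_induce_diff_singleton hleaf hU)
      (fun x => by
        rw [Finset.coe_erase, ← Set.inter_sdiff_right_comm]
        refine preconnected_induce_diff_singleton (hleaf.anti ?_) (hvar x)
        exact Set.inter_subset_inter_left _ Set.inter_subset_left)
      (by rw [Finset.card_erase_of_mem hl, hk, Nat.add_sub_cancel])
    rw [Finset.coe_erase] at hmem
    obtain ⟨e, he, hear⟩ := exists_isEarOf_of_leaf hl hleaf hU hvar hmem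
    refine ⟨e :: es, ⟨hear, hes⟩, fun a => ?_⟩
    rw [← Set.insert_sdiff_self_of_mem (Finset.mem_coe.mpr hl)]
    simp only [List.exists_mem_cons_iff, Set.exists_mem_insert, hmem, he]

theorem IsAcyclic.exists_earList {A : Finset (Atom S n)} (h : IsAcyclic A) :
    ∃ es : List (Ear S n), EarList es ∧ ∀ a, (∃ e ∈ es, e.atom = a) ↔ a ∈ A := by
  obtain ⟨T, hconn, hacyc, hvar⟩ := h
  have hU : (T.induce ((Finset.univ : Finset {a // a ∈ A}) : Set {a // a ∈ A})).Preconnected := by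
    rw [Finset.coe_univ]
    exact SimpleGraph.induceUnivIso T |>.symm.preconnected_iff.mp hconn
  obtain ⟨es, hes, hmem⟩ := MirrorCQ.exists_earList Subtype.val hacyc Finset.univ hU
    fun x => by
      rw [Finset.coe_univ, Set.univ_inter]
      exact hvar x
  exact ⟨es, hes, fun a => by simp [hmem]⟩

end EarDecomposition

/-! ### Splitting the solutions of a mirror query -/

section Splitting

variable {S : Schema} {n : ℕ} {D : Database S}

/-- The assignment `v` satisfies the atoms in `A`. -/
def Sat (D : Database S) (A : Finset (Atom S n)) (v : Fin n → ℕ) : Prop :=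
  ∀ a ∈ A, v ∘ a.2 ∈ D.rel a.1

theorem sat_congr {A : Finset (Atom S n)} {v v' : Fin n → ℕ} (h : ∀ x ∈ varsOf A, v x = v' x) :
    Sat D A v ↔ Sat D A v' := by
  refine forall₂_congr fun a ha => ?_
  rw [show v ∘ a.2 = v' ∘ a.2 from funext fun j => h _ ⟨a, ha, j, rfl⟩]

theorem sat_image_map {A : Finset (Atom S n)} {f : Fin n → Fin n} {v : Fin n → ℕ} :
    Sat D (A.image (Atom.map f)) v ↔ Sat D A (v ∘ f) := by
  simp only [Sat, Finset.forall_mem_image]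
  rfl

variable {q : FullCQ S} {I : Finset (Atom S q.numVars)}

theorem FullCQ.mem_solutions {v : Fin q.numVars → ℕ} : v ∈ q.solutions D ↔ Sat D q.atoms v := by
  refine ⟨And.right, fun h => ⟨fun x => ?_, h⟩⟩
  obtain ⟨a, ha, j, rfl⟩ := q.covered x
  exact D.rel_mem_dom _ _ (h a ha) j

theorem FullCQ.mem_solutions_iff_of_subset (hI : I ⊆ q.atoms) {v : Fin q.numVars → ℕ} :
    v ∈ q.solutions D ↔ Sat D I v ∧ Sat D (q.atoms \ I) v := by
  rw [FullCQ.mem_solutions]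
  conv_lhs => rw [← Finset.union_sdiff_of_subset hI]
  exact Finset.forall_mem_union

theorem FullCQ.IsImage.subset (h : q.IsImage I) : I ⊆ q.atoms := by
  obtain ⟨ν, hν, rfl⟩ := h
  exact Finset.image_subset_iff.mpr hν

theorem FullCQ.mem_varsOf_sdiff {x : Fin q.numVars} (hx : x ∉ varsOf I) :
    x ∈ varsOf (q.atoms \ I) := by
  obtain ⟨a, ha, hxa⟩ := q.covered x
  exact ⟨a, Finset.mem_sdiff.mpr ⟨ha, fun h => hx ⟨a, h, hxa⟩⟩, hxa⟩

open Classical in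
/-- The assignment that is `s` on `X` and `s' ∘ g` elsewhere. -/
noncomputable def combine (X : Set (Fin n)) (g : Fin n → Fin n) (s s' : Fin n → ℕ) : Fin n → ℕ :=
  fun x => if x ∈ X then s x else s' (g x)

theorem combine_of_mem {X : Set (Fin n)} {x : Fin n} (h : x ∈ X) (g : Fin n → Fin n)
    (s s' : Fin n → ℕ) : combine X g s s' x = s x :=
  if_pos h

theorem combine_of_notMem {X : Set (Fin n)} {x : Fin n} (h : x ∉ X) (g : Fin n → Fin n)
    (s s' : Fin n → ℕ) : combine X g s s' x = s' (g x) :=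
  if_neg h

theorem combine_congr {X : Set (Fin n)} {g : Fin n → Fin n} (hg : ∀ x ∉ X, g x ∈ X)
    {s s' u u' : Fin n → ℕ} (hs : ∀ x ∈ X, s x = u x) (hs' : ∀ x ∈ X, s' x = u' x) :
    combine X g s s' = combine X g u u' := by
  funext x
  by_cases hx : x ∈ X
  · rw [combine_of_mem hx, combine_of_mem hx, hs x hx]
  · rw [combine_of_notMem hx, combine_of_notMem hx, hs' _ (hg x hx)]

theorem combine_apply_of_isIsomorphism {A B : Finset (Atom S n)} {f g : Fin n → Fin n}
    (hf : IsIsomorphism f A B) (hfix : ∀ x ∈ varsOf A ∩ varsOf B, f x = x)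
    (hg : ∀ x ∈ varsOf B, x ∉ varsOf A → g x ∈ varsOf A ∧ f (g x) = x) {s s' : Fin n → ℕ}
    (hss' : ∀ x ∈ varsOf A ∩ varsOf B, s x = s' x) {x : Fin n} (hx : x ∈ varsOf A) :
    combine (varsOf A) g s s' (f x) = s' x := by
  have hfx : f x ∈ varsOf B := hf.1.mapsTo hx
  by_cases h : f x ∈ varsOf A
  · have hxx : f x = x := hf.1.injOn h hx (hfix (f x) ⟨h, hfx⟩)
    rw [combine_of_mem h, hxx, hss' x ⟨hx, hxx ▸ hfx⟩]
  · obtain ⟨hgx, hfg⟩ := hg _ hfx h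
    rw [combine_of_notMem h, hf.1.injOn hgx hx hfg]

/-- The solutions of `q` are, without repetition, the combinations by `g` of the pairs of solutions
of the query with atoms `I` that agree on `Z`. -/
structure Splitting (q : FullCQ S) (I : Finset (Atom S q.numVars)) (Z : List (Fin q.numVars))
    (g : Fin q.numVars → Fin q.numVars) : Prop where
  shared_mem : ∀ x ∈ Z, x ∈ varsOf I
  partner_mem : ∀ x ∉ varsOf I, g x ∈ varsOf I
  exists_combine : ∀ D, ∀ v ∈ q.solutions D, ∃ s s', Sat D I s ∧ Sat D I s' ∧
    (∀ x ∈ Z, s x = s' x) ∧ v = combine (varsOf I) g s s'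
  combine_mem : ∀ D s s', Sat D I s → Sat D I s' → (∀ x ∈ Z, s x = s' x) →
    combine (varsOf I) g s s' ∈ q.solutions D
  combine_inj : ∀ s s' u u' : Fin q.numVars → ℕ, (∀ x ∈ Z, s x = s' x) → (∀ x ∈ Z, u x = u' x) →
    combine (varsOf I) g s s' = combine (varsOf I) g u u' →
    ∀ x ∈ varsOf I, s x = u x ∧ s' x = u' x

theorem Splitting.of_isIsomorphism (hI : I ⊆ q.atoms) {f g : Fin q.numVars → Fin q.numVars}
    (hf : IsIsomorphism f I (q.atoms \ I))
    (hfix : ∀ x ∈ varsOf I ∩ varsOf (q.atoms \ I), f x = x)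
    (hg : ∀ x ∈ varsOf (q.atoms \ I), x ∉ varsOf I → g x ∈ varsOf I ∧ f (g x) = x)
    {Z : List (Fin q.numVars)} (hZ : ∀ x, x ∈ Z ↔ x ∈ varsOf I ∩ varsOf (q.atoms \ I)) :
    Splitting q I Z g := by
  have hright : ∀ s s' : Fin q.numVars → ℕ, (∀ x ∈ Z, s x = s' x) → ∀ x ∈ varsOf I,
      combine (varsOf I) g s s' (f x) = s' x := fun s s' hss' x hx =>
    combine_apply_of_isIsomorphism hf hfix hg (fun x hx => hss' x ((hZ x).mpr hx)) hx
  refine ⟨fun x hx => ((hZ x).mp hx).1, fun x hx => (hg x (FullCQ.mem_varsOf_sdiff hx) hx).1,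
    fun D v hv => ?_, fun D s s' hs hs' hss' => ?_, fun s s' u u' hss' huu' h x hx => ⟨?_, ?_⟩⟩
  · rw [FullCQ.mem_solutions_iff_of_subset hI, ← hf.2, sat_image_map] at hv
    refine ⟨v, v ∘ f, hv.1, hv.2, fun x hx => ?_, funext fun x => ?_⟩
    · rw [Function.comp_apply, hfix x ((hZ x).mp hx)]
    · by_cases hx : x ∈ varsOf I
      · rw [combine_of_mem hx]
      · rw [combine_of_notMem hx, Function.comp_apply,
          (hg x (FullCQ.mem_varsOf_sdiff hx) hx).2]
  · rw [FullCQ.mem_solutions_iff_of_subset hI, ← hf.2, sat_image_map]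
    exact ⟨(sat_congr fun x hx => combine_of_mem hx ..).mpr hs,
      (sat_congr fun x hx => hright s s' hss' x hx).mpr hs'⟩
  · simpa only [combine_of_mem hx] using congrFun h x
  · rw [← hright s s' hss' x hx, h, hright u u' huu' x hx]

theorem FullCQ.IsMirror.exists_splitting (hq : q.IsMirror) :
    ∃ I Z g, IsAcyclic I ∧ Splitting q I Z g := by
  classical
  obtain ⟨I, hI, hacyc, f, hf, hfix⟩ := hq
  have hinv : ∀ x, ∃ y, x ∈ varsOf (q.atoms \ I) → y ∈ varsOf I ∧ f y = x := fun x => by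
    by_cases hx : x ∈ varsOf (q.atoms \ I)
    · exact (hf.1.surjOn hx).imp fun y hy _ => hy
    · exact ⟨x, fun h => (hx h).elim⟩
  choose g hg using hinv
  exact ⟨I, (List.finRange q.numVars).filter (· ∈ varsOf I ∩ varsOf (q.atoms \ I)), g, hacyc,
    .of_isIsomorphism hI.subset hf hfix (fun x hx _ => hg x hx) (by simp)⟩

end Splitting

/-! ### Linked lists -/

section LinkedLists

open Classical in
/-- The last of the numbers `1, …, m` with the property `P`, or `0` if there is none. -/
noncomputable def last (P : ℕ → Prop) : ℕ → ℕ
  | 0 => 0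
  | m + 1 => if P (m + 1) then m + 1 else last P m

variable {P : ℕ → Prop} {m : ℕ}

theorem last_succ_of_pos (h : P (m + 1)) : last P (m + 1) = m + 1 := if_pos h

theorem last_succ_of_neg (h : ¬ P (m + 1)) : last P (m + 1) = last P m := if_neg h

theorem last_congr {P' : ℕ → Prop} (h : ∀ j, 1 ≤ j → j ≤ m → (P j ↔ P' j)) :
    last P m = last P' m := by
  induction m with
  | zero => rfl
  | succ m ih =>
    have hm := h (m + 1) (by omega) le_rfl
    by_cases hP : P (m + 1)
    · rw [last_succ_of_pos hP, last_succ_of_pos (hm.mp hP)]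
    · rw [last_succ_of_neg hP, last_succ_of_neg (mt hm.mpr hP),
        ih fun j hj hjm => h j hj (by omega)]

theorem last_ne_zero : last P m ≠ 0 ↔ ∃ j, 1 ≤ j ∧ j ≤ m ∧ P j := by
  induction m with
  | zero =>
    simp only [last, ne_eq, not_true_eq_false, false_iff]
    rintro ⟨j, hj, hj', -⟩
    omega
  | succ m ih =>
    by_cases h : P (m + 1)
    · rw [last_succ_of_pos h]
      exact ⟨fun _ => ⟨m + 1, by omega, le_rfl, h⟩, fun _ => by omega⟩
    · rw [last_succ_of_neg h, ih]
      refine ⟨fun ⟨j, hj, hjm, hP⟩ => ⟨j, hj, by omega, hP⟩, fun ⟨j, hj, hjm, hP⟩ => ?_⟩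
      rcases hjm.lt_or_eq with hlt | rfl
      · exact ⟨j, hj, by omega, hP⟩
      · exact (h hP).elim

/-- For each key `κ` the numbers `1, …, m` with the property `P κ` form a linked list in descending
order: `head κ` is its first entry and `next j` the entry after `j`; `0` marks the end. -/
structure Chained (P : List ℕ → ℕ → Prop) (head : List ℕ → ℕ) (next : ℕ → ℕ) (m : ℕ) : Prop where
  head_eq : ∀ κ, head κ = last (P κ) m
  next_eq : ∀ κ j, 1 ≤ j → j ≤ m → P κ j → next j = last (P κ) (j - 1)

variable {P : List ℕ → ℕ → Prop} {head head' : List ℕ → ℕ} {next next' : ℕ → ℕ}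

theorem Chained.zero (h : ∀ κ, head κ = 0) : Chained P head next 0 :=
  ⟨h, fun _ j hj hj' => by omega⟩

theorem Chained.congr {P' : List ℕ → ℕ → Prop} (h : Chained P head next m)
    (hP : ∀ κ j, 1 ≤ j → j ≤ m → (P κ j ↔ P' κ j)) : Chained P' head next m where
  head_eq κ := (h.head_eq κ).trans (last_congr (hP κ))
  next_eq κ j hj hjm hPj := (h.next_eq κ j hj hjm ((hP κ j hj hjm).mpr hPj)).trans
    (last_congr fun i hi hij => hP κ i hi (by omega))

theorem Chained.skip (h : Chained P head next m) (hP : ∀ κ, ¬ P κ (m + 1)) :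
    Chained P head next (m + 1) where
  head_eq κ := by rw [h.head_eq, last_succ_of_neg (hP κ)]
  next_eq κ j hj hjm hPj := by
    rcases hjm.lt_or_eq with hlt | rfl
    · exact h.next_eq κ j hj (by omega) hPj
    · exact (hP κ hPj).elim

theorem Chained.insert {κ₀ : List ℕ} (h : Chained P head next m)
    (hP : ∀ κ, P κ (m + 1) ↔ κ = κ₀) (head_self : head' κ₀ = m + 1)
    (head_of_ne : ∀ κ, κ ≠ κ₀ → head' κ = head κ) (next_succ : next' (m + 1) = head κ₀)
    (next_of_le : ∀ j, j ≤ m → next' j = next j) : Chained P head' next' (m + 1) where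
  head_eq κ := by
    by_cases hκ : κ = κ₀
    · rw [last_succ_of_pos ((hP κ).mpr hκ), hκ, head_self]
    · rw [last_succ_of_neg (fun h => hκ ((hP κ).mp h)), head_of_ne κ hκ, h.head_eq]
  next_eq κ j hj hjm hPj := by
    rcases hjm.lt_or_eq with hlt | rfl
    · rw [next_of_le j (by omega)]
      exact h.next_eq κ j hj (by omega) hPj
    · rw [next_succ, h.head_eq, (hP κ).mp hPj, Nat.add_sub_cancel]

end LinkedLists

section Entry

variable {α : Type*} [Inhabited α] {l : List α} {a : α} {i j : ℕ}

/-- The `j`-th member of `l`, counted from `1`, as `0` marks the end of a linked list of numbers of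
members. -/
def entry (l : List α) (j : ℕ) : α := l.getD (j - 1) default

theorem drop_eq_entry_cons (hj : j < l.length) : l.drop j = entry l (j + 1) :: l.drop (j + 1) := by
  rw [List.drop_eq_getElem_cons hj]
  simp [entry, hj]

theorem mem_iff_exists_entry : a ∈ l ↔ ∃ j, 1 ≤ j ∧ j ≤ l.length ∧ a = entry l j := by
  rw [List.mem_iff_getElem]
  constructor
  · rintro ⟨i, hi, rfl⟩
    exact ⟨i + 1, by omega, by omega, by simp [entry, hi]⟩
  · rintro ⟨j, hj, hjm, rfl⟩
    exact ⟨j - 1, by omega, by rw [entry, List.getD_eq_getElem _ _ (by omega)]⟩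

theorem entry_inj (hl : l.Nodup) (hi : 1 ≤ i) (hi' : i ≤ l.length) (hj : 1 ≤ j)
    (hj' : j ≤ l.length) (h : entry l i = entry l j) : i = j := by
  rw [entry, entry, List.getD_eq_getElem _ _ (by omega), List.getD_eq_getElem _ _ (by omega)] at h
  have := (List.Nodup.getElem_inj_iff hl).mp h
  omega

theorem entry_append (l' : List α) (hj : 1 ≤ j) (hj' : j ≤ l.length) :
    entry (l ++ l') j = entry l j :=
  List.getD_append _ _ _ _ (by omega)

theorem entry_concat (l : List α) (a : α) : entry (l ++ [a]) (l.length + 1) = a := by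
  simp [entry]

end Entry

/-! ### Reading the input -/

section Input

variable {S : Schema}

/-- The tuples of a database in the order in which they are listed. -/
abbrev Rows (S : Schema) : Type := (R : Fin S.numSymbols) → List (Fin (S.arity R) → ℕ)

/-- The listing of the relations with symbols in `l`, as in `Database.IsEncoding`. -/
def Rows.encode (rows : Rows S) (l : List (Fin S.numSymbols)) : List ℕ :=
  l.flatMap fun R => (rows R).length :: (rows R).flatMap List.ofFn

theorem drop_succ_of_drop {w : List ℕ} {i x : ℕ} {tl : List ℕ} (h : w.drop i = x :: tl) :
    w.drop (i + 1) = tl := by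
  rw [← List.drop_drop, h]
  rfl

/-- Copy the next tuple of the input, the one of `R` with the number in register `row`, to the
heap. -/
def readTuple (R : Fin S.numSymbols) (l : List (Fin (S.arity R))) : List Op :=
  l.flatMap fun (k : Fin _) =>
    [.input .aux .pos, .inc .pos .pos, .put [.lit 0, .lit R, .lit k, .reg .row] .aux]

/-- Copy the next relation of the input, that of `R`, to the heap. -/
def readRel (R : Fin S.numSymbols) : Cmd :=
  .seq (.block [.input (.cnt R) .pos, .inc .pos .pos, .const .row 0])
    (.whileNe .row (.cnt R) (.block (.inc .row .row :: readTuple R (List.finRange _))))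

/-- Copy the relations of the symbols in `l` to the heap. -/
def readAll (l : List (Fin S.numSymbols)) : Cmd :=
  l.foldr (fun R C => .seq (readRel R) C) .skip

variable {w : List ℕ} {R : Fin S.numSymbols}

/-- The entries in the positions `l` of the tuple `t` of `R` have been copied. -/
structure TupleRead (w : List ℕ) (R : Fin S.numSymbols) (t : Fin (S.arity R) → ℕ)
    (l : List (Fin (S.arity R))) (tl : List ℕ) (σ σ' : State) : Prop where
  input : w.drop (σ'.reg .pos) = tl
  reg : ∀ r, r ≠ .aux → r ≠ .pos → σ'.reg r = σ.reg r
  heap : ∀ k ∈ l, σ'.heap [0, R, k, σ.reg .row] = t k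
  heap_of_ne : ∀ a, (∀ k ∈ l, a ≠ [0, ↑R, ↑k, σ.reg .row]) → σ'.heap a = σ.heap a

theorem readTuple_eval (t : Fin (S.arity R) → ℕ) (l : List (Fin (S.arity R))) (tl : List ℕ)
    (σ : State) (h : w.drop (σ.reg .pos) = l.map t ++ tl) :
    TupleRead w R t l tl σ ((Cmd.block (readTuple R l)).eval w σ) := by
  induction l generalizing σ with
  | nil => exact ⟨by simpa [readTuple] using h, by simp [readTuple], by simp, by simp [readTuple]⟩
  | cons k l ih =>
    rw [List.map_cons, List.cons_append] at h
    let σ₁ := ((σ.set .aux (t k)).set .pos (σ.reg .pos + 1)).write [0, R, k, σ.reg .row] (t k)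
    have heval : (Cmd.block (readTuple R (k :: l))).eval w σ =
        (Cmd.block (readTuple R l)).eval w σ₁ := by
      rw [readTuple, List.flatMap_cons]
      simp [Op.eval, linearMem_of_drop _ h, State.set_reg, σ₁, readTuple]
    have hrow : σ₁.reg .row = σ.reg .row := by simp [σ₁, State.set_reg]
    obtain ⟨hinput, hreg, hheap, hframe⟩ := ih σ₁ (by
      rw [show σ₁.reg .pos = σ.reg .pos + 1 by simp [σ₁]]
      exact drop_succ_of_drop h)
    rw [← heval] at hinput hreg hheap hframe
    rw [hrow] at hheap hframe
    refine ⟨hinput, fun r hr hr' => ?_, fun k' hk' => ?_, fun a ha => ?_⟩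
    · rw [hreg r hr hr']
      simp [σ₁, State.set_reg, hr, hr']
    · by_cases hl : k' ∈ l
      · exact hheap k' hl
      · obtain rfl : k' = k := by simpa [hl] using hk'
        rw [hframe _ fun k'' hk'' he => hl ?_]
        · simp [σ₁, State.write_heap]
        · rwa [show k' = k'' by simpa [Fin.val_inj] using he]
    · rw [hframe a fun k' hk' => ha k' (List.mem_cons_of_mem _ hk')]
      simp [σ₁, State.write_heap, ha k (by simp)]

/-- The first `j` tuples of `R` have been copied; the input goes on with the others and `tl`. -/
structure RelRead (w : List ℕ) (rows : Rows S) (R : Fin S.numSymbols) (tl : List ℕ) (σ : State)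
    (j : ℕ) (σ' : State) : Prop where
  row : σ'.reg .row = j
  cnt : σ'.reg (.cnt R) = (rows R).length
  input : w.drop (σ'.reg .pos) = ((rows R).drop j).flatMap List.ofFn ++ tl
  reg : ∀ r, r ≠ .aux → r ≠ .pos → r ≠ .row → r ≠ .cnt R → σ'.reg r = σ.reg r
  heap : ∀ (k : Fin (S.arity R)) i, 1 ≤ i → i ≤ j → σ'.heap [0, R, k, i] = entry (rows R) i k
  heap_of_ne : ∀ a, (∀ k i, a ≠ [0, ↑R, k, i]) → σ'.heap a = σ.heap a

variable {rows : Rows S} {tl : List ℕ} {σ : State}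

theorem RelRead.zero (h : w.drop (σ.reg .pos) = rows.encode [R] ++ tl) :
    RelRead w rows R tl σ 0
      ((Cmd.block [.input (.cnt R) .pos, .inc .pos .pos, .const .row 0]).eval w σ) := by
  replace h : w.drop (σ.reg .pos) = (rows R).length :: ((rows R).flatMap List.ofFn ++ tl) := by
    simpa [Rows.encode] using h
  simp only [Cmd.eval_block_cons, Cmd.eval_block_nil, Op.eval, linearMem_of_drop _ h]
  refine ⟨by simp, by simp [State.set_reg], ?_, fun r _ _ _ _ => by simp [State.set_reg, *],
    fun k i hi hi' => by omega, fun a _ => rfl⟩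
  simpa [State.set_reg] using drop_succ_of_drop h

theorem RelRead.step {j : ℕ} {σ' : State} (h : RelRead w rows R tl σ j σ')
    (hj : j < (rows R).length) : RelRead w rows R tl σ (j + 1)
      ((Cmd.block (.inc .row .row :: readTuple R (List.finRange _))).eval w σ') := by
  have hin := h.input
  rw [drop_eq_entry_cons hj, List.flatMap_cons, List.append_assoc, List.ofFn_eq_map] at hin
  obtain ⟨hinput, hreg, hheap, hframe⟩ := readTuple_eval (entry (rows R) (j + 1)) (List.finRange _)
    (((rows R).drop (j + 1)).flatMap List.ofFn ++ tl) (σ'.set .row (j + 1)) (w := w)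
    (by simpa [State.set_reg] using hin)
  rw [State.set_reg_self] at hheap hframe
  rw [Cmd.eval_block_cons, Op.eval, h.row]
  refine ⟨?_, ?_, hinput, fun r h₁ h₂ h₃ h₄ => ?_, fun k i hi hi' => ?_, fun a ha => ?_⟩
  · rw [hreg _ (by simp) (by simp), State.set_reg_self]
  · rw [hreg _ (by simp) (by simp), State.set_reg_of_ne _ _ (by simp), h.cnt]
  · rw [hreg r h₁ h₂, State.set_reg_of_ne _ _ h₃, h.reg r h₁ h₂ h₃ h₄]
  · rcases hi'.lt_or_eq with hlt | rfl
    · rw [hframe _ (by simp; omega)]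
      exact h.heap k i hi (by omega)
    · exact hheap k (by simp)
  · rw [hframe a fun k _ => ha k _]
    exact h.heap_of_ne a ha

theorem readRel_runs (R : Fin S.numSymbols) : ∃ κ, ∀ (w : List ℕ) (rows : Rows S) (tl : List ℕ)
    (σ : State), w.drop (σ.reg .pos) = rows.encode [R] ++ tl →
    ∃ σ', Runs w (readRel R) (κ * ((rows R).length + 1)) σ σ' ∧
      RelRead w rows R tl σ (rows R).length σ' := by
  set A : Cmd := .block [.input (.cnt R) .pos, .inc .pos .pos, .const .row 0] with hA
  set B : Cmd := .block (.inc .row .row :: readTuple R (List.finRange _)) with hB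
  refine ⟨A.cost + B.cost + 3, fun w rows tl σ h => ?_⟩
  obtain ⟨σ', hruns, hσ'⟩ := Runs.whileNe_of_invariant (J := RelRead w rows R tl σ)
    (fun j τ hτ => ⟨hτ.row, hτ.cnt⟩)
    (fun j τ hj hτ => ⟨_, (Cmd.plain_block _).runs τ, hτ.step hj⟩) (RelRead.zero h)
  refine ⟨σ', (((Cmd.plain_block _).runs σ).seq hruns).mono ?_, hσ'⟩
  rw [← hA, ← hB]
  nlinarith [Nat.zero_le A.cost, Nat.zero_le B.cost, Nat.zero_le (rows R).length]

/-- The relations of the symbols in `l` have been copied. -/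
structure RelsRead (rows : Rows S) (l : List (Fin S.numSymbols)) (σ σ' : State) : Prop where
  cnt : ∀ R ∈ l, σ'.reg (.cnt R) = (rows R).length
  reg : ∀ r, r ≠ .aux → r ≠ .pos → r ≠ .row → (∀ R ∈ l, r ≠ .cnt R) → σ'.reg r = σ.reg r
  heap : ∀ R ∈ l, ∀ (k : Fin (S.arity R)) j, 1 ≤ j → j ≤ (rows R).length →
    σ'.heap [0, R, k, j] = entry (rows R) j k
  heap_of_ne : ∀ a, (∀ R ∈ l, ∀ k j, a ≠ [0, ↑R, k, j]) → σ'.heap a = σ.heap a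

theorem RelRead.relsRead {l : List (Fin S.numSymbols)} (hR : R ∉ l) {σ₁ σ₂ : State}
    (h₁ : RelRead w rows R tl σ (rows R).length σ₁) (h₂ : RelsRead rows l σ₁ σ₂) :
    RelsRead rows (R :: l) σ σ₂ := by
  have hne : ∀ R' ∈ l, (R : ℕ) ≠ R' := fun R' hR' he => hR (Fin.val_injective he ▸ hR')
  refine ⟨List.forall_mem_cons.mpr ⟨?_, h₂.cnt⟩, fun r h_aux h_pos h_row h_cnt => ?_,
    List.forall_mem_cons.mpr ⟨fun k j hj hj' => ?_, h₂.heap⟩, fun a ha => ?_⟩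
  · rw [h₂.reg _ (by simp) (by simp) (by simp) (by simpa using hne), h₁.cnt]
  · rw [h₂.reg r h_aux h_pos h_row fun R' h' => h_cnt R' (List.mem_cons_of_mem _ h'),
      h₁.reg r h_aux h_pos h_row (h_cnt R (by simp))]
  · rw [h₂.heap_of_ne _ fun R' hR' k' j' he => hne R' hR' (by simp_all), h₁.heap k j hj hj']
  · rw [h₂.heap_of_ne a fun R' h' => ha R' (List.mem_cons_of_mem _ h'),
      h₁.heap_of_ne a (ha R (by simp))]

theorem readAll_runs (l : List (Fin S.numSymbols)) (hl : l.Nodup) : ∃ κ, ∀ (w : List ℕ)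
    (rows : Rows S) (M : ℕ) (σ : State), (∀ R, (rows R).length ≤ M) →
    w.drop (σ.reg .pos) = rows.encode l →
    ∃ σ', Runs w (readAll l) (κ * (M + 1)) σ σ' ∧ RelsRead rows l σ σ' := by
  induction l with
  | nil =>
    exact ⟨0, fun w rows M σ _ _ => ⟨σ, ⟨0, by omega, .skip σ⟩,
      ⟨by simp, by simp, by simp, by simp⟩⟩⟩
  | cons R l ih =>
    obtain ⟨κ', hκ'⟩ := ih hl.of_cons
    obtain ⟨κ, hκ⟩ := readRel_runs R
    refine ⟨κ + κ', fun w rows M σ hM h => ?_⟩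
    obtain ⟨σ₁, hruns₁, hσ₁⟩ := hκ w rows (rows.encode l) σ (by simpa [Rows.encode] using h)
    obtain ⟨σ₂, hruns₂, hσ₂⟩ := hκ' w rows M σ₁ hM (by simpa using hσ₁.input)
    refine ⟨σ₂, ?_, hσ₁.relsRead (List.nodup_cons.mp hl).1 hσ₂⟩
    rw [Nat.add_mul]
    exact (hruns₁.mono (Nat.mul_le_mul_left _ (Nat.succ_le_succ (hM R)))).seq hruns₂

/-- The tuples listed in `rows` are in the heap: entry `k` of the `j`-th tuple of `R` is at
`[0, R, k, j]`, and register `cnt R` holds the number of tuples of `R`. -/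
structure Loaded (rows : Rows S) (σ : State) : Prop where
  zero : σ.reg .zero = 0
  cnt : ∀ R : Fin S.numSymbols, σ.reg (.cnt R) = (rows R).length
  heap : ∀ (R : Fin S.numSymbols) (k : Fin (S.arity R)) j, 1 ≤ j → j ≤ (rows R).length →
    σ.heap [0, R, k, j] = entry (rows R) j k

theorem RelsRead.loaded {σ' : State}
    (h : RelsRead rows (List.finRange S.numSymbols) State.blank σ') : Loaded rows σ' where
  zero := h.reg _ (by simp) (by simp) (by simp) (by simp)
  cnt R := h.cnt R (by simp)
  heap R := h.heap R (by simp)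

end Input

/-! ### Tuples that take part in solutions -/

section Alive

variable {S : Schema} {n : ℕ} {rows : Rows S} {done : List (Ear S n)} {e : Ear S n}
  {v v' : Fin n → ℕ}

/-- The assignment `v` satisfies the atom of the ear `e`, and it can be extended to those of the
ears in `done` (the ears before `e`, the last one first) that hang below `e`. -/
def Alive (rows : Rows S) : List (Ear S n) → Ear S n → (Fin n → ℕ) → Prop
  | [], e, v => v ∘ e.atom.2 ∈ rows e.atom.1
  | c :: done, e, v => Alive rows done e v ∧
      ((∀ x ∈ c.key, x ∈ Atom.vars e.atom) → ∃ u, Alive rows done c u ∧ ∀ x ∈ c.key, u x = v x)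

theorem Alive.congr (h : Alive rows done e v) (hv : Set.EqOn v v' (Atom.vars e.atom)) :
    Alive rows done e v' := by
  induction done with
  | nil => rwa [Alive, ← Set.eqOn_range.mp hv]
  | cons c done ih =>
    refine ⟨ih h.1, fun hc => ?_⟩
    obtain ⟨u, hu, huv⟩ := h.2 hc
    exact ⟨u, hu, fun x hx => (huv x hx).trans (hv (hc x hx))⟩

theorem Alive.comp_mem (h : Alive rows done e v) : v ∘ e.atom.2 ∈ rows e.atom.1 := by
  induction done with
  | nil => exact h
  | cons c done ih => exact ih h.1

theorem alive_of_comp_mem (he : v ∘ e.atom.2 ∈ rows e.atom.1)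
    (hdone : ∀ c ∈ done, v ∘ c.atom.2 ∈ rows c.atom.1) : Alive rows done e v := by
  induction done generalizing e with
  | nil => exact he
  | cons c done ih =>
    obtain ⟨hc, hdone⟩ := List.forall_mem_cons.mp hdone
    exact ⟨ih he hdone, fun _ => ⟨v, ih hc hdone, fun _ _ => rfl⟩⟩

/-- The `j`-th tuple of the relation of `e` is alive, and `κ` are its values for the key of `e`. -/
def Hit (rows : Rows S) (done : List (Ear S n)) (e : Ear S n) (κ : List ℕ) (j : ℕ) : Prop :=
  ∃ v, v ∘ e.atom.2 = entry (rows e.atom.1) j ∧ Alive rows done e v ∧ κ = e.key.map v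

theorem hit_iff_of_eqOn {κ : List ℕ} {j : ℕ} {u : Fin n → ℕ}
    (hkey : ∀ x ∈ e.key, x ∈ Atom.vars e.atom)
    (hu : ∀ v, v ∘ e.atom.2 = entry (rows e.atom.1) j → Set.EqOn u v (Atom.vars e.atom)) :
    Hit rows done e κ j ↔
      (u ∘ e.atom.2 = entry (rows e.atom.1) j ∧ Alive rows done e u) ∧ κ = e.key.map u := by
  refine ⟨?_, fun ⟨⟨hrow, hal⟩, hκ⟩ => ⟨u, hrow, hal, hκ⟩⟩
  rintro ⟨v, hrow, hal, rfl⟩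
  have huv := hu v hrow
  exact ⟨⟨(Set.eqOn_range.mp huv).trans hrow, hal.congr huv.symm⟩,
    List.map_congr_left fun x hx => (huv (hkey x hx)).symm⟩

theorem last_hit_ne_zero :
    last (Hit rows done e (e.key.map v)) (rows e.atom.1).length ≠ 0 ↔
      ∃ u, Alive rows done e u ∧ ∀ x ∈ e.key, u x = v x := by
  rw [last_ne_zero]
  constructor
  · rintro ⟨j, -, -, u, -, hal, hkey⟩
    exact ⟨u, hal, fun x hx => (List.map_inj_left.mp hkey x hx).symm⟩
  · rintro ⟨u, hal, huv⟩
    obtain ⟨j, hj, hjm, hrow⟩ := mem_iff_exists_entry.mp hal.comp_mem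
    exact ⟨j, hj, hjm, u, hrow, hal, (List.map_congr_left huv).symm⟩

end Alive

/-! ### The index of the tuples -/

section Index

variable {S : Schema} {n : ℕ} {rows : Rows S} {done : List (Ear S n)} {e : Ear S n}
  {σ σ' : State}

/-- The first `m` tuples of the relation of `e` are indexed: those that are alive form linked lists,
one for each list `κ` of values for the key of `e`, which starts in the cell `1 :: e.id :: κ`. -/
def IndexOf (rows : Rows S) (done : List (Ear S n)) (e : Ear S n) (m : ℕ) (σ : State) : Prop :=
  Chained (Hit rows done e) (fun κ => σ.heap (1 :: e.id :: κ)) (fun j => σ.heap [2, e.id, j]) m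

/-- The index is complete for the ears in the list, the last one first. -/
def Indexed (rows : Rows S) : List (Ear S n) → State → Prop
  | [], _ => True
  | e :: done, σ => IndexOf rows done e (rows e.atom.1).length σ ∧ Indexed rows done σ

theorem Indexed.alive_iff (h : Indexed rows done σ) (e : Ear S n) (v : Fin n → ℕ) :
    Alive rows done e v ↔ v ∘ e.atom.2 ∈ rows e.atom.1 ∧
      ∀ c ∈ done, (∀ x ∈ c.key, x ∈ Atom.vars e.atom) → σ.heap (1 :: c.id :: c.key.map v) ≠ 0 := by
  induction done with
  | nil => simp [Alive]
  | cons c done ih =>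
    rw [Alive, ih h.2, List.forall_mem_cons, h.1.head_eq, last_hit_ne_zero]
    tauto

/-- A heap cell of the index for the ear with number `i`. -/
def IndexCell (i : ℕ) (a : List ℕ) : Prop := (∃ κ, a = 1 :: i :: κ) ∨ ∃ j, a = [2, i, j]

theorem not_indexCell_zero_cons (i : ℕ) (a : List ℕ) : ¬ IndexCell i (0 :: a) := by
  simp [IndexCell]

theorem IndexCell.unique {i j : ℕ} {a : List ℕ} (hi : IndexCell i a) (hj : IndexCell j a) :
    i = j := by
  rcases hi with ⟨κ, rfl⟩ | ⟨k, rfl⟩ <;> rcases hj with ⟨κ', h⟩ | ⟨k', h⟩ <;> simp_all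

theorem IndexOf.congr {m : ℕ} (h : IndexOf rows done e m σ)
    (hσ : ∀ a, IndexCell e.id a → σ'.heap a = σ.heap a) : IndexOf rows done e m σ' where
  head_eq κ := (hσ _ (.inl ⟨κ, rfl⟩)).trans (h.head_eq κ)
  next_eq κ j hj hjm hP := (hσ _ (.inr ⟨j, rfl⟩)).trans (h.next_eq κ j hj hjm hP)

theorem Indexed.congr (h : Indexed rows done σ)
    (hσ : ∀ c ∈ done, ∀ a, IndexCell c.id a → σ'.heap a = σ.heap a) : Indexed rows done σ' := by
  induction done with
  | nil => trivial
  | cons c done ih =>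
    exact ⟨h.1.congr (hσ c (by simp)), ih h.2 fun c' hc' => hσ c' (List.mem_cons_of_mem _ hc')⟩

theorem Indexed.of_reverseAux {es : List (Ear S n)} (h : Indexed rows (es.reverseAux done) σ) :
    Indexed rows done σ := by
  induction es generalizing done with
  | nil => exact h
  | cons e es ih => exact (ih h).2

/-- The registers that keep their values while the index is built and in the nested loops. -/
def Reg.Lasting : Reg → Prop
  | .zero | .ctr | .cnt _ => True
  | _ => False

theorem State.set_reg_of_lasting (σ : State) {r r' : Reg} (v : ℕ) (hr : r.Lasting)
    (hr' : ¬ r'.Lasting) : (σ.set r' v).reg r = σ.reg r :=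
  State.set_reg_of_ne _ _ fun h => hr' (h ▸ hr)

theorem Loaded.congr (h : Loaded rows σ) (hreg : ∀ r : Reg, r.Lasting → σ'.reg r = σ.reg r)
    (hheap : ∀ a, σ'.heap (0 :: a) = σ.heap (0 :: a)) : Loaded rows σ' where
  zero := (hreg .zero trivial).trans h.zero
  cnt R := (hreg (.cnt R) trivial).trans (h.cnt R)
  heap R k j hj hjm := (hheap _).trans (h.heap R k j hj hjm)

end Index

/-! ### Commands that load and test tuples -/

section RowCommands

variable {S : Schema} {n : ℕ} {w : List ℕ} {σ : State}

/-- The assignment held in the registers `asg`. -/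
def State.asg (σ : State) (x : Fin n) : ℕ := σ.reg (.asg x)

theorem State.asg_set (σ : State) {r : Reg} (v : ℕ) (hr : ∀ x, r ≠ .asg x) :
    ((σ.set r v).asg : Fin n → ℕ) = σ.asg :=
  funext fun x => State.set_reg_of_ne _ _ (hr x).symm

/-- The operands that denote the values of the variables in `l`. -/
def keyOperands (l : List (Fin n)) : List Operand := l.map fun (x : Fin n) => .reg (.asg x)

@[simp] theorem map_val_keyOperands (σ : State) (l : List (Fin n)) :
    (keyOperands l).map (Operand.val σ) = l.map σ.asg := by
  simp [keyOperands, Function.comp_def, State.asg]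

/-- Load the entries in the positions `l` of the tuple with the number in register `p` into the
variables of the atom. -/
def loadRow (p : Reg) (a : Atom S n) (l : List (Fin (S.arity a.1))) : List Op :=
  l.map fun (k : Fin _) => .get (.asg (a.2 k)) [.lit 0, .lit a.1, .lit k, .reg p]

theorem loadRow_heap (p : Reg) (a : Atom S n) (l : List (Fin (S.arity a.1))) (σ : State) :
    ((Cmd.block (loadRow p a l)).eval w σ).heap = σ.heap := by
  induction l generalizing σ with
  | nil => rfl
  | cons _ _ ih => exact ih _

theorem loadRow_reg (p : Reg) (a : Atom S n) {l : List (Fin (S.arity a.1))} {r : Reg} (σ : State)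
    (hr : ∀ k ∈ l, r ≠ .asg (a.2 k)) :
    ((Cmd.block (loadRow p a l)).eval w σ).reg r = σ.reg r := by
  induction l generalizing σ with
  | nil => rfl
  | cons k l ih =>
    obtain ⟨hk, hl⟩ := List.forall_mem_cons.mp hr
    exact (ih _ hl).trans (State.set_reg_of_ne _ _ hk)

theorem loadRow_asg {p : Reg} (hp : ∀ x, p ≠ .asg x) (a : Atom S n)
    {l : List (Fin (S.arity a.1))} {v : Fin n → ℕ} (σ : State)
    (hv : ∀ k ∈ l, v (a.2 k) = σ.heap [0, a.1, k, σ.reg p]) :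
    ∀ k ∈ l, ((Cmd.block (loadRow p a l)).eval w σ).asg (a.2 k) = v (a.2 k) := by
  induction l generalizing σ with
  | nil => simp
  | cons k l ih =>
    obtain ⟨hk, hl⟩ := List.forall_mem_cons.mp hv
    let σ₁ := σ.set (.asg (a.2 k)) (σ.heap [0, a.1, k, σ.reg p])
    have ih := ih σ₁ (by simpa only [σ₁, State.set_heap, State.set_reg_of_ne _ _ (hp _)] using hl)
    refine List.forall_mem_cons.mpr ⟨?_, ih⟩
    by_cases hrepeat : ∃ k' ∈ l, a.2 k' = a.2 k
    · obtain ⟨k', hk', heq⟩ := hrepeat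
      exact heq ▸ ih k' hk'
    · have hkeep : ((Cmd.block (loadRow p a l)).eval w σ₁).asg (a.2 k) = σ₁.asg (a.2 k) :=
        loadRow_reg p a σ₁ fun k' hk' h =>
          hrepeat ⟨k', hk', by simpa [Fin.val_inj] using h.symm⟩
      exact hkeep.trans ((State.set_reg_self ..).trans hk.symm)

theorem Loaded.eqOn_loadRow {rows : Rows S} {a : Atom S n} {p : Reg} (h : Loaded rows σ)
    (hp : ∀ x, p ≠ .asg x) (hpos : 1 ≤ σ.reg p) (hle : σ.reg p ≤ (rows a.1).length)
    {v : Fin n → ℕ} (hv : v ∘ a.2 = entry (rows a.1) (σ.reg p)) :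
    Set.EqOn ((Cmd.block (loadRow p a (List.finRange _))).eval w σ).asg v (Atom.vars a) := by
  rintro _ ⟨k, rfl⟩
  refine loadRow_asg hp a σ (fun k _ => ?_) k (List.mem_finRange k)
  rw [h.heap _ k _ hpos hle, ← hv, Function.comp_apply]

/-- Started in `σ`, the command `G` runs `C` if the condition `p` holds, and it does nothing
otherwise, except that it may change the register `aux` in both cases. -/
def Guards (w : List ℕ) (p : Prop) (G C : Cmd) (σ : State) : Prop :=
  ∃ v, p ∧ G.eval w σ = C.eval w (σ.set .aux v) ∨ ¬ p ∧ G.eval w σ = σ.set .aux v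

namespace Guards

variable {p q : Prop} {G G' C : Cmd}

theorem refl (C : Cmd) (σ : State) : Guards w True C C σ :=
  ⟨σ.reg .aux, .inl ⟨trivial, by rw [State.set_eq_self]⟩⟩

theorem trans (h : Guards w p G G' σ) (h' : ∀ v, Guards w q G' C (σ.set .aux v)) :
    Guards w (p ∧ q) G C σ := by
  obtain ⟨v, ⟨hp, hG⟩ | ⟨hp, hG⟩⟩ := h
  · obtain ⟨v', h'⟩ := h' v
    refine ⟨v', ?_⟩
    simpa only [hp, true_and, hG, State.set_set] using h'
  · exact ⟨v, .inr ⟨fun h => hp h.1, hG⟩⟩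

theorem of_eval_eq_ite [Decidable p] {v : ℕ}
    (h : G.eval w σ = if p then C.eval w (σ.set .aux v) else σ.set .aux v) :
    Guards w p G C σ := by
  by_cases hp : p
  · exact ⟨v, .inl ⟨hp, by rw [h, if_pos hp]⟩⟩
  · exact ⟨v, .inr ⟨hp, by rw [h, if_neg hp]⟩⟩

end Guards

/-- Run `C` if the tuple with the number in register `p` agrees with the current assignment in the
positions `l`. -/
def ifMatch (p : Reg) (a : Atom S n) (l : List (Fin (S.arity a.1))) (C : Cmd) : Cmd :=
  l.foldr (fun (k : Fin _) C => .seq (.op (.get .aux [.lit 0, .lit a.1, .lit k, .reg p]))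
    (.ifeq (.asg (a.2 k)) .aux C .skip)) C

theorem plain_ifMatch (p : Reg) (a : Atom S n) (l : List (Fin (S.arity a.1))) {C : Cmd}
    (hC : C.Plain) : (ifMatch p a l C).Plain := by
  induction l with
  | nil => exact hC
  | cons k l ih => exact ⟨trivial, ih, trivial⟩

theorem guards_ifMatch {p : Reg} (hp : p ≠ .aux) (a : Atom S n) (l : List (Fin (S.arity a.1)))
    (C : Cmd) (σ : State) :
    Guards w (∀ k ∈ l, σ.asg (a.2 k) = σ.heap [0, a.1, k, σ.reg p]) (ifMatch p a l C) C σ := by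
  induction l generalizing σ with
  | nil =>
    simp only [List.not_mem_nil, false_imp_iff, implies_true]
    exact .refl C σ
  | cons k l ih =>
    rw [List.forall_mem_cons]
    refine Guards.trans (G' := ifMatch p a l C) ?_ fun v => ?_
    · refine .of_eval_eq_ite (v := σ.heap [0, a.1, k, σ.reg p]) ?_
      simp only [ifMatch, List.foldr_cons, Cmd.eval, Op.eval, address, List.map_cons, List.map_nil,
        Operand.val, State.set_reg]
      rfl
    · have hasg : ((σ.set .aux v).asg : Fin n → ℕ) = σ.asg := σ.asg_set v (by simp)
      simpa only [State.set_heap, State.set_reg_of_ne _ _ hp, hasg] using ih (σ.set .aux v)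

open Classical in
/-- Run `C` if the current assignment can be extended to the ears in `l` that hang below `e`. -/
noncomputable def ifAlive (e : Ear S n) (l : List (Ear S n)) (C : Cmd) : Cmd :=
  l.foldr (fun c C => if ∀ x ∈ c.key, x ∈ Atom.vars e.atom then
    .seq (.op (.get .aux (.lit 1 :: .lit c.id :: keyOperands c.key))) (.ifeq .aux .zero .skip C)
    else C) C

theorem plain_ifAlive (e : Ear S n) (l : List (Ear S n)) {C : Cmd} (hC : C.Plain) :
    (ifAlive e l C).Plain := by
  induction l with
  | nil => exact hC
  | cons c l ih =>
    rw [ifAlive, List.foldr_cons]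
    split_ifs
    · exact ⟨trivial, trivial, ih⟩
    · exact ih

theorem guards_ifAlive (e : Ear S n) (l : List (Ear S n)) (C : Cmd) (σ : State)
    (hσ : σ.reg .zero = 0) :
    Guards w (∀ c ∈ l, (∀ x ∈ c.key, x ∈ Atom.vars e.atom) →
      σ.heap (1 :: c.id :: c.key.map σ.asg) ≠ 0) (ifAlive e l C) C σ := by
  induction l generalizing σ with
  | nil =>
    simp only [List.not_mem_nil, false_imp_iff, implies_true]
    exact .refl C σ
  | cons c l ih =>
    rw [List.forall_mem_cons]
    refine Guards.trans (G' := ifAlive e l C) ?_ fun v => ?_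
    · by_cases hc : ∀ x ∈ c.key, x ∈ Atom.vars e.atom
      · rw [forall_prop_of_true hc]
        refine .of_eval_eq_ite (v := σ.heap (1 :: c.id :: c.key.map σ.asg)) ?_
        simp [ifAlive, if_pos hc, Cmd.eval, Op.eval, State.set_reg, hσ]
      · rw [eq_true (fun h => (hc h).elim), ifAlive, List.foldr_cons, if_neg hc]
        exact .refl _ σ
    · have hasg : ((σ.set .aux v).asg : Fin n → ℕ) = σ.asg := σ.asg_set v (by simp)
      simpa only [State.set_heap, hasg] using
        ih (σ.set .aux v) ((State.set_reg_of_ne _ _ (by simp)).trans hσ)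

theorem guards_ifMatch_ifAlive {rows : Rows S} {done : List (Ear S n)} {e : Ear S n} {p : Reg}
    (hp : p ≠ .aux) (C : Cmd) (h : Loaded rows σ) (hdone : Indexed rows done σ)
    (hpos : 1 ≤ σ.reg p) (hle : σ.reg p ≤ (rows e.atom.1).length) :
    Guards w (σ.asg ∘ e.atom.2 = entry (rows e.atom.1) (σ.reg p) ∧ Alive rows done e σ.asg)
      (ifMatch p e.atom (List.finRange _) (ifAlive e done C)) C σ := by
  have hmatch : (∀ k ∈ List.finRange _, σ.asg (e.atom.2 k) = σ.heap [0, e.atom.1, k, σ.reg p]) ↔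
      σ.asg ∘ e.atom.2 = entry (rows e.atom.1) (σ.reg p) := by
    simp [funext_iff, h.heap _ _ _ hpos hle]
  have halive : σ.asg ∘ e.atom.2 = entry (rows e.atom.1) (σ.reg p) → (Alive rows done e σ.asg ↔
      ∀ c ∈ done, (∀ x ∈ c.key, x ∈ Atom.vars e.atom) →
        σ.heap (1 :: c.id :: c.key.map σ.asg) ≠ 0) := fun hrow => by
    rw [hdone.alive_iff e, and_iff_right (mem_iff_exists_entry.mpr ⟨_, hpos, hle, hrow⟩)]
  rw [and_congr_right halive, ← hmatch]
  refine (guards_ifMatch hp e.atom _ _ σ).trans fun v => ?_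
  have hasg : ((σ.set .aux v).asg : Fin n → ℕ) = σ.asg := σ.asg_set v (by simp)
  simpa only [State.set_heap, hasg] using
    guards_ifAlive e done C (σ.set .aux v) ((State.set_reg_of_ne _ _ (by simp)).trans h.zero)

end RowCommands

/-! ### Building the index -/

section Build

variable {S : Schema} {n : ℕ} {w : List ℕ} {rows : Rows S} {done : List (Ear S n)} {e : Ear S n}
  {σ τ τ' : State} {m : ℕ}

/-- Put the tuple with the number in register `row` in front of its linked list. -/
def insertRow (e : Ear S n) : Cmd :=
  .block [.get .aux (.lit 1 :: .lit e.id :: keyOperands e.key),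
    .put [.lit 2, .lit e.id, .reg .row] .aux,
    .put (.lit 1 :: .lit e.id :: keyOperands e.key) .row]

/-- Index the next tuple for the ear `e`. -/
noncomputable def buildBody (done : List (Ear S n)) (e : Ear S n) : Cmd :=
  .seq (.block (.inc .row .row :: loadRow .row e.atom (List.finRange _)))
    (ifMatch .row e.atom (List.finRange _) (ifAlive e done (insertRow e)))

/-- Build the index for the ear `e`, given the index for the ears in `done`. -/
noncomputable def buildOne (done : List (Ear S n)) (e : Ear S n) : Cmd :=
  .seq (.op (.const .row 0)) (.whileNe .row (.cnt e.atom.1) (buildBody done e))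

/-- Build the index for the ears in a list, given the index for the ears in `done`. -/
noncomputable def buildAll : List (Ear S n) → List (Ear S n) → Cmd
  | _, [] => .skip
  | done, e :: es => .seq (buildOne done e) (buildAll (e :: done) es)

theorem plain_buildBody (done : List (Ear S n)) (e : Ear S n) : (buildBody done e).Plain :=
  ⟨Cmd.plain_block _, plain_ifMatch _ _ _ (plain_ifAlive _ _ (Cmd.plain_block _))⟩

theorem insertRow_eval (e : Ear S n) (τ : State) :
    (insertRow e).eval w τ = ((τ.set .aux (τ.heap (1 :: e.id :: e.key.map τ.asg))).write
      [2, e.id, τ.reg .row] (τ.heap (1 :: e.id :: e.key.map τ.asg))).write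
      (1 :: e.id :: e.key.map τ.asg) (τ.reg .row) := by
  have hasg : ∀ v l v', (((τ.set .aux v).write l v').asg : Fin n → ℕ) = τ.asg :=
    fun v _ _ => τ.asg_set (r := .aux) v (by simp)
  simp [insertRow, Op.eval, State.set_reg, hasg]

/-- The state `τ` occurs while the index for `e` is built from the state `σ`, and the first `m`
tuples are indexed in it. -/
structure Building (rows : Rows S) (done : List (Ear S n)) (e : Ear S n) (σ : State) (m : ℕ)
    (τ : State) : Prop where
  index : IndexOf rows done e m τ
  reg : ∀ r : Reg, r.Lasting → τ.reg r = σ.reg r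
  heap : ∀ a, ¬ IndexCell e.id a → τ.heap a = σ.heap a

namespace Building

theorem congr (h : Building rows done e σ m τ)
    (hreg : ∀ r : Reg, r.Lasting → τ'.reg r = τ.reg r) (hheap : τ'.heap = τ.heap) :
    Building rows done e σ m τ' where
  index := h.index.congr fun a _ => congrFun hheap a
  reg r hr := (hreg r hr).trans (h.reg r hr)
  heap a ha := (congrFun hheap a).trans (h.heap a ha)

theorem loaded (h : Building rows done e σ m τ) (hσ : Loaded rows σ) : Loaded rows τ :=
  hσ.congr h.reg fun a => h.heap _ (not_indexCell_zero_cons _ a)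

theorem indexed (h : Building rows done e σ m τ) (hid : ∀ c ∈ done, c.id ≠ e.id)
    (hσ : Indexed rows done σ) : Indexed rows done τ :=
  hσ.congr fun c hc a ha => h.heap a fun ha' => hid c hc (ha.unique ha')

theorem skip (h : Building rows done e σ m τ) (hno : ∀ κ, ¬ Hit rows done e κ (m + 1)) :
    Building rows done e σ (m + 1) τ where
  index := Chained.skip h.index hno
  reg := h.reg
  heap := h.heap

theorem insert (h : Building rows done e σ m τ) (hrow : τ.reg .row = m + 1)
    (hhit : ∀ κ, Hit rows done e κ (m + 1) ↔ κ = e.key.map τ.asg) :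
    Building rows done e σ (m + 1) ((insertRow e).eval w τ) := by
  rw [insertRow_eval, hrow]
  refine ⟨Chained.insert h.index hhit ?_ (fun κ hκ => ?_) ?_ fun j hj => ?_, fun r hr => ?_,
    fun a ha => ?_⟩
  · simp [State.write_heap]
  · simp [State.write_heap, hκ]
  · simp [State.write_heap]
  · simp [State.write_heap, show j ≠ m + 1 by omega]
  · exact (State.set_reg_of_lasting τ (r' := .aux) _ hr not_false).trans (h.reg r hr)
  · have hhead : a ≠ 1 :: e.id :: e.key.map τ.asg := fun h => ha (.inl ⟨_, h⟩)
    have hnext : a ≠ [2, e.id, m + 1] := fun h => ha (.inr ⟨_, h⟩)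
    rw [State.write_heap, if_neg hhead, State.write_heap, if_neg hnext]
    exact h.heap a ha

end Building

theorem Building.eval_tests (h : Building rows done e σ m τ) (hσ : Loaded rows σ)
    (hdone : Indexed rows done σ) (hid : ∀ c ∈ done, c.id ≠ e.id)
    (hm : m < (rows e.atom.1).length) (hrow : τ.reg .row = m + 1)
    (hhit : ∀ κ, Hit rows done e κ (m + 1) ↔
      (τ.asg ∘ e.atom.2 = entry (rows e.atom.1) (m + 1) ∧ Alive rows done e τ.asg) ∧
        κ = e.key.map τ.asg) {τ' : State}
    (hτ' : (ifMatch .row e.atom (List.finRange _) (ifAlive e done (insertRow e))).eval w τ = τ') :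
    τ'.reg .row = m + 1 ∧ Building rows done e σ (m + 1) τ' := by
  have hguard := guards_ifMatch_ifAlive (w := w) (e := e) (p := .row) (by simp) (insertRow e)
    (h.loaded hσ) (h.indexed hid hdone) (by omega) (by omega)
  have haux (v : ℕ) : (τ.set .aux v).reg .row = m + 1 :=
    (State.set_reg_of_ne _ _ (by simp)).trans hrow
  have hasg (v : ℕ) : ((τ.set .aux v).asg : Fin n → ℕ) = τ.asg := τ.asg_set v (by simp)
  have h' (v : ℕ) : Building rows done e σ m (τ.set .aux v) :=
    h.congr (fun r hr => State.set_reg_of_lasting _ _ hr not_false) rfl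
  rw [hrow] at hguard
  obtain ⟨v, ⟨halive, hev⟩ | ⟨hdead, hev⟩⟩ := hguard <;> rw [hev] at hτ' <;> subst hτ'
  · refine ⟨?_, (h' v).insert (haux v) fun κ => ?_⟩
    · rw [insertRow_eval, State.write_reg, State.write_reg,
        State.set_reg_of_ne _ _ (by simp), haux]
    · rw [hasg, hhit, and_iff_right halive]
  · exact ⟨haux v, (h' v).skip fun κ hκ => hdead ((hhit κ).mp hκ).1⟩

theorem Building.eval_buildBody (h : Building rows done e σ m τ) (hσ : Loaded rows σ)
    (hdone : Indexed rows done σ) (hid : ∀ c ∈ done, c.id ≠ e.id)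
    (hkey : ∀ x ∈ e.key, x ∈ Atom.vars e.atom) (hm : m < (rows e.atom.1).length)
    (hrow : τ.reg .row = m) :
    ((buildBody done e).eval w τ).reg .row = m + 1 ∧
      Building rows done e σ (m + 1) ((buildBody done e).eval w τ) := by
  let τ₀ := τ.set .row (m + 1)
  let τ₁ := (Cmd.block (loadRow .row e.atom (List.finRange _))).eval w τ₀
  have h₀ : Building rows done e σ m τ₀ :=
    h.congr (fun r hr => State.set_reg_of_lasting _ _ hr not_false) rfl
  have h₁ : Building rows done e σ m τ₁ :=
    h₀.congr (fun r hr => loadRow_reg _ _ _ (by rintro _ - rfl; exact hr)) (loadRow_heap ..)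
  have hrow₀ : τ₀.reg .row = m + 1 := State.set_reg_self ..
  refine h₁.eval_tests hσ hdone hid hm ((loadRow_reg _ _ _ (by simp)).trans hrow₀)
    (fun κ => hit_iff_of_eqOn hkey fun v hv => ?_) (w := w) ?_
  · exact (h₀.loaded hσ).eqOn_loadRow (by simp) (by omega) (by omega) (hrow₀.symm ▸ hv)
  · simp only [τ₁, τ₀, ← hrow]
    rfl

theorem buildOne_runs (hkey : ∀ x ∈ e.key, x ∈ Atom.vars e.atom) (hid : ∀ c ∈ done, c.id ≠ e.id)
    (hσ : Loaded rows σ) (hdone : Indexed rows done σ)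
    (hzero : ∀ l, σ.heap (1 :: e.id :: l) = 0) :
    ∃ σ', Runs w (buildOne done e)
        (((buildBody done e).cost + 3) * ((rows e.atom.1).length + 1)) σ σ' ∧
      Building rows done e σ (rows e.atom.1).length σ' := by
  have hconst : Runs w (.op (.const .row 0)) 1 σ (σ.set .row 0) := ⟨1, le_rfl, .op _ _⟩
  have hstart : Building rows done e σ 0 (σ.set .row 0) :=
    ⟨Chained.zero hzero, fun r hr => State.set_reg_of_lasting _ _ hr not_false, fun _ _ => rfl⟩
  obtain ⟨σ', hruns, -, h⟩ := Runs.whileNe_of_invariant (w := w) (a := .row) (b := .cnt e.atom.1)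
    (J := fun m τ => τ.reg .row = m ∧ Building rows done e σ m τ)
    (fun m τ hJ => ⟨hJ.1, (hJ.2.reg (.cnt _) trivial).trans (hσ.cnt _)⟩)
    (fun m τ hm hJ => ⟨_, (plain_buildBody done e).runs τ,
      hJ.2.eval_buildBody hσ hdone hid hkey hm hJ.1⟩)
    ⟨State.set_reg_self .., hstart⟩
  exact ⟨σ', (hconst.seq hruns).mono (by ring_nf; omega), h⟩

theorem buildAll_runs (done es : List (Ear S n)) (hes : EarList es)
    (hid : ∀ c ∈ done, ∀ e ∈ es, c.id ≠ e.id) :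
    ∃ κ, ∀ (w : List ℕ) (rows : Rows S) (M : ℕ) (σ : State), (∀ R, (rows R).length ≤ M) →
      Loaded rows σ → Indexed rows done σ → (∀ e ∈ es, ∀ l, σ.heap (1 :: e.id :: l) = 0) →
      ∃ σ', Runs w (buildAll done es) (κ * (M + 1)) σ σ' ∧
        Indexed rows (es.reverseAux done) σ' ∧ (∀ r : Reg, r.Lasting → σ'.reg r = σ.reg r) ∧
        ∀ a, (∀ e ∈ es, ¬ IndexCell e.id a) → σ'.heap a = σ.heap a := by
  induction es generalizing done with
  | nil => exact ⟨0, fun w rows M σ _ _ hI _ => ⟨σ, ⟨0, by omega, .skip σ⟩, hI, by simp, by simp⟩⟩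
  | cons e es ih =>
    have hne : ∀ b ∈ es, b.id ≠ e.id := fun b hb =>
      (hes.1.id_eq ▸ hes.2.id_lt b hb).ne
    obtain ⟨hide, hides⟩ := forall₂_and.mp fun c hc => List.forall_mem_cons.mp (hid c hc)
    obtain ⟨κ, ih⟩ := ih (e :: done) hes.2
      (List.forall_mem_cons.mpr ⟨fun b hb => (hne b hb).symm, hides⟩)
    refine ⟨(buildBody done e).cost + 3 + κ, fun w rows M σ hM hσ hdone hzero => ?_⟩
    obtain ⟨hzeroe, hzeros⟩ := List.forall_mem_cons.mp hzero
    obtain ⟨σ₁, hruns₁, h₁⟩ := buildOne_runs (w := w) (fun x hx => ((hes.1.mem_key x).mp hx).1)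
      hide hσ hdone hzeroe
    obtain ⟨σ₂, hruns₂, hindex, hreg, hheap⟩ := ih w rows M σ₁ hM (h₁.loaded hσ)
      ⟨h₁.index, h₁.indexed hide hdone⟩ fun b hb l => by
        rw [h₁.heap _ fun h => hne b hb (IndexCell.unique (.inl ⟨l, rfl⟩) h), hzeros b hb l]
    refine ⟨σ₂, ?_, hindex, fun r hr => (hreg r hr).trans (h₁.reg r hr), fun a ha => ?_⟩
    · rw [Nat.add_mul]
      exact (hruns₁.mono (by gcongr; exact hM _)).seq hruns₂
    · obtain ⟨hae, haes⟩ := List.forall_mem_cons.mp ha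
      exact (hheap a haes).trans (h₁.heap a hae)

end Build

/-! ### Nested loops over an acyclic query -/

section Chain

variable {w : List ℕ} {C : Cmd} {p : Reg} {d N : ℕ} {P : ℕ → Prop}
  {J : ℕ → State → List (List ℕ) → Prop}

theorem exec_whileNe_of_last (hJ : ∀ m σ E, J m σ E → σ.reg p = last P m ∧ σ.reg .zero = 0)
    (hstep : ∀ m σ E, m < N → P (m + 1) → J (m + 1) σ E →
      ∃ t σ', Exec w C σ t σ' ∧ Gap d t ∧ outputs t ≠ [] ∧ J m σ' (E ++ outputs t))
    (hskip : ∀ m σ E, m < N → ¬ P (m + 1) → J (m + 1) σ E → J m σ E)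
    {m : ℕ} {σ : State} {E : List (List ℕ)} (hm : m ≤ N) (h : J m σ E) :
    ∃ t σ', Exec w (.whileNe p .zero C) σ t σ' ∧ Gap (2 * d + 2) t ∧ lead t ≤ d + 1 ∧
      (last P m ≠ 0 → outputs t ≠ []) ∧ J 0 σ' (E ++ outputs t) := by
  induction m generalizing σ E with
  | zero =>
    obtain ⟨hp, hzero⟩ := hJ _ _ _ h
    exact ⟨[none], σ, .whileDone (by rw [hp, hzero]; rfl), Gap.silent (k := 1) (by omega),
      by simp [lead], fun h => (h rfl).elim, by simpa using h⟩
  | succ m ih =>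
    by_cases hP : P (m + 1)
    · obtain ⟨hp, hzero⟩ := hJ _ _ _ h
      rw [last_succ_of_pos hP] at hp
      obtain ⟨t, σ₁, hexec, hgap, hout, h₁⟩ := hstep m σ E (by omega) hP h
      obtain ⟨t', σ₂, hexec', hgap', hlead', -, h₂⟩ := ih (by omega) h₁
      have hlead : lead (none :: (t ++ none :: t')) ≤ d + 1 := by
        rw [lead, lead_append_of_outputs_ne_nil hout]
        exact Nat.succ_le_succ hgap.lead_le
      have hgap'' : Gap (2 * d + 2) (none :: t') := ⟨by rw [lead]; omega, hgap'⟩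
      exact ⟨none :: (t ++ none :: t'), σ₂, .whileStep (by omega) hexec hexec',
        ⟨by omega, hgap.append hgap'' (by rw [lead]; omega)⟩, hlead, fun _ => by simp [hout],
        by simpa using h₂⟩
    · rw [last_succ_of_neg hP]
      exact ih (by omega) (hskip _ _ _ (by omega) hP h)

end Chain

section Loops

variable {S : Schema} {n : ℕ}

/-- The variables of the atoms of the ears in a list. -/
def earVars (es : List (Ear S n)) : Set (Fin n) := {x | ∃ e ∈ es, x ∈ Atom.vars e.atom}

@[simp] theorem earVars_nil : earVars ([] : List (Ear S n)) = ∅ := by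
  simp [earVars]

@[simp] theorem earVars_cons (e : Ear S n) (es : List (Ear S n)) :
    earVars (e :: es) = Atom.vars e.atom ∪ earVars es := by
  ext x
  simp [earVars]

/-- Load the current tuple for `e`, run `body`, and go to the next tuple. -/
def loopBody (e : Ear S n) (body : Cmd) : Cmd :=
  .seq (.block (loadRow (.ptr e.id) e.atom (List.finRange _)))
    (.seq body (.op (.get (.ptr e.id) [.lit 2, .lit e.id, .reg (.ptr e.id)])))

/-- Run `body` for all tuples of the relation of `e` that are alive and have the current values for
the key of `e`. -/
def loopEar (e : Ear S n) (body : Cmd) : Cmd :=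
  .seq (.op (.get (.ptr e.id) (.lit 1 :: .lit e.id :: keyOperands e.key)))
    (.whileNe (.ptr e.id) .zero (loopBody e body))

/-- Nested loops for the ears in a list, the first one being the innermost. -/
def loops : List (Ear S n) → Cmd → Cmd
  | [], body => body
  | e :: es, body => loops es (loopEar e body)

/-- The delay of a loop body with the delay `d` for `body`. -/
def Ear.bodyDelay (e : Ear S n) (d : ℕ) : ℕ :=
  (Cmd.block (loadRow (.ptr e.id) e.atom (List.finRange _))).cost +
    (d + (Op.get (.ptr e.id) [.lit 2, .lit e.id, .reg (.ptr e.id)]).cost)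

/-- The delay of a loop with the delay `d` for `body`. -/
def Ear.delay (e : Ear S n) (d : ℕ) : ℕ :=
  (Op.get (.ptr e.id) (.lit 1 :: .lit e.id :: keyOperands e.key)).cost + (2 * e.bodyDelay d + 2)

/-- The delay of nested loops with the delay `d` for the innermost body. -/
def loopsDelay : List (Ear S n) → ℕ → ℕ
  | [], d => d
  | e :: es, d => loopsDelay es (e.delay d)

variable {w : List ℕ} {rows : Rows S} {Sol : Set (Fin n → ℕ)}
  {Inv : List (Fin n → ℕ) → List (List ℕ) → State → Prop} {done es : List (Ear S n)} {e : Ear S n}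
  {d : ℕ} {body : Cmd} {h H H' : List (Fin n → ℕ)} {E : List (List ℕ)} {σ σ' τ τ' : State}
  {t : Trace}

/-- An execution of `body` from `σ` to `σ'` that visits the members `H` of `Sol` with the current
values for the variables of `es`. The invariant `Inv h E` refers to the list `h` of the members
visited so far and the list `E` of the tuples output so far. -/
structure Visit (w : List ℕ) (Sol : Set (Fin n → ℕ))
    (Inv : List (Fin n → ℕ) → List (List ℕ) → State → Prop) (es : List (Ear S n)) (d : ℕ)
    (body : Cmd) (h : List (Fin n → ℕ)) (E : List (List ℕ)) (σ : State) (t : Trace) (σ' : State)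
    (H : List (Fin n → ℕ)) : Prop where
  exec : Exec w body σ t σ'
  gap : Gap d t
  outputs_ne_nil : es ≠ [] → outputs t ≠ []
  inv : Inv (h ++ H) (E ++ outputs t) σ'
  mem_iff : ∀ s, s ∈ H ↔ s ∈ Sol ∧ Set.EqOn s σ.asg (earVars es)
  ptr : ∀ e ∈ es, σ'.reg (.ptr e.id) = σ.reg (.ptr e.id)
  asg : Set.EqOn (σ'.asg : Fin n → ℕ) σ.asg (earVars es)

/-- The command `body` visits the members of `Sol` with the current values for the variables of
`es`, whenever they have not been visited yet and the values can be extended to the ears below. -/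
def Visits (w : List ℕ) (rows : Rows S) (Sol : Set (Fin n → ℕ))
    (Inv : List (Fin n → ℕ) → List (List ℕ) → State → Prop) (done es : List (Ear S n)) (d : ℕ)
    (body : Cmd) : Prop :=
  ∀ h E σ, Inv h E σ → (∀ e ∈ es, Alive rows done e σ.asg) →
    (∀ s ∈ h, ¬ Set.EqOn s σ.asg (earVars es)) →
      ∃ t σ' H, Visit w Sol Inv es d body h E σ t σ' H

/-- An invariant that does not depend on the registers used by the loops, and guarantees that the
index for `es` is available. -/
structure LoopInvariant (rows : Rows S) (es : List (Ear S n))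
    (Inv : List (Fin n → ℕ) → List (List ℕ) → State → Prop) : Prop where
  congr : ∀ {h E σ σ'}, Inv h E σ → (∀ r : Reg, r.Lasting → σ'.reg r = σ.reg r) →
    σ'.heap = σ.heap → Inv h E σ'
  loaded : ∀ {h E σ}, Inv h E σ → Loaded rows σ
  indexed : ∀ {h E σ}, Inv h E σ → Indexed rows es σ

theorem LoopInvariant.of_reverseAux (hInv : LoopInvariant rows (es.reverseAux done) Inv) :
    LoopInvariant rows done Inv where
  congr := hInv.congr
  loaded := hInv.loaded
  indexed h := (hInv.indexed h).of_reverseAux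

theorem LoopInvariant.set (hInv : LoopInvariant rows es Inv) (hσ : Inv h E σ) (i v : ℕ) :
    Inv h E (σ.set (.ptr i) v) :=
  hInv.congr hσ (fun _ hr => State.set_reg_of_lasting _ _ hr not_false) rfl

/-- The state `τ` occurs in the loop for `e` started in `σ`, all tuples with numbers greater than
`m` have been processed, and the solutions `H` have been visited. -/
structure InLoop (rows : Rows S) (Sol : Set (Fin n → ℕ))
    (Inv : List (Fin n → ℕ) → List (List ℕ) → State → Prop) (done es : List (Ear S n))
    (e : Ear S n) (h : List (Fin n → ℕ)) (σ : State) (m : ℕ) (H : List (Fin n → ℕ))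
    (E : List (List ℕ)) (τ : State) : Prop where
  inv : Inv (h ++ H) E τ
  ptr_self : τ.reg (.ptr e.id) = last (Hit rows done e (e.key.map σ.asg)) m
  ptr : ∀ f ∈ es, τ.reg (.ptr f.id) = σ.reg (.ptr f.id)
  asg : Set.EqOn (τ.asg : Fin n → ℕ) σ.asg (earVars es)
  mem_iff : ∀ s, s ∈ H ↔ s ∈ Sol ∧ Set.EqOn s σ.asg (earVars es) ∧
    ∃ j, m < j ∧ j ≤ (rows e.atom.1).length ∧ s ∘ e.atom.2 = entry (rows e.atom.1) j

theorem ptr_ne_ptr (hes : EarList (e :: es)) : ∀ f ∈ es, Reg.ptr f.id ≠ .ptr e.id :=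
  fun f hf heq => (hes.1.id_eq ▸ hes.2.id_lt f hf).ne (Reg.ptr.inj heq)

namespace InLoop

variable {m : ℕ}

theorem start (hes : EarList (e :: es)) (hInv : LoopInvariant rows (e :: done) Inv)
    (hσ : Inv h E σ) :
    InLoop rows Sol Inv done es e h σ (rows e.atom.1).length [] E
      (σ.set (.ptr e.id) (last (Hit rows done e (e.key.map σ.asg)) (rows e.atom.1).length)) where
  inv := by simpa using hInv.set hσ _ _
  ptr_self := State.set_reg_self ..
  ptr f hf := State.set_reg_of_ne _ _ (ptr_ne_ptr hes f hf)
  asg x _ := congrFun (σ.asg_set _ (by simp)) x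
  mem_iff s := by
    simp only [List.not_mem_nil, false_iff]
    rintro ⟨-, -, j, hj, hj', -⟩
    omega

theorem skip (hes : EarList (e :: es)) (hSol : ∀ s ∈ Sol, Alive rows done e s)
    (hτ : InLoop rows Sol Inv done es e h σ (m + 1) H E τ)
    (hno : ¬ Hit rows done e (e.key.map σ.asg) (m + 1)) :
    InLoop rows Sol Inv done es e h σ m H E τ where
  __ := hτ
  ptr_self := by rw [hτ.ptr_self, last_succ_of_neg hno]
  mem_iff s := by
    rw [hτ.mem_iff]
    refine and_congr_right fun hs => and_congr_right fun heq => ?_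
    refine ⟨fun ⟨j, hj, hrow⟩ => ⟨j, by omega, hrow⟩, fun ⟨j, hj, hrow⟩ => ⟨j, ?_, hrow⟩⟩
    refine lt_of_le_of_ne hj ?_
    rintro rfl
    exact hno ⟨s, hrow.2, hSol s hs, List.map_congr_left fun x hx =>
      (heq ((hes.1.mem_key x).mp hx).2).symm⟩

theorem load (hes : EarList (e :: es)) (hInv : LoopInvariant rows (e :: done) Inv)
    (hτ : InLoop rows Sol Inv done es e h σ (m + 1) H E τ) (hm : m < (rows e.atom.1).length)
    (hhit : Hit rows done e (e.key.map σ.asg) (m + 1)) :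
    ∃ τ₁, Runs w (.block (loadRow (.ptr e.id) e.atom (List.finRange _)))
        (Cmd.block (loadRow (.ptr e.id) e.atom (List.finRange _))).cost τ τ₁ ∧
      InLoop rows Sol Inv done es e h σ (m + 1) H E τ₁ ∧
      τ₁.asg ∘ e.atom.2 = entry (rows e.atom.1) (m + 1) ∧ Alive rows done e τ₁.asg := by
  obtain ⟨u, hrow, halive, hkey⟩ := hhit
  refine ⟨_, (Cmd.plain_block _).runs τ, ?_⟩
  set τ₁ := (Cmd.block (loadRow (.ptr e.id) e.atom (List.finRange _))).eval w τ
  have hreg (r : Reg) (hr : ∀ x ∈ Atom.vars e.atom, r ≠ .asg x) : τ₁.reg r = τ.reg r :=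
    loadRow_reg _ _ _ fun k _ => hr _ ⟨k, rfl⟩
  have hptr : τ.reg (.ptr e.id) = m + 1 :=
    hτ.ptr_self.trans (last_succ_of_pos ⟨u, hrow, halive, hkey⟩)
  have hasg : Set.EqOn τ₁.asg u (Atom.vars e.atom) :=
    (hInv.loaded hτ.inv).eqOn_loadRow (by simp) (by omega) (by omega) (hptr ▸ hrow)
  refine ⟨⟨hInv.congr hτ.inv (fun r hr => hreg r (by rintro _ - rfl; exact hr))
    (loadRow_heap ..), (hreg _ (by simp)).trans hτ.ptr_self,
    fun f hf => (hreg _ (by simp)).trans (hτ.ptr f hf), fun x hx => ?_, hτ.mem_iff⟩,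
    (Set.eqOn_range.mp hasg).trans hrow, halive.congr hasg.symm⟩
  by_cases hxe : x ∈ Atom.vars e.atom
  · exact (hasg hxe).trans (List.map_inj_left.mp hkey x ((hes.1.mem_key x).mpr ⟨hxe, hx⟩)).symm
  · refine (hreg _ fun y hy hxy => hxe ?_).trans (hτ.asg hx)
    rwa [Fin.ext (Reg.asg.inj hxy)]

theorem fresh (hrows : (rows e.atom.1).Nodup)
    (hτ : InLoop rows Sol Inv done es e h σ (m + 1) H E τ) (hm : m < (rows e.atom.1).length)
    (hrow : τ.asg ∘ e.atom.2 = entry (rows e.atom.1) (m + 1))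
    (hfresh : ∀ s ∈ h, ¬ Set.EqOn s σ.asg (earVars es)) :
    ∀ s ∈ h ++ H, ¬ Set.EqOn s τ.asg (earVars (e :: es)) := by
  intro s hs heq
  rw [earVars_cons, Set.eqOn_union] at heq
  rcases List.mem_append.mp hs with hs | hs
  · exact hfresh s hs (heq.2.trans hτ.asg)
  · obtain ⟨-, -, j, hj, hjN, hjrow⟩ := (hτ.mem_iff s).mp hs
    have hat : entry (rows e.atom.1) j = entry (rows e.atom.1) (m + 1) :=
      hjrow.symm.trans ((Set.eqOn_range.mp heq.1).trans hrow)
    have := entry_inj hrows (by omega) hjN (by omega) hm hat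
    omega

theorem advance (hes : EarList (e :: es)) (hInv : LoopInvariant rows (e :: done) Inv)
    (hτ : InLoop rows Sol Inv done es e h σ (m + 1) H E τ) (hm : m < (rows e.atom.1).length)
    (hrow : τ.asg ∘ e.atom.2 = entry (rows e.atom.1) (m + 1))
    (hbody : Visit w Sol Inv (e :: es) d body (h ++ H) E τ t τ' H') :
    InLoop rows Sol Inv done es e h σ m (H ++ H') (E ++ outputs t)
      (τ'.set (.ptr e.id) (last (Hit rows done e (e.key.map σ.asg)) m)) where
  inv := by simpa using hInv.set hbody.inv _ _
  ptr_self := State.set_reg_self ..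
  ptr f hf := by
    rw [State.set_reg_of_ne _ _ (ptr_ne_ptr hes f hf), hbody.ptr f (List.mem_cons_of_mem _ hf),
      hτ.ptr f hf]
  asg := by
    rw [State.asg_set _ _ (by simp)]
    exact (hbody.asg.mono (by simp)).trans hτ.asg
  mem_iff s := by
    have hnew : Set.EqOn s τ.asg (earVars (e :: es)) ↔
        Set.EqOn s σ.asg (earVars es) ∧ s ∘ e.atom.2 = entry (rows e.atom.1) (m + 1) := by
      rw [earVars_cons, Set.eqOn_union, and_comm, Atom.vars, Set.eqOn_range, hrow]
      exact and_congr_left' ⟨fun hs => hs.trans hτ.asg, fun hs => hs.trans hτ.asg.symm⟩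
    rw [List.mem_append, hτ.mem_iff, hbody.mem_iff, hnew, ← and_or_left, ← and_or_left]
    refine and_congr_right fun _ => and_congr_right fun _ => ?_
    constructor
    · rintro (⟨j, hj, hjrow⟩ | hs)
      · exact ⟨j, by omega, hjrow⟩
      · exact ⟨m + 1, by omega, hm, hs⟩
    · rintro ⟨j, hj, hjN, hs⟩
      rcases (Nat.succ_le_of_lt hj).lt_or_eq with hlt | rfl
      · exact .inl ⟨j, hlt, hjN, hs⟩
      · exact .inr hs

theorem step (hrows : (rows e.atom.1).Nodup) (hes : EarList (e :: es))
    (hInv : LoopInvariant rows (e :: done) Inv)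
    (hbody : Visits w rows Sol Inv done (e :: es) d body)
    (halive : ∀ f ∈ es, Alive rows done f σ.asg)
    (hfresh : ∀ s ∈ h, ¬ Set.EqOn s σ.asg (earVars es)) (hm : m < (rows e.atom.1).length)
    (hhit : Hit rows done e (e.key.map σ.asg) (m + 1))
    (hτ : InLoop rows Sol Inv done es e h σ (m + 1) H E τ) :
    ∃ t τ', Exec w (loopBody e body) τ t τ' ∧ Gap (e.bodyDelay d) t ∧ outputs t ≠ [] ∧
      ∃ H', InLoop rows Sol Inv done es e h σ m H' (E ++ outputs t) τ' := by
  obtain ⟨τ₁, ⟨i, hi, hload⟩, hτ₁, hrow, halive₁⟩ := hτ.load (w := w) hes hInv hm hhit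
  have halives : ∀ f ∈ e :: es, Alive rows done f τ₁.asg :=
    List.forall_mem_cons.mpr ⟨halive₁, fun f hf => (halive f hf).congr
      fun x hx => (hτ₁.asg ⟨f, hf, hx⟩).symm⟩
  obtain ⟨t, τ₂, H', hvisit⟩ :=
    hbody _ _ _ hτ₁.inv halives (hτ₁.fresh hrows hm hrow hfresh)
  have hnext : Op.eval w (.get (.ptr e.id) [.lit 2, .lit e.id, .reg (.ptr e.id)]) τ₂ =
      τ₂.set (.ptr e.id) (last (Hit rows done e (e.key.map σ.asg)) m) := by
    have hptr : τ₂.reg (.ptr e.id) = m + 1 := by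
      rw [hvisit.ptr e (by simp), hτ₁.ptr_self, last_succ_of_pos hhit]
    have hcell := (hInv.indexed hvisit.inv).1.next_eq _ (m + 1) (by omega) hm hhit
    rw [Nat.add_sub_cancel] at hcell
    simp [Op.eval, hptr, hcell]
  refine ⟨_, _, hload.seq (hvisit.exec.seq (.op _ _)),
    (Gap.silent hi).append_add (hvisit.gap.append_add (Gap.silent le_rfl)),
    by simpa using hvisit.outputs_ne_nil (by simp), H ++ H', ?_⟩
  rw [hnext]
  simpa using hτ₁.advance hes hInv hm hrow hvisit

end InLoop

theorem loopEar_visits (hrows : ∀ R, (rows R).Nodup) (hes : EarList (e :: es))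
    (hInv : LoopInvariant rows (e :: done) Inv) (hSol : ∀ s ∈ Sol, Alive rows done e s)
    (hbody : Visits w rows Sol Inv done (e :: es) d body) :
    Visits w rows Sol Inv (e :: done) es (e.delay d) (loopEar e body) := by
  intro h E σ hσ halive hfresh
  obtain ⟨t, σ', hexec, hgap, -, hout, H, hσ'⟩ := exec_whileNe_of_last (w := w)
    (C := loopBody e body) (p := .ptr e.id) (d := e.bodyDelay d)
    (P := Hit rows done e (e.key.map σ.asg))
    (J := fun m τ E' => ∃ H, InLoop rows Sol Inv done es e h σ m H E' τ)
    (fun m τ E' ⟨H, hτ⟩ => ⟨hτ.ptr_self, (hInv.loaded hτ.inv).zero⟩)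
    (fun m τ E' hm hhit ⟨H, hτ⟩ => hτ.step (hrows _) hes hInv hbody
      (fun f hf => (halive f hf).1) hfresh hm hhit)
    (fun m τ E' _ hno ⟨H, hτ⟩ => ⟨H, hτ.skip hes hSol hno⟩) le_rfl
    ⟨[], .start hes hInv hσ⟩
  have hget : Op.eval w (.get (.ptr e.id) (.lit 1 :: .lit e.id :: keyOperands e.key)) σ =
      σ.set (.ptr e.id) (last (Hit rows done e (e.key.map σ.asg)) (rows e.atom.1).length) := by
    simp [Op.eval, ← (hInv.indexed hσ).1.head_eq]
  refine ⟨_, σ', H, .seq (.op _ _) (hget ▸ hexec), (Gap.silent le_rfl).append_add hgap,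
    fun hne => ?_, by simpa using hσ'.inv, fun s => ?_, hσ'.ptr, hσ'.asg⟩
  · obtain ⟨p, hp, hkey⟩ := hes.1.exists_parent hne
    simpa using hout (last_hit_ne_zero.mpr ((halive p hp).2 hkey))
  · rw [hσ'.mem_iff, and_congr_right fun hs => and_iff_left ?_]
    obtain ⟨j, hj, hjN, hrow⟩ := mem_iff_exists_entry.mp (hSol s hs).comp_mem
    exact ⟨j, hj, hjN, hrow⟩

theorem loops_visits (hrows : ∀ R, (rows R).Nodup) (hes : EarList es)
    (hInv : LoopInvariant rows (es.reverseAux done) Inv)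
    (hSol : ∀ s ∈ Sol, (∀ c ∈ done, s ∘ c.atom.2 ∈ rows c.atom.1) ∧
      ∀ e ∈ es, s ∘ e.atom.2 ∈ rows e.atom.1)
    (hbody : Visits w rows Sol Inv done es d body) :
    Visits w rows Sol Inv (es.reverseAux done) [] (loopsDelay es d) (loops es body) := by
  induction es generalizing done d body with
  | nil => exact hbody
  | cons e es ih =>
    simp only [List.forall_mem_cons] at hSol
    exact ih hes.2 hInv
      (fun s hs => ⟨List.forall_mem_cons.mpr ⟨(hSol s hs).2.1, (hSol s hs).1⟩, (hSol s hs).2.2⟩)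
      (loopEar_visits hrows hes (LoopInvariant.of_reverseAux (es := es) hInv)
        (fun s hs => alive_of_comp_mem (hSol s hs).2.1 (hSol s hs).1) hbody)

end Loops

/-! ### Listings and agreeing pairs -/

section Listing

variable {α β : Type*} {f : α → β} {P : Set α} {E : List β}

/-- The list `E` consists of the values of `f` on `P`, one for each member of `P`. -/
def IsListing (f : α → β) (P : Set α) (E : List β) : Prop :=
  ∃ l : List α, l.Nodup ∧ (∀ a, a ∈ l ↔ a ∈ P) ∧ E = l.map f

theorem IsListing.empty (f : α → β) : IsListing f ∅ [] :=
  ⟨[], List.nodup_nil, by simp, rfl⟩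

theorem IsListing.concat {a : α} (h : IsListing f P E) (ha : a ∉ P) :
    IsListing f (insert a P) (E ++ [f a]) := by
  obtain ⟨l, hnodup, hmem, rfl⟩ := h
  refine ⟨l.concat a, hnodup.concat (mt (hmem a).mp ha), fun b => ?_, by simp⟩
  simp [hmem, or_comm]

theorem IsListing.nodup (h : IsListing f P E) (hf : Set.InjOn f P) : E.Nodup := by
  obtain ⟨l, hnodup, hmem, rfl⟩ := h
  exact hnodup.map_on fun a ha b hb => hf ((hmem a).mp ha) ((hmem b).mp hb)

theorem IsListing.mem_iff (h : IsListing f P E) {b : β} : b ∈ E ↔ b ∈ f '' P := by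
  obtain ⟨l, -, hmem, rfl⟩ := h
  simp [hmem]

end Listing

section Agreeing

variable {α β γ : Type*} {key : α → γ} {f : α × α → β} {h l : List α} {s u : α} {E : List β}

/-- The pairs of members of `h` with the same key. -/
def agreeing (key : α → γ) (h : List α) : Set (α × α) :=
  {p | p.1 ∈ h ∧ p.2 ∈ h ∧ key p.1 = key p.2}

/-- The pairs with the same key that consist of members of `h`, or of `s` and one of `s :: l`. -/
def agreeingWith (key : α → γ) (h : List α) (s : α) (l : List α) : Set (α × α) :=
  {p | (p.1 ∈ h ∧ p.2 ∈ h ∨ p.1 = s ∧ p.2 ∈ s :: l ∨ p.1 ∈ s :: l ∧ p.2 = s) ∧ key p.1 = key p.2}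

theorem agreeingWith_nil : agreeingWith key h s [] = insert (s, s) (agreeing key h) := by
  ext ⟨a, b⟩
  simp only [agreeingWith, agreeing, Set.mem_ofPred, Set.mem_insert_iff, Prod.mk.injEq,
    List.mem_singleton]
  grind

theorem agreeingWith_self : agreeingWith key h s h = agreeing key (h ++ [s]) := by
  ext ⟨a, b⟩
  simp only [agreeingWith, agreeing, Set.mem_ofPred, List.mem_append, List.mem_cons,
    List.not_mem_nil, or_false]
  grind

theorem agreeingWith_cons_of_ne (hne : key s ≠ key u) :
    agreeingWith key h s (u :: l) = agreeingWith key h s l := by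
  ext ⟨a, b⟩
  simp only [agreeingWith, Set.mem_ofPred, List.mem_cons]
  grind

theorem agreeingWith_cons_of_eq (heq : key s = key u) :
    agreeingWith key h s (u :: l) = insert (u, s) (insert (s, u) (agreeingWith key h s l)) := by
  ext ⟨a, b⟩
  simp only [agreeingWith, Set.mem_ofPred, List.mem_cons, Set.mem_insert_iff, Prod.mk.injEq]
  grind

theorem isListing_agreeingWith_nil (hE : IsListing f (agreeing key h) E) (hs : s ∉ h) :
    IsListing f (agreeingWith key h s []) (E ++ [f (s, s)]) := by
  rw [agreeingWith_nil]
  exact hE.concat fun hmem => hs hmem.1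

theorem isListing_agreeingWith_cons (hE : IsListing f (agreeingWith key h s l) E) (hs : s ∉ h)
    (hu : u ∉ s :: l) (heq : key s = key u) :
    IsListing f (agreeingWith key h s (u :: l)) (E ++ [f (s, u), f (u, s)]) := by
  rw [agreeingWith_cons_of_eq heq, List.append_cons]
  have hsu : (s, u) ∉ agreeingWith key h s l := by
    simp only [agreeingWith, Set.mem_ofPred]
    grind
  refine (hE.concat hsu).concat ?_
  simp only [agreeingWith, Set.mem_insert_iff, Set.mem_ofPred, Prod.mk.injEq]
  grind

end Agreeing

/-! ### Storing and combining solutions -/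

section Store

variable {n : ℕ} {w : List ℕ} {X : Set (Fin n)} {Z : List (Fin n)} {g : Fin n → Fin n}
  {h : List (Fin n → ℕ)} {s : Fin n → ℕ} {σ σ' : State}

/-- The values on `X` of the assignments in `h` are stored in the heap, and the assignments form
linked lists according to their values on `Z`. -/
structure Stored (X : Set (Fin n)) (Z : List (Fin n)) (h : List (Fin n → ℕ)) (σ : State) :
    Prop where
  ctr : σ.reg .ctr = h.length
  heap : ∀ j, 1 ≤ j → j ≤ h.length → ∀ x ∈ X, σ.heap [3, x, j] = entry h j x
  chained : Chained (fun κ j => κ = Z.map (entry h j)) (fun κ => σ.heap (4 :: κ))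
    (fun j => σ.heap [5, j]) h.length

theorem Stored.congr (hσ : Stored X Z h σ) (hctr : σ'.reg .ctr = σ.reg .ctr)
    (hheap : σ'.heap = σ.heap) : Stored X Z h σ' := by
  obtain ⟨ctr, heap, chained⟩ := hσ
  exact ⟨hctr.trans ctr, hheap ▸ heap, hheap ▸ chained⟩

/-- Store the values of the variables in `l`. -/
def storeOps (l : List (Fin n)) : List Op :=
  l.map fun (x : Fin n) => .put [.lit 3, .lit x, .reg .ctr] (.asg x)

/-- Put the newest stored assignment in front of its linked list. -/
def linkNewest (Z : List (Fin n)) : Cmd :=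
  .block [.get .cur (.lit 4 :: keyOperands Z), .put [.lit 5, .reg .ctr] .cur,
    .put (.lit 4 :: keyOperands Z) .ctr]

/-- Store the current assignment. -/
def storeBlock (Z : List (Fin n)) : Cmd :=
  .seq (.op (.inc .ctr .ctr)) (.seq (.block (storeOps (List.finRange n))) (linkNewest Z))

theorem plain_storeBlock (Z : List (Fin n)) : (storeBlock Z).Plain :=
  ⟨trivial, Cmd.plain_block _, Cmd.plain_block _⟩

theorem storeOps_reg (l : List (Fin n)) (σ : State) :
    ((Cmd.block (storeOps l)).eval w σ).reg = σ.reg := by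
  induction l generalizing σ with
  | nil => rfl
  | cons _ _ ih => exact ih _

theorem storeOps_heap_of_ne {l : List (Fin n)} {a : List ℕ} (σ : State)
    (ha : ∀ x ∈ l, a ≠ [3, ↑x, σ.reg .ctr]) :
    ((Cmd.block (storeOps l)).eval w σ).heap a = σ.heap a := by
  induction l generalizing σ with
  | nil => rfl
  | cons x l ih =>
    obtain ⟨hx, hl⟩ := List.forall_mem_cons.mp ha
    exact (ih (σ.write _ _) hl).trans (Function.update_of_ne hx ..)

theorem storeOps_heap {l : List (Fin n)} {x : Fin n} (hx : x ∈ l) (σ : State) :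
    ((Cmd.block (storeOps l)).eval w σ).heap [3, x, σ.reg .ctr] = σ.asg x := by
  induction l generalizing σ with
  | nil => simp at hx
  | cons y l ih =>
    let σ₁ := σ.write [3, y, σ.reg .ctr] (σ.reg (.asg y))
    by_cases hxl : x ∈ l
    · exact ih hxl σ₁
    obtain rfl : x = y := (List.mem_cons.mp hx).resolve_right hxl
    refine (storeOps_heap_of_ne σ₁ fun z hz h => hxl ?_).trans (Function.update_self ..)
    simp only [List.cons.injEq, Fin.val_inj] at h
    exact h.2.1 ▸ hz

theorem linkNewest_eval (σ : State) :
    (linkNewest Z).eval w σ = ((σ.set .cur (σ.heap (4 :: Z.map σ.asg))).write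
      [5, σ.reg .ctr] (σ.heap (4 :: Z.map σ.asg))).write (4 :: Z.map σ.asg) (σ.reg .ctr) := by
  have hasg : ∀ v l v', (((σ.set .cur v).write l v').asg : Fin n → ℕ) = σ.asg :=
    fun v _ _ => σ.asg_set (r := .cur) v (by simp)
  simp [linkNewest, Op.eval, State.set_reg, hasg]

theorem storeBlock_eval (Z : List (Fin n)) (σ : State) :
    ∃ τ : State, τ.reg = (σ.set .ctr (σ.reg .ctr + 1)).reg ∧
      (∀ x : Fin n, τ.heap [3, x, σ.reg .ctr + 1] = σ.asg x) ∧
      (∀ a, (∀ x : Fin n, a ≠ [3, ↑x, σ.reg .ctr + 1]) → τ.heap a = σ.heap a) ∧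
      (storeBlock Z).eval w σ = ((τ.set .cur (σ.heap (4 :: Z.map σ.asg))).write
        [5, σ.reg .ctr + 1] (σ.heap (4 :: Z.map σ.asg))).write
        (4 :: Z.map σ.asg) (σ.reg .ctr + 1) := by
  let σ₀ := σ.set .ctr (σ.reg .ctr + 1)
  let τ := (Cmd.block (storeOps (List.finRange n))).eval w σ₀
  have hctr : σ₀.reg .ctr = σ.reg .ctr + 1 := State.set_reg_self ..
  have hreg : τ.reg = σ₀.reg := storeOps_reg ..
  have hasg : (σ₀.asg : Fin n → ℕ) = σ.asg := σ.asg_set _ (by simp)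
  have hasg' : (τ.asg : Fin n → ℕ) = σ.asg := by
    rw [← hasg]
    exact funext fun x => congrFun hreg _
  have hheap (a : List ℕ) (ha : ∀ x : Fin n, a ≠ [3, ↑x, σ.reg .ctr + 1]) :
      τ.heap a = σ.heap a := storeOps_heap_of_ne σ₀ fun x _ => hctr ▸ ha x
  refine ⟨τ, hreg, fun x => ?_, hheap, ?_⟩
  · rw [← hasg, ← hctr]
    exact storeOps_heap (List.mem_finRange x) σ₀
  · have hev : (storeBlock Z).eval w σ = (linkNewest Z).eval w τ := rfl
    rw [hev, linkNewest_eval, hasg', hheap _ (by simp), hreg, hctr]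

theorem storeBlock_reg {r : Reg} (hcur : r ≠ .cur) (hctr : r ≠ .ctr) (σ : State) :
    ((storeBlock Z).eval w σ).reg r = σ.reg r := by
  obtain ⟨τ, hreg, -, -, hev⟩ := storeBlock_eval (w := w) Z σ
  simp [hev, State.set_reg, hcur, hreg, hctr]

theorem storeBlock_heap {k : ℕ} (hk : k < 3) (a : List ℕ) (σ : State) :
    ((storeBlock Z).eval w σ).heap (k :: a) = σ.heap (k :: a) := by
  obtain ⟨τ, -, -, hheap, hev⟩ := storeBlock_eval (w := w) Z σ
  have h3 : k ≠ 3 := by omega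
  have h4 : k ≠ 4 := by omega
  have h5 : k ≠ 5 := by omega
  simp [hev, State.write_heap, h4, h5, hheap (k :: a) (by simp [h3])]

theorem Stored.storeBlock_cur (hσ : Stored X Z h σ) (hs : Z.map σ.asg = Z.map s) :
    ((storeBlock Z).eval w σ).reg .cur = last (fun j => Z.map s = Z.map (entry h j)) h.length := by
  obtain ⟨τ, -, -, -, hev⟩ := storeBlock_eval (w := w) Z σ
  rw [hev, State.write_reg, State.write_reg, State.set_reg_self, hs]
  exact hσ.chained.head_eq _

theorem Stored.storeBlock (hσ : Stored X Z h σ) (hs : Z.map σ.asg = Z.map s)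
    (hX : Set.EqOn σ.asg s X) : Stored X Z (h ++ [s]) ((storeBlock Z).eval w σ) := by
  obtain ⟨τ, hreg, hnew, hheap, hev⟩ := storeBlock_eval (w := w) Z σ
  rw [hσ.ctr, hs] at hev
  rw [hσ.ctr] at hnew hheap
  rw [hev]
  refine ⟨?_, fun j hj hjle x hx => ?_, ?_⟩
  · simp [State.set_reg, hreg, hσ.ctr]
  · rw [List.length_append, List.length_singleton] at hjle
    simp only [State.write_heap, List.cons.injEq, State.set_heap, Nat.reduceEqDiff, false_and,
      if_false]
    rcases hjle.lt_or_eq with hlt | rfl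
    · rw [hheap _ (by simp; omega), hσ.heap j hj (by omega) x hx, entry_append _ hj (by omega)]
    · rw [hnew, entry_concat, hX hx]
  · rw [List.length_append, List.length_singleton]
    refine (hσ.chained.congr fun κ j hj hjle => by rw [entry_append _ hj hjle]).insert
      (κ₀ := Z.map s) (fun κ => by rw [entry_concat]) ?_ (fun κ hκ => ?_) ?_ (fun j hj => ?_)
    · simp [State.write_heap]
    · simp [State.write_heap, hκ, hheap]
    · simp [State.write_heap]
    · simp [State.write_heap, hheap, show j ≠ h.length + 1 by omega]

/-- Load the stored values of the variables in `l` from the assignment with the number in register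
`cur`. -/
def fetchOps (l : List (Fin n)) : List Op :=
  l.map fun (x : Fin n) => .get (.old x) [.lit 3, .lit x, .reg .cur]

theorem fetchOps_heap (l : List (Fin n)) (σ : State) :
    ((Cmd.block (fetchOps l)).eval w σ).heap = σ.heap := by
  induction l generalizing σ with
  | nil => rfl
  | cons _ _ ih => exact ih _

theorem fetchOps_reg {l : List (Fin n)} {r : Reg} (hr : ∀ x ∈ l, r ≠ .old x) (σ : State) :
    ((Cmd.block (fetchOps l)).eval w σ).reg r = σ.reg r := by
  induction l generalizing σ with
  | nil => rfl
  | cons x l ih =>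
    obtain ⟨hx, hl⟩ := List.forall_mem_cons.mp hr
    exact (ih hl _).trans (State.set_reg_of_ne _ _ hx)

theorem fetchOps_old {l : List (Fin n)} {x : Fin n} (hx : x ∈ l) (σ : State) :
    ((Cmd.block (fetchOps l)).eval w σ).reg (.old x) = σ.heap [3, x, σ.reg .cur] := by
  induction l generalizing σ with
  | nil => simp at hx
  | cons y l ih =>
    let σ₁ := σ.set (.old y) (σ.heap [3, y, σ.reg .cur])
    by_cases hxl : x ∈ l
    · exact (ih hxl σ₁).trans (by simp [σ₁, State.set_reg])
    obtain rfl : x = y := (List.mem_cons.mp hx).resolve_right hxl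
    refine (fetchOps_reg (fun z hz h => hxl ?_) σ₁).trans (State.set_reg_self ..)
    simp only [Reg.old.injEq, Fin.val_inj] at h
    exact h ▸ hz

/-- The tuple of the combination of a pair of assignments. -/
noncomputable def combineTuple (X : Set (Fin n)) (g : Fin n → Fin n)
    (p : (Fin n → ℕ) × (Fin n → ℕ)) : List ℕ := List.ofFn (combine X g p.1 p.2)

open Classical in
/-- Output the combination of the assignments in the registers `b` and `b'`. -/
noncomputable def emitCombined (X : Set (Fin n)) (g : Fin n → Fin n) (b b' : ℕ → Reg) : Cmd :=
  .emit (List.ofFn fun x : Fin n => if x ∈ X then b x else b' (g x))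

theorem emitCombined_exec (hg : ∀ x ∉ X, g x ∈ X) {b b' : ℕ → Reg} {s s' : Fin n → ℕ}
    (hs : ∀ x ∈ X, σ.reg (b x) = s x) (hs' : ∀ x ∈ X, σ.reg (b' x) = s' x) :
    Exec w (emitCombined X g b b') σ [some (combineTuple X g (s, s'))] σ := by
  classical
  have htuple : combineTuple X g (s, s') = List.ofFn fun x =>
      combine X g (fun x => σ.reg (b x)) (fun x => σ.reg (b' x)) x :=
    congrArg List.ofFn (combine_congr hg (fun x hx => (hs x hx).symm) fun x hx => (hs' x hx).symm)
  have hregs : combineTuple X g (s, s') =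
      (List.ofFn fun x : Fin n => if x ∈ X then b x else b' (g x)).map σ.reg := by
    rw [htuple, List.map_ofFn]
    exact congrArg List.ofFn (funext fun x => (apply_ite σ.reg ..).symm)
  rw [hregs]
  exact .emit _ σ

end Store

section Visitor

variable {n : ℕ} {w : List ℕ} {X : Set (Fin n)} {Z : List (Fin n)} {g : Fin n → Fin n}
  {h : List (Fin n → ℕ)} {s : Fin n → ℕ} {E : List (List ℕ)} {σ τ : State} {m : ℕ}

/-- Output the combinations of the current assignment with a stored one, and go to the next stored
assignment. -/
noncomputable def pairLoopBody (X : Set (Fin n)) (g : Fin n → Fin n) : Cmd :=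
  .seq (.block (fetchOps (List.finRange n))) (.seq (emitCombined X g .asg .old)
    (.seq (emitCombined X g .old .asg) (.op (.get .cur [.lit 5, .reg .cur]))))

/-- Store the current assignment, and output its combinations with itself and with the assignments
stored before. -/
noncomputable def visitor (X : Set (Fin n)) (Z : List (Fin n)) (g : Fin n → Fin n) : Cmd :=
  .seq (storeBlock Z) (.seq (emitCombined X g .asg .asg)
    (.whileNe .cur .zero (pairLoopBody X g)))

/-- The delay of the body of the loop over the stored assignments. -/
def pairLoopDelay (n : ℕ) : ℕ :=
  (Cmd.block (fetchOps (List.finRange n))).cost + (1 + (1 + (Op.get .cur [.lit 5, .reg .cur]).cost))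

/-- The delay of `visitor`. -/
def visitorDelay (Z : List (Fin n)) : ℕ :=
  (storeBlock Z).cost + (1 + (2 * pairLoopDelay n + 2))

/-- The state `τ` occurs in the loop over the stored assignments `h`, started in `σ` to combine them
with `s`, and those with numbers greater than `m` have been processed. -/
structure Pairing (X : Set (Fin n)) (Z : List (Fin n)) (g : Fin n → Fin n)
    (h : List (Fin n → ℕ)) (s : Fin n → ℕ) (σ : State) (m : ℕ) (τ : State) (E : List (List ℕ)) :
    Prop where
  heap_eq : τ.heap = σ.heap
  reg_eq : ∀ r : Reg, (∀ x, r ≠ .old x) → r ≠ .cur → τ.reg r = σ.reg r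
  cur : τ.reg .cur = last (fun j => Z.map s = Z.map (entry h j)) m
  listing : IsListing (combineTuple X g) (agreeingWith (fun v => Z.map v) h s (h.drop m)) E

theorem Pairing.skip (hm : m < h.length) (hne : Z.map s ≠ Z.map (entry h (m + 1)))
    (hτ : Pairing X Z g h s σ (m + 1) τ E) : Pairing X Z g h s σ m τ E where
  heap_eq := hτ.heap_eq
  reg_eq := hτ.reg_eq
  cur := hτ.cur.trans (last_succ_of_neg hne)
  listing := by
    rw [drop_eq_entry_cons hm, agreeingWith_cons_of_ne hne]
    exact hτ.listing

theorem Pairing.listing_succ (hnodup : (h ++ [s]).Nodup) (hm : m < h.length)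
    (heq : Z.map s = Z.map (entry h (m + 1))) (hτ : Pairing X Z g h s σ (m + 1) τ E) :
    IsListing (combineTuple X g) (agreeingWith (fun v => Z.map v) h s (h.drop m))
      (E ++ [combineTuple X g (s, entry h (m + 1)), combineTuple X g (entry h (m + 1), s)]) := by
  obtain ⟨hh, -, hs⟩ := List.nodup_append.mp hnodup
  have hsh : s ∉ h := fun hmem => hs s hmem s (List.mem_singleton_self s) rfl
  have hdrop := drop_eq_entry_cons hm
  have hu : entry h (m + 1) ∉ s :: h.drop (m + 1) := by
    rw [List.mem_cons, not_or]
    refine ⟨fun he => hsh (he ▸ mem_iff_exists_entry.mpr ⟨m + 1, by omega, hm, rfl⟩), ?_⟩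
    exact (List.nodup_cons.mp (hdrop ▸ hh.sublist (List.drop_sublist m h))).1
  rw [hdrop]
  exact isListing_agreeingWith_cons hτ.listing hsh hu heq

theorem Pairing.eval_next (hσ : Stored X Z (h ++ [s]) σ) (hm : m < h.length)
    (heq : Z.map s = Z.map (entry h (m + 1))) (hheap : τ.heap = σ.heap)
    (hcur : τ.reg .cur = m + 1) :
    (Op.get .cur [.lit 5, .reg .cur]).eval w τ =
      τ.set .cur (last (fun j => Z.map s = Z.map (entry h j)) m) := by
  have hlen : (h ++ [s]).length = h.length + 1 := List.length_append
  have hnext := hσ.chained.next_eq (Z.map s) (m + 1) (by omega) (by omega)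
    (by rwa [entry_append _ (by omega) hm])
  rw [Nat.add_sub_cancel, last_congr (P' := fun j => Z.map s = Z.map (entry h j))
    fun j hj hjm => by rw [entry_append _ hj (by omega)]] at hnext
  simp [Op.eval, hcur, hheap, hnext]

theorem pairLoopBody_exec (hg : ∀ x ∉ X, g x ∈ X) (hσ : Stored X Z (h ++ [s]) σ)
    (hX : Set.EqOn σ.asg s X) (hnodup : (h ++ [s]).Nodup) (hm : m < h.length)
    (heq : Z.map s = Z.map (entry h (m + 1))) (hτ : Pairing X Z g h s σ (m + 1) τ E) :
    ∃ t τ', Exec w (pairLoopBody X g) τ t τ' ∧ Gap (pairLoopDelay n) t ∧ outputs t ≠ [] ∧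
      Pairing X Z g h s σ m τ' (E ++ outputs t) := by
  let τ₁ := (Cmd.block (fetchOps (List.finRange n))).eval w τ
  obtain ⟨i, hi, hfetch⟩ := (Cmd.plain_block (fetchOps (List.finRange n))).runs (w := w) τ
  have hcur : τ.reg .cur = m + 1 := hτ.cur.trans (last_succ_of_pos heq)
  have hheap : τ₁.heap = σ.heap := (fetchOps_heap _ _).trans hτ.heap_eq
  have hreg (r : Reg) (hr : ∀ x, r ≠ .old x) : τ₁.reg r = τ.reg r :=
    fetchOps_reg (fun x _ => hr x) _
  have hlen : (h ++ [s]).length = h.length + 1 := List.length_append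
  have hasg (x : Fin n) (hx : x ∈ X) : τ₁.reg (.asg x) = s x := by
    rw [hreg _ (by simp), hτ.reg_eq _ (by simp) (by simp)]
    exact hX hx
  have hold (x : Fin n) (hx : x ∈ X) : τ₁.reg (.old x) = entry h (m + 1) x := by
    rw [fetchOps_old (List.mem_finRange x), hcur, hτ.heap_eq,
      hσ.heap _ (by omega) (by omega) x hx, entry_append _ (by omega) hm]
  have hnext := Exec.op (w := w) (.get .cur [.lit 5, .reg .cur]) τ₁
  rw [Pairing.eval_next hσ hm heq hheap ((hreg _ (by simp)).trans hcur)] at hnext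
  refine ⟨_, _, hfetch.seq ((emitCombined_exec hg hasg hold).seq
    ((emitCombined_exec hg hold hasg).seq hnext)), ?_, by simp, hheap, fun r hr hr' => ?_,
    State.set_reg_self .., ?_⟩
  · exact (Gap.silent hi).append_add ((Gap.singleton _).append_add ((Gap.singleton _).append_add
      (Gap.silent le_rfl)))
  · exact (State.set_reg_of_ne _ _ hr').trans ((hreg r hr).trans (hτ.reg_eq r hr hr'))
  · simpa using hτ.listing_succ hnodup hm heq

theorem pairLoop_exec (hg : ∀ x ∉ X, g x ∈ X) (hσ : Stored X Z (h ++ [s]) σ)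
    (hX : Set.EqOn σ.asg s X) (hnodup : (h ++ [s]).Nodup) (hzero : σ.reg .zero = 0)
    (h₀ : Pairing X Z g h s σ h.length σ E) :
    ∃ t τ, Exec w (.whileNe .cur .zero (pairLoopBody X g)) σ t τ ∧
      Gap (2 * pairLoopDelay n + 2) t ∧ Pairing X Z g h s σ 0 τ (E ++ outputs t) := by
  obtain ⟨t, τ, hexec, hgap, -, -, hτ⟩ := exec_whileNe_of_last (w := w) (N := h.length)
    (J := Pairing X Z g h s σ)
    (fun m τ E hτ => ⟨hτ.cur, (hτ.reg_eq _ (by simp) (by simp)).trans hzero⟩)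
    (fun m τ E hm heq hτ => pairLoopBody_exec hg hσ hX hnodup hm heq hτ)
    (fun m τ E hm hne hτ => hτ.skip hm hne) le_rfl h₀
  exact ⟨t, τ, hexec, hgap, hτ⟩

end Visitor

section Enumeration

variable {S : Schema} {n : ℕ} {w : List ℕ} {rows : Rows S} {es full : List (Ear S n)}
  {X : Set (Fin n)} {Z : List (Fin n)} {g : Fin n → Fin n} {h : List (Fin n → ℕ)} {s : Fin n → ℕ}
  {E : List (List ℕ)} {σ σ' : State}

/-- The invariant of the enumeration: the assignments in `h` are those visited so far, and their
combinations have been output. -/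
structure Enumerating (rows : Rows S) (full : List (Ear S n)) (X : Set (Fin n)) (Z : List (Fin n))
    (g : Fin n → Fin n) (h : List (Fin n → ℕ)) (E : List (List ℕ)) (σ : State) : Prop where
  loaded : Loaded rows σ
  indexed : Indexed rows full σ
  stored : Stored X Z h σ
  nodup : h.Nodup
  listing : IsListing (combineTuple X g) (agreeing (fun v => Z.map v) h) E

theorem loopInvariant_enumerating :
    LoopInvariant rows full (Enumerating rows full X Z g) where
  congr h hreg hheap := ⟨h.loaded.congr hreg fun _ => congrFun hheap _,
    h.indexed.congr fun _ _ _ _ => congrFun hheap _,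
    h.stored.congr (hreg .ctr trivial) hheap, h.nodup, h.listing⟩
  loaded h := h.loaded
  indexed h := h.indexed

theorem Enumerating.visitor_exec (hg : ∀ x ∉ X, g x ∈ X) (hZ : ∀ x ∈ Z, x ∈ X)
    (hσ : Enumerating rows full X Z g h E σ) (hX : Set.EqOn σ.asg s X) (hs : s ∉ h) :
    ∃ t σ', Exec w (visitor X Z g) σ t σ' ∧ Gap (visitorDelay Z) t ∧ outputs t ≠ [] ∧
      Enumerating rows full X Z g (h ++ [s]) (E ++ outputs t) σ' ∧
      ∀ r : Reg, (∀ x, r ≠ .old x) → r ≠ .cur → r ≠ .ctr → σ'.reg r = σ.reg r := by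
  let σ₁ := (storeBlock Z).eval w σ
  obtain ⟨i, hi, hstore⟩ := (plain_storeBlock Z).runs (w := w) σ
  have hreg₁ (r : Reg) (hcur : r ≠ .cur) (hctr : r ≠ .ctr) : σ₁.reg r = σ.reg r :=
    storeBlock_reg hcur hctr σ
  have hX₁ : Set.EqOn σ₁.asg s X := fun x hx => (hreg₁ _ (by simp) (by simp)).trans (hX hx)
  have hZs : Z.map σ.asg = Z.map s := List.map_congr_left fun x hx => hX (hZ x hx)
  have hnodup : (h ++ [s]).Nodup := List.concat_eq_append ▸ hσ.nodup.concat hs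
  have hstored : Stored X Z (h ++ [s]) σ₁ := hσ.stored.storeBlock hZs hX
  have hzero : σ₁.reg .zero = 0 := (hreg₁ _ (by simp) (by simp)).trans hσ.loaded.zero
  have hpairing : Pairing X Z g h s σ₁ h.length σ₁ (E ++ [combineTuple X g (s, s)]) :=
    ⟨rfl, fun _ _ _ => rfl, hσ.stored.storeBlock_cur hZs,
      (List.drop_length (l := h)).symm ▸ isListing_agreeingWith_nil hσ.listing hs⟩
  obtain ⟨t, σ', hloop, hgap, hτ⟩ := pairLoop_exec (w := w) hg hstored hX₁ hnodup hzero hpairing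
  have hreg (r : Reg) (hold : ∀ x, r ≠ .old x) (hcur : r ≠ .cur) (hctr : r ≠ .ctr) :
      σ'.reg r = σ.reg r := (hτ.reg_eq r hold hcur).trans (hreg₁ r hcur hctr)
  have hheap (k : ℕ) (hk : k < 3) (a : List ℕ) : σ'.heap (k :: a) = σ.heap (k :: a) :=
    (congrFun hτ.heap_eq _).trans (storeBlock_heap hk a σ)
  refine ⟨_, σ', hstore.seq ((emitCombined_exec hg hX₁ hX₁).seq hloop),
    (Gap.silent hi).append_add ((Gap.singleton _).append_add hgap), by simp,
    ⟨?_, ?_, ?_, hnodup, ?_⟩, hreg⟩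
  · exact ⟨(hreg _ (by simp) (by simp) (by simp)).trans hσ.loaded.zero,
      fun R => (hreg _ (by simp) (by simp) (by simp)).trans (hσ.loaded.cnt R),
      fun R k j hj hjle => (hheap 0 (by simp) _).trans (hσ.loaded.heap R k j hj hjle)⟩
  · refine hσ.indexed.congr fun c _ a ha => ?_
    rcases ha with ⟨κ, rfl⟩ | ⟨j, rfl⟩ <;> exact hheap _ (by simp) _
  · exact hstored.congr (hτ.reg_eq _ (by simp) (by simp)) hτ.heap_eq
  · simpa [agreeingWith_self] using hτ.listing

theorem visitor_visits (hZ : ∀ x ∈ Z, x ∈ earVars es) (hg : ∀ x ∉ earVars es, g x ∈ earVars es) :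
    Visits w rows {s | (∀ x ∉ earVars es, s x = 0) ∧ ∀ e ∈ es, s ∘ e.atom.2 ∈ rows e.atom.1}
      (Enumerating rows full (earVars es) Z g) [] es (visitorDelay Z)
      (visitor (earVars es) Z g) := by
  intro h E σ hσ halive hfresh
  let s := (earVars es).indicator (σ.asg : Fin n → ℕ)
  have hs : Set.EqOn s σ.asg (earVars es) := Set.eqOn_indicator
  have hrows (e : Ear S n) (he : e ∈ es) : s ∘ e.atom.2 = σ.asg ∘ e.atom.2 :=
    funext fun k => hs ⟨e, he, k, rfl⟩
  obtain ⟨t, σ', hexec, hgap, hout, hσ', hreg⟩ :=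
    hσ.visitor_exec (w := w) hg hZ hs.symm fun hmem => hfresh s hmem hs
  refine ⟨t, σ', [s], hexec, hgap, fun _ => hout, hσ', fun v => ?_,
    fun e _ => hreg _ (by simp) (by simp) (by simp),
    fun x _ => hreg _ (by simp) (by simp) (by simp)⟩
  rw [List.mem_singleton]
  refine ⟨?_, fun ⟨⟨hv, _⟩, hvs⟩ => ?_⟩
  · rintro rfl
    refine ⟨⟨fun x hx => Set.indicator_of_notMem hx _, fun e he => ?_⟩, hs⟩
    exact (hrows e he).symm ▸ (halive e he).comp_mem
  · funext x
    by_cases hx : x ∈ earVars es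
    · rw [hvs hx, hs hx]
    · exact (hv x hx).trans (Set.indicator_of_notMem hx _).symm

end Enumeration

/-! ### The program for a mirror query -/

section Encoding

variable {S : Schema} {D : Database S} {rows : Rows S} {w : List ℕ} {q : FullCQ S}

/-- The lists in `rows` consist of the tuples of the relations of `D`, without repetition. -/
structure Rows.Lists (rows : Rows S) (D : Database S) : Prop where
  nodup : ∀ R, (rows R).Nodup
  mem_iff : ∀ R t, t ∈ rows R ↔ t ∈ D.rel R

theorem Rows.Lists.length_eq_card (h : rows.Lists D) (R : Fin S.numSymbols) :
    (rows R).length = (D.rel R).card := by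
  classical
  rw [← List.toFinset_card_of_nodup (h.nodup R)]
  congr 1
  ext t
  rw [List.mem_toFinset, h.mem_iff]

theorem Rows.Lists.length_le_size (h : rows.Lists D) (R : Fin S.numSymbols) :
    (rows R).length ≤ D.size :=
  (h.length_eq_card R).le.trans
    (Finset.single_le_sum (f := fun R => (D.rel R).card) (fun _ _ => Nat.zero_le _)
      (Finset.mem_univ R))

theorem Database.IsEncoding.exists_rows (h : D.IsEncoding w) :
    ∃ rows : Rows S, rows.Lists D ∧ w = rows.encode (List.finRange _) := by
  obtain ⟨rows, hrows, hw⟩ := h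
  exact ⟨rows, ⟨fun R => (hrows R).1, fun R => (hrows R).2⟩, hw⟩

theorem Database.IsEncoding.size_le (h : D.IsEncoding w) :
    D.size ≤ S.numSymbols * magnitude w := by
  obtain ⟨rows, hrows, rfl⟩ := h.exists_rows
  have hcard : ∀ R ∈ Finset.univ,
      (D.rel R).card ≤ magnitude (rows.encode (List.finRange S.numSymbols)) := fun R _ => by
    rw [← hrows.length_eq_card R]
    exact (lt_magnitude (List.mem_flatMap.mpr
      ⟨R, List.mem_finRange R, List.mem_cons_self ..⟩)).le
  simpa [Database.size] using Finset.sum_le_card_nsmul _ _ _ hcard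

theorem Database.IsEncoding.lt_magnitude (h : D.IsEncoding w) {v : Fin q.numVars → ℕ}
    (hv : v ∈ q.solutions D) (x : Fin q.numVars) : v x < magnitude w := by
  obtain ⟨rows, hrows, rfl⟩ := h.exists_rows
  obtain ⟨a, ha, j, rfl⟩ := q.covered x
  exact MirrorCQ.lt_magnitude (List.mem_flatMap.mpr ⟨a.1, List.mem_finRange _,
    List.mem_cons_of_mem _ (List.mem_flatMap.mpr ⟨v ∘ a.2, (hrows.mem_iff _ _).mpr (hv.2 a ha),
      List.mem_ofFn.mpr ⟨j, rfl⟩⟩)⟩)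

theorem Database.IsEncoding.length_le (h : D.IsEncoding w) {E : List (List ℕ)} (hE : E.Nodup)
    (hE' : ∀ o ∈ E, o ∈ List.ofFn '' q.solutions D) : E.length ≤ magnitude w ^ q.numVars := by
  classical
  rw [← List.toFinset_card_of_nodup hE]
  have hsub : E.toFinset ⊆
      (Fintype.piFinset fun _ : Fin q.numVars => Finset.range (magnitude w)).image List.ofFn := by
    intro o ho
    obtain ⟨v, hv, rfl⟩ := hE' o (List.mem_toFinset.mp ho)
    exact Finset.mem_image_of_mem _ (Fintype.mem_piFinset.mpr fun x =>
      Finset.mem_range.mpr (h.lt_magnitude hv x))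
  refine (Finset.card_le_card hsub).trans (Finset.card_image_le.trans ?_)
  rw [Fintype.card_piFinset_const, Finset.card_range]

open Polynomial in
theorem FullCQ.constantDelayEnumerable_of_exec {C : Cmd} {κ d : ℕ}
    (hC : ∀ (D : Database S) (w : List ℕ), D.IsEncoding w → ∃ i t σ, i ≤ κ * (D.size + 1) ∧
      Exec w C State.blank (silent i ++ t) σ ∧ Gap d t ∧ (outputs t).Nodup ∧
      ∀ o, o ∈ outputs t ↔ o ∈ List.ofFn '' q.solutions D) :
    q.ConstantDelayEnumerable := by
  let P : ℕ[X] := X + Polynomial.C C.extent + (Polynomial.C κ * (Polynomial.C S.numSymbols * X + 1)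
    + (Polynomial.C d + 1) * (X ^ q.numVars + 1)) + 2
  obtain ⟨r, hr⟩ := exists_eval_le_pow P
  refine ⟨C.code 0, r * 3 ^ C.extent + κ + d, fun D w hw => ?_⟩
  obtain ⟨i, t, σ, hi, hexec, hgap, hnodup, hout⟩ := hC D w hw
  have hmag : 2 ≤ magnitude w := Nat.le_add_left 2 _
  have hi' : i ≤ κ * (S.numSymbols * magnitude w + 1) :=
    hi.trans (Nat.mul_le_mul_left _ (Nat.succ_le_succ hw.size_le))
  have hlen : t.length ≤ (d + 1) * (magnitude w ^ q.numVars + 1) :=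
    hgap.length_le.trans (Nat.mul_le_mul_left _
      (Nat.succ_le_succ (hw.length_le hnodup fun o ho => (hout o).mp ho)))
  have hbound : magnitude w + C.extent + (i + t.length) + 2 ≤ magnitude w ^ r := by
    refine le_trans ?_ (hr _ hmag)
    simp only [P, eval_add, eval_mul, eval_pow, eval_X, eval_C, eval_one, eval_ofNat]
    gcongr
  have hsols : List.ofFn '' q.solutions D = {o | o ∈ outputs t} :=
    Set.ext fun o => (hout o).symm
  rw [hsols]
  refine (hexec.enumerates hgap hnodup).mono ?_ (Nat.le_add_left _ _) ?_
  · exact hi.trans (Nat.mul_le_mul_right _ (by omega))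
  · refine (Nat.pow_le_pow_left hbound _).trans ?_
    rw [← pow_mul]
    exact Nat.pow_le_pow_right (by omega) (by omega)

end Encoding

section Program

variable {S : Schema} {n : ℕ} {I : Finset (Atom S n)} {es : List (Ear S n)} {D : Database S}
  {rows : Rows S} {h : List (Fin n → ℕ)}

theorem earVars_eq_varsOf (hI : ∀ a, (∃ e ∈ es, e.atom = a) ↔ a ∈ I) : earVars es = varsOf I := by
  ext x
  simp only [earVars, varsOf, ← hI, Set.mem_ofPred]
  exact ⟨fun ⟨e, he, hx⟩ => ⟨_, ⟨e, he, rfl⟩, hx⟩, fun ⟨_, ⟨e, he, ha⟩, hx⟩ => ⟨e, he, ha ▸ hx⟩⟩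

theorem Rows.Lists.forall_ears_iff_sat (hrows : rows.Lists D)
    (hI : ∀ a, (∃ e ∈ es, e.atom = a) ↔ a ∈ I) {v : Fin n → ℕ} :
    (∀ e ∈ es, v ∘ e.atom.2 ∈ rows e.atom.1) ↔ Sat D I v := by
  simp only [Sat, hrows.mem_iff, ← hI, forall_exists_index, and_imp, forall_apply_eq_imp_iff₂]

/-- The assignments in `h` are the solutions of the query with atoms `I`, with the value `0` for
the variables that do not occur in `I`. -/
def ListsSolutions (D : Database S) (I : Finset (Atom S n))
    (h : List (Fin n → ℕ)) : Prop :=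
  ∀ s, s ∈ h ↔ (∀ x ∉ varsOf I, s x = 0) ∧ Sat D I s

theorem ListsSolutions.eq_of_eqOn (hh : ListsSolutions D I h) {s s' : Fin n → ℕ}
    (hs : s ∈ h) (hs' : s' ∈ h) (heq : Set.EqOn s s' (varsOf I)) : s = s' := by
  funext x
  by_cases hx : x ∈ varsOf I
  · exact heq hx
  · rw [((hh s).mp hs).1 x hx, ((hh s').mp hs').1 x hx]

theorem ListsSolutions.indicator_mem (hh : ListsSolutions D I h) {s : Fin n → ℕ}
    (hs : Sat D I s) : (varsOf I).indicator s ∈ h :=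
  (hh _).mpr ⟨fun _ hx => Set.indicator_of_notMem hx s,
    (sat_congr fun _ hx => Set.indicator_of_mem hx s).mpr hs⟩

/-- Read the input and build the index for the ears in `es`. -/
noncomputable def preprocess (es : List (Ear S n)) : Cmd :=
  .seq (readAll (List.finRange S.numSymbols)) (buildAll [] es)

theorem preprocess_runs (hes : EarList es) : ∃ κ, ∀ (rows : Rows S) (M : ℕ) (X) (Z) (g),
    (∀ R, (rows R).length ≤ M) → ∃ σ,
      Runs (rows.encode (List.finRange _)) (preprocess es) (κ * (M + 1)) State.blank σ ∧
      Enumerating rows (es.reverseAux []) X Z g [] [] σ := by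
  obtain ⟨κ, hread⟩ := readAll_runs (List.finRange S.numSymbols) (List.nodup_finRange _)
  obtain ⟨κ', hbuild⟩ := buildAll_runs [] es hes (by simp)
  refine ⟨κ + κ', fun rows M X Z g hM => ?_⟩
  obtain ⟨σ₁, hruns₁, hσ₁⟩ := hread _ rows M State.blank hM rfl
  have hzero₁ (k : ℕ) (a : List ℕ) (hk : k ≠ 0) : σ₁.heap (k :: a) = 0 :=
    hσ₁.heap_of_ne _ (by simp [hk])
  obtain ⟨σ₂, hruns₂, hindexed, hreg, hheap⟩ := hbuild _ rows M σ₁ hM hσ₁.loaded trivial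
    fun _ _ _ => hzero₁ 1 _ one_ne_zero
  have hctr : σ₂.reg .ctr = 0 :=
    (hreg .ctr trivial).trans (hσ₁.reg _ (by simp) (by simp) (by simp) (by simp))
  have hheads (a : List ℕ) : σ₂.heap (4 :: a) = 0 :=
    (hheap _ fun e _ => by simp [IndexCell]).trans (hzero₁ 4 a (by simp))
  refine ⟨σ₂, ?_, hσ₁.loaded.congr hreg fun a => hheap _ fun e _ => not_indexCell_zero_cons _ _,
    hindexed, ⟨hctr, fun j hj hj' => ?_, .zero hheads⟩, List.nodup_nil, ?_⟩
  · rw [Nat.add_mul]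
    exact hruns₁.seq hruns₂
  · exact absurd (hj.trans hj') (by simp)
  · rw [show agreeing (fun v => Z.map v) ([] : List (Fin n → ℕ)) = ∅ by simp [agreeing]]
    exact .empty _

/-- The program that reads the input, builds the index, and visits the solutions of the query with
the atoms of the ears in `es`. -/
noncomputable def mirrorProgram (es : List (Ear S n)) (Z : List (Fin n))
    (g : Fin n → Fin n) : Cmd :=
  .seq (preprocess es) (loops es (visitor (earVars es) Z g))

end Program

section Mirror

variable {S : Schema} {q : FullCQ S} {I : Finset (Atom S q.numVars)} {Z : List (Fin q.numVars)}
  {g : Fin q.numVars → Fin q.numVars} {es : List (Ear S q.numVars)} {D : Database S}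
  {rows : Rows S} {w : List ℕ} {h : List (Fin q.numVars → ℕ)}

theorem Splitting.injOn_combineTuple (hq : Splitting q I Z g) (hh : ListsSolutions D I h) :
    Set.InjOn (combineTuple (varsOf I) g) (agreeing (fun v => Z.map v) h) := by
  rintro ⟨s, s'⟩ ⟨hs, hs', hss'⟩ ⟨u, u'⟩ ⟨hu, hu', huu'⟩ heq
  have hinj := hq.combine_inj s s' u u' (List.map_inj_left.mp hss') (List.map_inj_left.mp huu')
    (List.ofFn_injective heq)
  exact Prod.ext (hh.eq_of_eqOn hs hu fun x hx => (hinj x hx).1)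
    (hh.eq_of_eqOn hs' hu' fun x hx => (hinj x hx).2)

theorem Splitting.image_combineTuple (hq : Splitting q I Z g) (hh : ListsSolutions D I h) :
    combineTuple (varsOf I) g '' agreeing (fun v => Z.map v) h = List.ofFn '' q.solutions D := by
  apply Set.Subset.antisymm
  · rintro _ ⟨⟨s, s'⟩, ⟨hs, hs', hss'⟩, rfl⟩
    exact ⟨_, hq.combine_mem D s s' ((hh s).mp hs).2 ((hh s').mp hs').2
      (List.map_inj_left.mp hss'), rfl⟩
  · rintro _ ⟨v, hv, rfl⟩
    obtain ⟨s, s', hs, hs', hss', rfl⟩ := hq.exists_combine D v hv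
    have hcut (s : Fin q.numVars → ℕ) (x) (hx : x ∈ varsOf I) : (varsOf I).indicator s x = s x :=
      Set.indicator_of_mem hx s
    refine ⟨⟨(varsOf I).indicator s, (varsOf I).indicator s'⟩,
      ⟨hh.indicator_mem hs, hh.indicator_mem hs', List.map_congr_left fun x hx => ?_⟩,
      congrArg List.ofFn (combine_congr hq.partner_mem (hcut s) (hcut s'))⟩
    exact (hcut s x (hq.shared_mem x hx)).trans
      ((hss' x hx).trans (hcut s' x (hq.shared_mem x hx)).symm)

theorem Enumerating.loops_exec {σ : State} (hrows : rows.Lists D) (hes : EarList es)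
    (hI : ∀ a, (∃ e ∈ es, e.atom = a) ↔ a ∈ I) (hq : Splitting q I Z g)
    (hσ : Enumerating rows (es.reverseAux []) (varsOf I) Z g [] [] σ) :
    ∃ t σ' h, Exec w (loops es (visitor (varsOf I) Z g)) σ t σ' ∧
      Gap (loopsDelay es (visitorDelay Z)) t ∧ ListsSolutions D I h ∧
      IsListing (combineTuple (varsOf I) g) (agreeing (fun v => Z.map v) h) (outputs t) := by
  rw [← earVars_eq_varsOf hI] at hσ ⊢
  have hZ (x) (hx : x ∈ Z) : x ∈ earVars es := earVars_eq_varsOf hI ▸ hq.shared_mem x hx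
  have hg (x) (hx : x ∉ earVars es) : g x ∈ earVars es := by
    rw [earVars_eq_varsOf hI] at hx ⊢
    exact hq.partner_mem x hx
  obtain ⟨t, σ', h, hvisit⟩ := loops_visits (w := w) hrows.nodup hes loopInvariant_enumerating
    (fun s hs => ⟨by simp, hs.2⟩) (visitor_visits hZ hg) [] [] σ hσ (by simp) (by simp)
  refine ⟨t, σ', h, hvisit.exec, hvisit.gap, fun s => ?_, hvisit.inv.listing⟩
  simp [hvisit.mem_iff, hrows.forall_ears_iff_sat hI, earVars_eq_varsOf hI]

theorem Splitting.mirrorProgram_exec (hq : Splitting q I Z g) (hes : EarList es)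
    (hI : ∀ a, (∃ e ∈ es, e.atom = a) ↔ a ∈ I) :
    ∃ κ, ∀ (D : Database S) (w : List ℕ), D.IsEncoding w → ∃ i t σ, i ≤ κ * (D.size + 1) ∧
      Exec w (mirrorProgram es Z g) State.blank (silent i ++ t) σ ∧
      Gap (loopsDelay es (visitorDelay Z)) t ∧ (outputs t).Nodup ∧
      ∀ o, o ∈ outputs t ↔ o ∈ List.ofFn '' q.solutions D := by
  obtain ⟨κ, hκ⟩ := preprocess_runs hes
  refine ⟨κ, fun D w hw => ?_⟩
  obtain ⟨rows, hrows, rfl⟩ := hw.exists_rows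
  obtain ⟨σ₁, ⟨i, hi, hpre⟩, hσ₁⟩ := hκ rows D.size (varsOf I) Z g hrows.length_le_size
  obtain ⟨t, σ, h, hloops, hgap, hh, hlist⟩ := hσ₁.loops_exec hrows hes hI hq
  refine ⟨i, t, σ, hi, ?_, hgap, hlist.nodup (hq.injOn_combineTuple hh), fun o => ?_⟩
  · rw [mirrorProgram, earVars_eq_varsOf hI]
    exact hpre.seq hloops
  · rw [hlist.mem_iff, hq.image_combineTuple hh]

end Mirror

end MirrorCQ

theorem mainTheorem7 (S : MirrorCQ.Schema) (q : MirrorCQ.FullCQ S) (hq : q.IsMirror) :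
    q.ConstantDelayEnumerable := by
  obtain ⟨I, Z, g, hacyclic, hsplit⟩ := hq.exists_splitting
  obtain ⟨es, hes, hI⟩ := hacyclic.exists_earList
  obtain ⟨κ, hexec⟩ := hsplit.mirrorProgram_exec hes hI
  exact MirrorCQ.FullCQ.constantDelayEnumerable_of_exec hexec
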